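/- Let $d\ge 1$, $p_1,\dots,p_d\ge 1$, $p=\sum_{j=1}^d p_j$, and let $X=(X_1,\dots,X_d)$ be a random vector in $\mathbb{R}^p$ with $X_j\in\mathbb{R}^{p_j}$ and $E|X|<\infty$. Let $X^1,X^2,\dots$ be i.i.d. copies of $X$, let $\phi_{X_j}$ be the characteristic function of $X_j$, and for $t=(t_1,\dots,t_d)\in\mathbb{R}^p$ put \[ \phi^n_X(t)=\frac1n\sum_{k=1}^n e^{i\langle t,X^k\rangle},\quad \phi^n_{\widetilde X}(t)=\prod_{j=1}^d\Big(\frac1n\sum_{k=1}^n e^{i\langle t_j,X^k_j\rangle}\Big),\quad \phi^{n\star}_{\widetilde X}(t)=\frac1n\sum_{k=1}^n e^{i\sum_{j=1}^d\langle t_j,X_j^{k+j-1}\rangle}, \] where upper (sample) indices are read cyclically modulo $n$ in the last sum. For $\eta:\mathbb{R}^p\to\mathbb{C}$ let \[ \|\eta\|^2_{w_1}=\int_{\mathbb{R}^p}|\eta(t)|^2w_1(t)\,dt,\qquad w_1(t)=\frac{1}{K_p|t|^{p+1}},\qquad K_p=\frac{2\pi^{p/2}\,\Gamma(1/2)}{2\,\Gamma((p+1)/2)},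 \] and set $\mathcal{Q}_n=\|\phi^n_X-\phi^n_{\widetilde X}\|^2_{w_1}$, $\mathcal{Q}^\star_n=\|\phi^n_X-\phi^{n\star}_{\widetilde X}\|^2_{w_1}$; these integrals are finite for every $n \ge 1$. Let \[ R(t,t^0)=\prod_{j=1}^d\phi_{X_j}(t_j-t^0_j)+(d-1)\prod_{j=1}^d\phi_{X_j}(t_j)\overline{\phi_{X_j}(t^0_j)}-\sum_{j=1}^d\phi_{X_j}(t_j-t^0_j)\prod_{\ell\ne j}\phi_{X_\ell}(t_\ell)\overline{\phi_{X_\ell}(t^0_\ell)} . \] (i) Suppose $X_1,\dots,X_d$ are mutually independent. Then there exist jointly measurable complex-valued Gaussian processes $\zeta=(\zeta(t))_{t\in\mathbb{R}^p}$ and $\zeta^\star=(\zeta^\star(t))_{t\in\mathbb{R}^p}$ (the real and imaginary parts of the finite-dimensional marginals being jointly Gaussian) with mean zero, covariance functions $E[\zeta(t)\overline{\zeta(t^0)}]=R(t,t^0)$ and $E[\zeta^\star(t)\overline{\zeta^\star(t^0)}]=2R(t,t^0)$, and the symmetry $\zeta(-t)=\overline{\zeta(t)}$, $\zeta^\star(-t)=\overline{\zeta^\star(t)}$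 almost surely for each $t$. For any such $\zeta$ and $\zeta^\star$, $\|\zeta\|^2_{w_1}$ and $\|\zeta^\star\|^2_{w_1}$ are almost surely finite, and as $n\to\infty$ \[ n\mathcal{Q}_n\xrightarrow{\ \mathcal D\ }\|\zeta\|^2_{w_1},\qquad n\mathcal{Q}^\star_n\xrightarrow{\ \mathcal D\ }\|\zeta^\star\|^2_{w_1}. \] (ii) Suppose $X_1,\dots,X_d$ are not mutually independent. Then $n\mathcal{Q}_n\to\infty$ and $n\mathcal{Q}^\star_n\to\infty$ almost surely. -/

import Mathlib

open MeasureTheory ProbabilityTheory Filter Topology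
open scoped BigOperators ComplexConjugate

noncomputable section

/-- `ℝ^p = ℝ^{p_1} × ⋯ × ℝ^{p_d}` with its Euclidean norm, inner product and Lebesgue measure;
the `j`-th component of `x` is `x j`. -/
abbrev BlockSpace {d : ℕ} (p : Fin d → ℕ) : Type :=
  PiLp 2 (fun j : Fin d => EuclideanSpace ℝ (Fin (p j)))

/-- `K(q, m) = 2 π^{q/2} Γ(1 - m/2) / (m 2^m Γ((q + m)/2))`. -/
def energyConst (q : ℕ) (m : ℝ) : ℝ :=
  (2 * Real.pi ^ ((q : ℝ) / 2) * Real.Gamma (1 - m / 2)) /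
    (m * (2 : ℝ) ^ m * Real.Gamma (((q : ℝ) + m) / 2))

/-- The weight `w₁(t) = (K_p |t|^{p+1})⁻¹`, where `K_p = K(p, 1)` and `p = p_1 + ⋯ + p_d`. -/
def weightOne {d : ℕ} (p : Fin d → ℕ) (t : BlockSpace p) : ℝ :=
  (energyConst (∑ j, p j) 1 * ‖t‖ ^ ((∑ j, p j) + 1))⁻¹

/-- The integrand `|η(t)|² w₁(t)` of the weighted norm. -/
def weightedSq {d : ℕ} (p : Fin d → ℕ) (η : BlockSpace p → ℂ) (t : BlockSpace p) : ℝ :=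
  ‖η t‖ ^ 2 * weightOne p t

/-- `‖η‖²_{w₁} = ∫ |η(t)|² w₁(t) dt`. -/
def weightedNormSq {d : ℕ} (p : Fin d → ℕ) (η : BlockSpace p → ℂ) : ℝ :=
  ∫ t, weightedSq p η t

/-- `e^{i ⟨t, x⟩}`. -/
def expInner {V : Type*} [Inner ℝ V] (t x : V) : ℂ :=
  Complex.exp (((inner ℝ t x : ℝ) : ℂ) * Complex.I)

/-- The empirical joint characteristic function `φ_X^n`. The sample is `x 0, …, x (n - 1)`. -/
def empJoint {d : ℕ} (p : Fin d → ℕ) (n : ℕ) (x : ℕ → BlockSpace p) (t : BlockSpace p) : ℂ :=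
  (n : ℂ)⁻¹ * ∑ k ∈ Finset.range n, expInner t (x k)

/-- The product of the empirical marginal characteristic functions. -/
def empProd {d : ℕ} (p : Fin d → ℕ) (n : ℕ) (x : ℕ → BlockSpace p) (t : BlockSpace p) : ℂ :=
  ∏ j : Fin d, ((n : ℂ)⁻¹ * ∑ k ∈ Finset.range n, expInner (t j) (x k j))

/-- The vector `(X_1^k, X_2^{k+1}, …, X_d^{k+d-1})`, with sample indices read cyclically
modulo `n` (sample points and components are numbered from `0` here). -/
def shiftedPoint {d : ℕ} (p : Fin d → ℕ) (n : ℕ) (x : ℕ → BlockSpace p) (k : ℕ) : BlockSpace p :=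
  WithLp.toLp 2 (fun j : Fin d => x ((k + (j : ℕ)) % n) j)

/-- The simplified empirical characteristic function under independence. -/
def empShifted {d : ℕ} (p : Fin d → ℕ) (n : ℕ) (x : ℕ → BlockSpace p) (t : BlockSpace p) : ℂ :=
  (n : ℂ)⁻¹ * ∑ k ∈ Finset.range n, expInner t (shiftedPoint p n x k)

/-- The difference `φ_X^n - φ_{X̃}^n`. -/
def diffComplete {d : ℕ} (p : Fin d → ℕ) (n : ℕ) (x : ℕ → BlockSpace p) (t : BlockSpace p) : ℂ :=
  empJoint p n x t - empProd p n x t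

/-- The difference `φ_X^n - φ_{X̃}^{n⋆}`. -/
def diffSimplified {d : ℕ} (p : Fin d → ℕ) (n : ℕ) (x : ℕ → BlockSpace p)
    (t : BlockSpace p) : ℂ :=
  empJoint p n x t - empShifted p n x t

/-- The empirical complete measure of mutual dependence `Q_n`. -/
def completeMeasure {d : ℕ} (p : Fin d → ℕ) (n : ℕ) (x : ℕ → BlockSpace p) : ℝ :=
  weightedNormSq p (diffComplete p n x)

/-- The simplified empirical complete measure of mutual dependence `Q_n⋆`. -/
def simplifiedMeasure {d : ℕ} (p : Fin d → ℕ) (n : ℕ) (x : ℕ → BlockSpace p) : ℝ :=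
  weightedNormSq p (diffSimplified p n x)

/-- The characteristic function `φ_{X_j}` of the `j`-th component of `X ∼ μ`. -/
def marginalCharFun {d : ℕ} (p : Fin d → ℕ) (μ : Measure (BlockSpace p)) (j : Fin d)
    (s : EuclideanSpace ℝ (Fin (p j))) : ℂ :=
  charFun (μ.map (fun x : BlockSpace p => x j)) s

/-- The covariance function `R(t, t⁰)`. -/
def limitCov {d : ℕ} (p : Fin d → ℕ) (μ : Measure (BlockSpace p)) (t t₀ : BlockSpace p) : ℂ :=
  (∏ j, marginalCharFun p μ j (t j - t₀ j))
    + ((d : ℂ) - 1) * ∏ j, (marginalCharFun p μ j (t j) * conj (marginalCharFun p μ j (t₀ j)))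
    - ∑ j, marginalCharFun p μ j (t j - t₀ j) *
        ∏ l ∈ Finset.univ.erase j,
          (marginalCharFun p μ l (t l) * conj (marginalCharFun p μ l (t₀ l)))

/-- `ζ` is a (jointly measurable) complex-valued Gaussian process with mean zero and covariance
`E[ζ(t) conj ζ(t⁰)] = C(t, t⁰)`, having the Hermitian symmetry `ζ(-t) = conj ζ(t)` of
characteristic functions. Gaussian means: the real and imaginary parts of the finite-dimensional
marginals are jointly Gaussian. The symmetry amounts to `E[ζ(t) ζ(t⁰)] = C(t, -t⁰)`; without it
the covariance would not determine the law of a complex Gaussian process. -/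
structure IsHermitianGaussianProcess {V Ω' : Type*} [MeasurableSpace V] [Neg V]
    [MeasurableSpace Ω'] (ζ : V → Ω' → ℂ) (P' : Measure Ω') (C : V → V → ℂ) : Prop where
  measurable : Measurable (fun z : V × Ω' => ζ z.1 z.2)
  gaussian : IsGaussianProcess ζ P'
  mean_zero : ∀ t, ∫ ω, ζ t ω ∂P' = 0
  covariance : ∀ t t₀, ∫ ω, ζ t ω * conj (ζ t₀ ω) ∂P' = C t t₀
  hermitian : ∀ t, ∀ᵐ ω ∂P', ζ (-t) ω = conj (ζ t ω)

end

/-! Write e_j for e^{i⟨t_j, x_j⟩} and φ_j for the marginal characteristic functions. The case of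
independence rests on one function, the kernel `dependenceKernel`, H(t, x) = ∏ e_j − ∏ φ_j − Σ_j
(e_j − φ_j) ∏_{l≠j} φ_l, which is e^{i⟨t, x⟩} minus its projection onto sums of functions of one
block. It is degenerate (integrating out all blocks but one gives zero,
`isDegenerate_dependenceKernel`), and its covariance under `μ` is exactly R
(`integral_dependenceKernel_mul_conj`).

Both statistics are averages of H. For the complete one, the linear terms subtracted in H are those
of the expansion of ∏ φ_j^n, so the difference is the mean of H(t, X^k) minus a remainder of second
order in the deviations φ_j^n − φ_j. Deviations of different blocks are independent, so the
remainder has mean square O(n⁻²), and the ordinary central limit theorem gives covariance R. For the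
simplified one the linear terms cancel, because a cyclic shift permutes the sample of each block.
What is left is the mean of H at the sample points minus the mean of H at the shifted points. For n
≥ d, two different points among these 2n share at most one entry, so degeneracy makes all 2n terms
orthogonal; this is the factor 2 in the covariance. The terms are not independent, but each involves
only d cyclically consecutive observations, and Bernstein blocking
(`tendsto_integral_cexp_sub_shifted`) gives the central limit theorem.

Passing from finite-dimensional limits to the weighted norm needs no tightness in a function space.
The second moments of the processes are at most a multiple of `charEnvelope`, which is integrable
against w₁ because E|X| < ∞. `tendstoInDistribution_integral` truncates the integrand at a multiple
of this majorant. The truncated integral is bounded, its moments are integrals of finite-dimensional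
expectations, and the method of moments applies. The error is small in L¹ because the second moments
themselves converge.

The limit processes are Gaussian series whose coefficients are those of H(t, ·) in a real
orthonormal basis of L²(μ). Partial sums whose length depends measurably on t converge almost surely
and give joint measurability with no appeal to continuity.

Without independence, both differences converge almost surely, for each t, to φ_X − ∏ φ_j. This
function is continuous and not identically zero, so Fubini and Fatou bound Q_n and Q_n⋆ below by a
positive constant for all large n, and the factor n sends both to infinity. -/

lemma energyConst_one_pos {q : ℕ} (hq : 1 ≤ q) : 0 < energyConst q 1 := by
  have h1 : (0 : ℝ) < q := by exact_mod_cast hq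
  unfold energyConst
  have h2 : 0 < Real.Gamma (1 - 1 / 2) := Real.Gamma_pos_of_pos (by norm_num)
  have h3 : 0 < Real.Gamma (((q : ℝ) + 1) / 2) := Real.Gamma_pos_of_pos (by positivity)
  have := Real.pi_pos
  positivity

/-! ### The weight w₁ and the integrable envelope -/

section Weight

variable {d : ℕ} {p : Fin d → ℕ}

lemma one_le_sum_dim (hd : 1 ≤ d) (hp : ∀ j, 1 ≤ p j) : 1 ≤ ∑ j, p j :=
  (hp ⟨0, hd⟩).trans (Finset.single_le_sum (f := p) (fun _ _ => Nat.zero_le _) (Finset.mem_univ _))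

lemma finrank_blockSpace : Module.finrank ℝ (BlockSpace p) = ∑ j, p j := by
  rw [(WithLp.linearEquiv 2 ℝ (∀ j, EuclideanSpace ℝ (Fin (p j)))).finrank_eq,
    Module.finrank_pi_fintype]
  simp

lemma energyConst_nonneg (q : ℕ) : 0 ≤ energyConst q 1 := by
  unfold energyConst
  have h2 : 0 < Real.Gamma (1 - 1 / 2) := Real.Gamma_pos_of_pos (by norm_num)
  have h3 : 0 < Real.Gamma (((q : ℝ) + 1) / 2) := Real.Gamma_pos_of_pos (by positivity)
  have := Real.pi_pos
  positivity

lemma weightOne_nonneg (t : BlockSpace p) : 0 ≤ weightOne p t := by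
  have := energyConst_nonneg (∑ j, p j)
  unfold weightOne
  positivity

lemma weightOne_pos (hd : 1 ≤ d) (hp : ∀ j, 1 ≤ p j) {t : BlockSpace p} (ht : t ≠ 0) :
    0 < weightOne p t := by
  have := energyConst_one_pos (one_le_sum_dim hd hp)
  have := norm_pos_iff.2 ht
  unfold weightOne
  positivity

lemma measurable_weightOne : Measurable (weightOne p) := by
  unfold weightOne; fun_prop

lemma nontrivial_blockSpace (hd : 1 ≤ d) (hp : ∀ j, 1 ≤ p j) : Nontrivial (BlockSpace p) := by
  apply Module.nontrivial_of_finrank_pos (R := ℝ)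
  rw [finrank_blockSpace]
  exact one_le_sum_dim hd hp

/-- In polar coordinates the Jacobian r^{p−1} turns the integrand into a constant on (0, 1] and into
at most a multiple of r⁻² on (1, ∞). -/
lemma integrable_min_norm_sq_weightOne (hd : 1 ≤ d) (hp : ∀ j, 1 ≤ p j) :
    Integrable (fun t : BlockSpace p => (min ‖t‖ 2) ^ 2 * weightOne p t) := by
  have := nontrivial_blockSpace hd hp
  set q := ∑ j, p j with hq
  have hq1 : 1 ≤ q := one_le_sum_dim hd hp
  have key : Integrable (fun t : BlockSpace p =>
      (fun r : ℝ => (min r 2) ^ 2 * (energyConst q 1 * r ^ (q + 1))⁻¹) ‖t‖) := by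
    rw [integrable_fun_norm_addHaar volume
      (f := fun r : ℝ => (min r 2) ^ 2 * (energyConst q 1 * r ^ (q + 1))⁻¹), finrank_blockSpace,
      ← hq, ← Set.Ioc_union_Ioi_eq_Ioi (zero_le_one : (0 : ℝ) ≤ 1), integrableOn_union]
    clear_value q
    constructor
    · have : IntegrableOn (fun _ : ℝ => (energyConst q 1)⁻¹) (Set.Ioc 0 1) := by simp
      refine this.congr_fun ?_ measurableSet_Ioc
      intro r hr
      have hr0 : r ≠ 0 := hr.1.ne'
      have hmin : min r 2 = r := min_eq_left (hr.2.trans one_le_two)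
      obtain ⟨m, rfl⟩ : ∃ m, q = m + 1 := ⟨q - 1, by omega⟩
      simp only [hmin, add_tsub_cancel_right, smul_eq_mul]
      field_simp
      ring
    · have : IntegrableOn (fun r : ℝ => 4 * (energyConst q 1)⁻¹ * r ^ (-2 : ℝ)) (Set.Ioi 1) :=
        (integrableOn_Ioi_rpow_of_lt (by norm_num) zero_lt_one).const_mul _
      refine Integrable.mono' this ?_ ?_
      · exact (by fun_prop : Measurable _).aestronglyMeasurable
      · refine (ae_restrict_iff' measurableSet_Ioi).2 (ae_of_all _ fun r hr => ?_)
        have hr0 : (0 : ℝ) < r := zero_lt_one.trans hr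
        have hm : 0 ≤ min r 2 := le_min hr0.le zero_le_two
        have hm2 : (min r 2) ^ 2 ≤ 4 := by
          have := min_le_right r 2
          nlinarith
        have hK := energyConst_one_pos hq1
        obtain ⟨m, rfl⟩ : ∃ m, q = m + 1 := ⟨q - 1, by omega⟩
        rw [Real.norm_of_nonneg (by simp only [smul_eq_mul]; positivity), Real.rpow_neg hr0.le]
        simp only [add_tsub_cancel_right, smul_eq_mul, Real.rpow_ofNat]
        calc r ^ m * ((min r 2) ^ 2 * (energyConst (m + 1) 1 * r ^ (m + 1 + 1))⁻¹)
            = (min r 2) ^ 2 * ((energyConst (m + 1) 1)⁻¹ * (r ^ 2)⁻¹) := by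
              rw [mul_inv]; field_simp; ring
          _ ≤ 4 * ((energyConst (m + 1) 1)⁻¹ * (r ^ 2)⁻¹) := by gcongr
          _ = _ := by ring
  exact key

/-- The scaling `∫ min(|t| a, 2)² w₁(t) dt = a ∫ min(|t|, 2)² w₁(t) dt`. -/
lemma integrable_min_mul_sq_weightOne (hd : 1 ≤ d) (hp : ∀ j, 1 ≤ p j) {a : ℝ} (ha : 0 ≤ a) :
    Integrable (fun t : BlockSpace p => (min (‖t‖ * a) 2) ^ 2 * weightOne p t) ∧
    ∫ t : BlockSpace p, (min (‖t‖ * a) 2) ^ 2 * weightOne p t =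
      a * ∫ t : BlockSpace p, (min ‖t‖ 2) ^ 2 * weightOne p t := by
  rcases ha.eq_or_lt with rfl | ha
  · simp
  -- The weight is homogeneous of degree −(p+1). The factor a^{p+1} meets the Jacobian a^{−p} of t ↦
  -- a t, and one power of a survives.
  have h1 : ∀ t : BlockSpace p, (min (‖t‖ * a) 2) ^ 2 * weightOne p t =
      a ^ ((∑ j, p j) + 1) * ((min ‖a • t‖ 2) ^ 2 * weightOne p (a • t)) := by
    intro t
    simp only [weightOne, norm_smul, Real.norm_of_nonneg ha.le]
    rw [mul_comm a ‖t‖, mul_pow, mul_inv, mul_inv, mul_inv]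
    field_simp
  simp_rw [h1]
  refine ⟨((integrable_comp_smul_iff volume _ ha.ne').2
    (integrable_min_norm_sq_weightOne hd hp)).const_mul _, ?_⟩
  rw [integral_const_mul, Measure.integral_comp_smul volume
    (fun t : BlockSpace p => (min ‖t‖ 2) ^ 2 * weightOne p t), finrank_blockSpace,
    abs_of_nonneg (by positivity), smul_eq_mul, pow_succ]
  field_simp

/-- The second-moment envelope `∫ min(|t| |x|, 2)² dμ(x)` of `e^{i⟨t, X⟩} - 1`. -/
noncomputable def charEnvelope {d : ℕ} (p : Fin d → ℕ) (μ : Measure (BlockSpace p))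
    (t : BlockSpace p) : ℝ :=
  ∫ x, (min (‖t‖ * ‖x‖) 2) ^ 2 ∂μ

lemma integrable_min_sq (μ : Measure (BlockSpace p)) [IsFiniteMeasure μ] (t : BlockSpace p) :
    Integrable (fun x => (min (‖t‖ * ‖x‖) 2) ^ 2) μ := by
  refine Integrable.of_bound (by fun_prop) 4 (ae_of_all _ fun x => ?_)
  have h0 : 0 ≤ min (‖t‖ * ‖x‖) 2 := by positivity
  have h1 := min_le_right (‖t‖ * ‖x‖) 2
  rw [Real.norm_of_nonneg (by positivity)]
  nlinarith

lemma charEnvelope_nonneg (μ : Measure (BlockSpace p)) (t : BlockSpace p) :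
    0 ≤ charEnvelope p μ t := integral_nonneg fun _ => by positivity

lemma measurable_charEnvelope (μ : Measure (BlockSpace p)) [IsFiniteMeasure μ] :
    Measurable (charEnvelope p μ) := by
  have : StronglyMeasurable (fun z : BlockSpace p × BlockSpace p =>
      (min (‖z.1‖ * ‖z.2‖) 2) ^ 2) := (by fun_prop : Measurable _).stronglyMeasurable
  exact this.integral_prod_right.measurable

/-- By Fubini the integral over t comes first and is a constant times |x|, so the first moment of
`μ` is exactly what is needed. -/
lemma integrable_charEnvelope_weightOne (hd : 1 ≤ d) (hp : ∀ j, 1 ≤ p j)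
    (μ : Measure (BlockSpace p)) [IsFiniteMeasure μ]
    (hμ : Integrable (fun x : BlockSpace p => ‖x‖) μ) :
    Integrable (fun t => charEnvelope p μ t * weightOne p t) := by
  have hm : Measurable (fun z : BlockSpace p × BlockSpace p =>
      (min (‖z.1‖ * ‖z.2‖) 2) ^ 2 * weightOne p z.1) := by
    have : Measurable (fun z : BlockSpace p × BlockSpace p => weightOne p z.1) :=
      measurable_weightOne.comp measurable_fst
    exact Measurable.mul (by fun_prop) this
  have h : Integrable (fun z : BlockSpace p × BlockSpace p =>
      (min (‖z.1‖ * ‖z.2‖) 2) ^ 2 * weightOne p z.1) (volume.prod μ) := by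
    rw [integrable_prod_iff' hm.aestronglyMeasurable]
    refine ⟨ae_of_all _ fun x =>
      (integrable_min_mul_sq_weightOne hd hp (norm_nonneg x)).1, ?_⟩
    have : ∀ x : BlockSpace p, ∫ t : BlockSpace p, ‖(min (‖t‖ * ‖x‖) 2) ^ 2 * weightOne p t‖ =
        ‖x‖ * ∫ t : BlockSpace p, (min ‖t‖ 2) ^ 2 * weightOne p t := by
      intro x
      rw [← (integrable_min_mul_sq_weightOne hd hp (norm_nonneg x)).2]
      refine integral_congr_ae (ae_of_all _ fun t => ?_)
      exact Real.norm_of_nonneg (mul_nonneg (by positivity) (weightOne_nonneg t))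
    simp_rw [this]
    exact hμ.mul_const _
  refine h.integral_prod_left.congr (ae_of_all _ fun t => ?_)
  simp only [charEnvelope]
  rw [integral_mul_const]

end Weight

/-! ### Convergence in distribution of integrals of nonnegative processes -/

section IntegralFunctional

lemma integral_polynomial_eval {Ω : Type*} [MeasurableSpace Ω] {P : Measure Ω} {Z : Ω → ℝ}
    (hZ : ∀ m : ℕ, Integrable (fun ω => Z ω ^ m) P) (q : Polynomial ℝ) :
    ∫ ω, q.eval (Z ω) ∂P = q.sum (fun m a => a * ∫ ω, Z ω ^ m ∂P) := by
  simp_rw [Polynomial.eval_eq_sum, Polynomial.sum]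
  rw [integral_finsetSum _ (fun m _ => (hZ m).const_mul _)]
  simp_rw [integral_const_mul]

/-- The method of moments for uniformly bounded random variables. -/
lemma tendsto_integral_comp_of_tendsto_moments {Ω Ω' : Type*} [MeasurableSpace Ω]
    [MeasurableSpace Ω'] {P : Measure Ω} {P' : Measure Ω'} [IsProbabilityMeasure P]
    [IsProbabilityMeasure P'] {Z : ℕ → Ω → ℝ} {W : Ω' → ℝ} {C : ℝ}
    (hZ : ∀ n, AEMeasurable (Z n) P) (hW : AEMeasurable W P')
    (hZC : ∀ n ω, Z n ω ∈ Set.Icc 0 C) (hWC : ∀ ω, W ω ∈ Set.Icc 0 C)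
    (hmom : ∀ m : ℕ, Tendsto (fun n => ∫ ω, Z n ω ^ m ∂P) atTop (𝓝 (∫ ω, W ω ^ m ∂P')))
    {F : ℝ → ℝ} (hF : Continuous F) :
    Tendsto (fun n => ∫ ω, F (Z n ω) ∂P) atTop (𝓝 (∫ ω, F (W ω) ∂P')) := by
  obtain ⟨B, hB⟩ : ∃ B, ∀ x ∈ Set.Icc 0 C, ‖F x‖ ≤ B :=
    isCompact_Icc.exists_bound_of_continuousOn hF.continuousOn
  have hpow : ∀ {x : ℝ}, x ∈ Set.Icc 0 C → ∀ m : ℕ, ‖x ^ m‖ ≤ C ^ m := fun hx m => by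
    rw [Real.norm_of_nonneg (pow_nonneg hx.1 _)]
    exact pow_le_pow_left₀ hx.1 hx.2 _
  have hiZ : ∀ n (m : ℕ), Integrable (fun ω => Z n ω ^ m) P := fun n m =>
    Integrable.of_bound ((hZ n).pow_const m).aestronglyMeasurable (C ^ m)
      (ae_of_all _ fun ω => hpow (hZC n ω) m)
  have hiW : ∀ (m : ℕ), Integrable (fun ω => W ω ^ m) P' := fun m =>
    Integrable.of_bound (hW.pow_const m).aestronglyMeasurable (C ^ m)
      (ae_of_all _ fun ω => hpow (hWC ω) m)
  have hqZ : ∀ n (q : Polynomial ℝ), Integrable (fun ω => q.eval (Z n ω)) P := fun n q => by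
    simp_rw [Polynomial.eval_eq_sum, Polynomial.sum]
    exact integrable_finsetSum _ fun m _ => (hiZ n m).const_mul _
  have hqW : ∀ (q : Polynomial ℝ), Integrable (fun ω => q.eval (W ω)) P' := fun q => by
    simp_rw [Polynomial.eval_eq_sum, Polynomial.sum]
    exact integrable_finsetSum _ fun m _ => (hiW m).const_mul _
  have hFZ : ∀ n, Integrable (fun ω => F (Z n ω)) P := fun n =>
    Integrable.of_bound (hF.measurable.comp_aemeasurable (hZ n)).aestronglyMeasurable B
      (ae_of_all _ fun ω => hB _ (hZC n ω))
  have hFW : Integrable (fun ω => F (W ω)) P' :=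
    Integrable.of_bound (hF.measurable.comp_aemeasurable hW).aestronglyMeasurable B
      (ae_of_all _ fun ω => hB _ (hWC ω))
  rw [Metric.tendsto_atTop]
  intro ε hε
  -- Weierstrass: moments control polynomials, and replacing `F` by `q` costs at most ε/4 on each
  -- side.
  obtain ⟨q, hq⟩ := exists_polynomial_near_of_continuousOn 0 C F hF.continuousOn (ε / 4)
    (by positivity)
  have hlim : Tendsto (fun n => ∫ ω, q.eval (Z n ω) ∂P) atTop (𝓝 (∫ ω, q.eval (W ω) ∂P')) := by
    rw [integral_polynomial_eval hiW]
    simp_rw [integral_polynomial_eval (hiZ _), Polynomial.sum]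
    exact tendsto_finsetSum _ fun m _ => (hmom m).const_mul _
  obtain ⟨N, hN⟩ := Metric.tendsto_atTop.1 hlim (ε / 4) (by positivity)
  refine ⟨N, fun n hn => ?_⟩
  have h1 : |∫ ω, q.eval (Z n ω) ∂P - ∫ ω, F (Z n ω) ∂P| ≤ ε / 4 := by
    rw [← integral_sub (hqZ n q) (hFZ n)]
    have := norm_integral_le_of_norm_le_const (μ := P) (C := ε / 4)
      (f := fun ω => q.eval (Z n ω) - F (Z n ω))
      (ae_of_all _ fun ω => (hq _ (hZC n ω)).le)
    simpa using this
  have h2 : |∫ ω, q.eval (W ω) ∂P' - ∫ ω, F (W ω) ∂P'| ≤ ε / 4 := by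
    rw [← integral_sub (hqW q) hFW]
    have := norm_integral_le_of_norm_le_const (μ := P') (C := ε / 4)
      (f := fun ω => q.eval (W ω) - F (W ω))
      (ae_of_all _ fun ω => (hq _ (hWC ω)).le)
    simpa using this
  have h3 := hN n hn
  rw [Real.dist_eq] at h3 ⊢
  rw [abs_lt] at *
  rw [abs_le] at h1 h2
  constructor <;> linarith

variable {T Ω : Type*} [MeasurableSpace T] [MeasurableSpace Ω] {ν : Measure T} [SigmaFinite ν]
  {P : Measure Ω} [IsProbabilityMeasure P]

omit [SigmaFinite ν] [IsProbabilityMeasure P] in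
lemma measurable_integral_left [SFinite ν] {E : Type*} [NormedAddCommGroup E] [NormedSpace ℝ E]
    [MeasurableSpace E] [BorelSpace E] [SecondCountableTopology E] {f : T → Ω → E}
    (hf : Measurable (fun z : T × Ω => f z.1 z.2)) : Measurable fun ω => ∫ t, f t ω ∂ν := by
  have : StronglyMeasurable (Function.uncurry fun ω t => f t ω) :=
    (hf.comp measurable_swap).stronglyMeasurable
  exact this.integral_prod_right.measurable

omit [SigmaFinite ν] [IsProbabilityMeasure P] in
lemma measurable_integral_right [SFinite P] {E : Type*} [NormedAddCommGroup E] [NormedSpace ℝ E]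
    [MeasurableSpace E] [BorelSpace E] [SecondCountableTopology E] {f : T → Ω → E}
    (hf : Measurable (fun z : T × Ω => f z.1 z.2)) : Measurable fun t => ∫ ω, f t ω ∂P := by
  have : StronglyMeasurable (Function.uncurry f) := hf.stronglyMeasurable
  exact this.integral_prod_right.measurable

/-- A power of an integral is an integral over a product space. The deterministic majorant `B`
justifies exchanging it with the expectation, so moments of the functional become finite-dimensional
expectations. -/
lemma integral_pow_integral_eq {g : T → Ω → ℝ} {B : T → ℝ}
    (hg : Measurable (fun z : T × Ω => g z.1 z.2)) (h0 : ∀ t ω, 0 ≤ g t ω)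
    (hB : ∀ t ω, g t ω ≤ B t) (hBi : Integrable B ν) (m : ℕ) :
    ∫ ω, (∫ t, g t ω ∂ν) ^ m ∂P =
      ∫ s : Fin m → T, ∫ ω, ∏ i, g (s i) ω ∂P ∂(Measure.pi fun _ => ν) := by
  have h1 : ∀ ω, (∫ t, g t ω ∂ν) ^ m =
      ∫ s : Fin m → T, ∏ i, g (s i) ω ∂(Measure.pi fun _ => ν) := by
    intro ω
    rw [integral_fintype_prod_eq_prod (fun (_ : Fin m) t => g t ω)]
    simp
  simp_rw [h1]
  rw [integral_integral_swap]
  have hBint : Integrable (fun s : Fin m → T => ∏ i, B (s i)) (Measure.pi fun _ => ν) :=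
    Integrable.fintype_prod fun _ => hBi
  have hBint' : Integrable (fun z : Ω × (Fin m → T) => (1 : ℝ) * ∏ i, B (z.2 i))
      (P.prod (Measure.pi fun _ => ν)) := (integrable_const (1 : ℝ)).mul_prod hBint
  refine hBint'.mono' ?_ (ae_of_all _ fun z => ?_)
  · refine (Finset.measurable_prod _ fun i _ => ?_).aestronglyMeasurable
    have : Measurable (fun z : Ω × (Fin m → T) => (z.2 i, z.1)) := by fun_prop
    exact hg.comp this
  · rw [one_mul]
    simp only [Function.uncurry]
    rw [Real.norm_of_nonneg (Finset.prod_nonneg fun i _ => h0 _ _)]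
    exact Finset.prod_le_prod (fun i _ => h0 _ _) fun i _ => hB _ _

omit [SigmaFinite ν] in
/-- A nonnegative jointly measurable process with integrable mean is integrable. -/
lemma integrable_uncurry_of_integral_le {f : T → Ω → ℝ} {G : T → ℝ}
    (hf : Measurable (fun z : T × Ω => f z.1 z.2)) (h0 : ∀ t ω, 0 ≤ f t ω)
    (hfi : ∀ t, Integrable (f t) P) (hfG : ∀ t, ∫ ω, f t ω ∂P ≤ G t) (hG : Integrable G ν) :
    Integrable (fun z : T × Ω => f z.1 z.2) (ν.prod P) := by
  rw [integrable_prod_iff hf.aestronglyMeasurable]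
  refine ⟨ae_of_all _ hfi, hG.mono' ?_ (ae_of_all _ fun t => ?_)⟩
  · exact (measurable_integral_right (f := fun t ω => ‖f t ω‖) hf.norm).aestronglyMeasurable
  · simp_rw [Real.norm_of_nonneg (h0 _ _)]
    rw [Real.norm_of_nonneg (integral_nonneg fun _ => h0 _ _)]
    exact hfG t

/-- Truncating a nonnegative process at `c` moves its integral by the integral of the excess of
the means, on average. -/
lemma integral_abs_integral_sub_min {f : T → Ω → ℝ} {c G : T → ℝ}
    (hf : Measurable (fun z : T × Ω => f z.1 z.2)) (h0 : ∀ t ω, 0 ≤ f t ω)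
    (hfi : ∀ t, Integrable (f t) P) (hfG : ∀ t, ∫ ω, f t ω ∂P ≤ G t) (hG : Integrable G ν)
    (hc : Measurable c) (hc0 : ∀ t, 0 ≤ c t) :
    Integrable (fun ω => ∫ t, f t ω ∂ν) P ∧ Integrable (fun ω => ∫ t, min (f t ω) (c t) ∂ν) P ∧
    ∫ ω, |(∫ t, f t ω ∂ν) - ∫ t, min (f t ω) (c t) ∂ν| ∂P =
      ∫ t, (∫ ω, f t ω ∂P - ∫ ω, min (f t ω) (c t) ∂P) ∂ν := by
  have hF := integrable_uncurry_of_integral_le hf h0 hfi hfG hG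
  have hmeas : Measurable (fun z : T × Ω => min (f z.1 z.2) (c z.1)) :=
    hf.min (hc.comp measurable_fst)
  have hmin : ∀ t ω, 0 ≤ min (f t ω) (c t) := fun t ω => le_min (h0 t ω) (hc0 t)
  have hF' : Integrable (fun z : T × Ω => min (f z.1 z.2) (c z.1)) (ν.prod P) := by
    refine hF.mono' hmeas.aestronglyMeasurable (ae_of_all _ fun z => ?_)
    rw [Real.norm_of_nonneg (hmin _ _)]
    exact min_le_left _ _
  have hi' : ∀ t, Integrable (fun ω => min (f t ω) (c t)) P := fun t => by
    refine (hfi t).mono' (hmeas.comp measurable_prodMk_left).aestronglyMeasurable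
      (ae_of_all _ fun ω => ?_)
    rw [Real.norm_of_nonneg (hmin _ _)]
    exact min_le_left _ _
  refine ⟨hF.integral_prod_right, hF'.integral_prod_right, ?_⟩
  have e1 : ∀ᵐ ω ∂P, |(∫ t, f t ω ∂ν) - ∫ t, min (f t ω) (c t) ∂ν| =
      ∫ t, (f t ω - min (f t ω) (c t)) ∂ν := by
    filter_upwards [hF.prod_left_ae, hF'.prod_left_ae] with ω h1 h2
    rw [integral_sub h1 h2, abs_of_nonneg]
    exact sub_nonneg.2 (integral_mono h2 h1 fun t => min_le_left _ _)
  rw [integral_congr_ae e1]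
  have e2 : ∀ t, ∫ ω, f t ω ∂P - ∫ ω, min (f t ω) (c t) ∂P =
      ∫ ω, (f t ω - min (f t ω) (c t)) ∂P := fun t => (integral_sub (hfi t) (hi' t)).symm
  simp_rw [e2]
  rw [integral_integral_swap]
  exact (hF.sub hF').swap

lemma abs_integral_lipschitz_sub_le {F : ℝ → ℝ} {L : NNReal} (hF : LipschitzWith L F)
    {C : ℝ} (hC : ∀ x y, dist (F x) (F y) ≤ C) {U V : Ω → ℝ} (hU : Integrable U P)
    (hV : Integrable V P) :
    |∫ ω, F (U ω) ∂P - ∫ ω, F (V ω) ∂P| ≤ L * ∫ ω, |U ω - V ω| ∂P := by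
  have hb : ∀ {Z : Ω → ℝ}, Integrable Z P → Integrable (fun ω => F (Z ω)) P := fun {Z} hZ => by
    refine Integrable.of_bound
      (hF.continuous.comp_aestronglyMeasurable hZ.aestronglyMeasurable) (‖F 0‖ + C)
      (ae_of_all _ fun ω => ?_)
    have := hC (Z ω) 0
    rw [dist_eq_norm] at this
    have h2 := norm_le_norm_add_norm_sub' (F (Z ω)) (F 0)
    linarith
  rw [← integral_sub (hb hU) (hb hV), ← integral_const_mul]
  rw [← Real.norm_eq_abs]
  refine (norm_integral_le_integral_norm _).trans ?_
  refine integral_mono_of_nonneg (ae_of_all _ fun _ => norm_nonneg _)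
    ((hU.sub hV).abs.const_mul _) (ae_of_all _ fun ω => ?_)
  have := hF.dist_le_mul (U ω) (V ω)
  rwa [dist_eq_norm, Real.dist_eq] at this

/-- Convergence in distribution of the integral of nonnegative processes whose truncated
finite-dimensional product moments and means converge, under an integrable bound on the means. -/
theorem tendstoInDistribution_integral {Ω' : Type*} [MeasurableSpace Ω'] {P' : Measure Ω'}
    [IsProbabilityMeasure P'] {h : ℕ → T → Ω → ℝ} {k : T → Ω' → ℝ} {G : T → ℝ}
    (hm : ∀ n, Measurable (fun z : T × Ω => h n z.1 z.2))
    (km : Measurable (fun z : T × Ω' => k z.1 z.2))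
    (h0 : ∀ n t ω, 0 ≤ h n t ω) (k0 : ∀ t ω, 0 ≤ k t ω)
    (Gm : Measurable G) (G0 : ∀ t, 0 ≤ G t) (Gi : Integrable G ν) {n₀ : ℕ}
    (hi : ∀ n ≥ n₀, ∀ t, Integrable (h n t) P) (hG : ∀ n ≥ n₀, ∀ t, ∫ ω, h n t ω ∂P ≤ G t)
    (ki : ∀ t, Integrable (k t) P')
    (hmean : ∀ t, Tendsto (fun n => ∫ ω, h n t ω ∂P) atTop (𝓝 (∫ ω, k t ω ∂P')))
    (hfdd : ∀ (m : ℕ) (t : Fin m → T) (c : Fin m → ℝ), (∀ i, 0 ≤ c i) →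
      Tendsto (fun n => ∫ ω, ∏ i, min (h n (t i) ω) (c i) ∂P) atTop
        (𝓝 (∫ ω, ∏ i, min (k (t i) ω) (c i) ∂P'))) :
    (∀ᵐ ω ∂P', Integrable (fun t => k t ω) ν) ∧
    TendstoInDistribution (fun n ω => ∫ t, h n t ω ∂ν) atTop (fun ω => ∫ t, k t ω ∂ν)
      (fun _ => P) P' := by
  have kG : ∀ t, ∫ ω, k t ω ∂P' ≤ G t := fun t =>
    le_of_tendsto (hmean t) (eventually_atTop.2 ⟨n₀, fun n hn => hG n hn t⟩)
  have hZm : ∀ n, Measurable fun ω => ∫ t, h n t ω ∂ν := fun n => measurable_integral_left (hm n)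
  have hWm : Measurable fun ω => ∫ t, k t ω ∂ν :=
    measurable_integral_left km
  refine ⟨(integrable_uncurry_of_integral_le km k0 ki kG Gi).prod_left_ae, ?_⟩
  refine ⟨fun n => (hZm n).aemeasurable, hWm.aemeasurable, ?_⟩
  refine tendsto_iff_forall_lipschitz_integral_tendsto.2 ?_
  rintro F ⟨C, hC⟩ ⟨L, hL⟩
  simp only [ProbabilityMeasure.coe_mk]
  rw [integral_map hWm.aemeasurable hL.continuous.aestronglyMeasurable]
  simp_rw [fun n => integral_map (hZm n).aemeasurable (μ := P) (f := F)
    hL.continuous.aestronglyMeasurable]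
  -- the truncation level `M * G`
  set c : ℕ → T → ℝ := fun M t => M * G t with hc
  have cm : ∀ M, Measurable (c M) := fun M => Gm.const_mul _
  have c0 : ∀ M t, 0 ≤ c M t := fun M t => mul_nonneg M.cast_nonneg (G0 t)
  have ci : ∀ M, Integrable (c M) ν := fun M => Gi.const_mul _
  have hmm : ∀ M n, Measurable fun z : T × Ω => min (h n z.1 z.2) (c M z.1) := fun M n =>
    (hm n).min ((cm M).comp measurable_fst)
  have kmm : ∀ M, Measurable fun z : T × Ω' => min (k z.1 z.2) (c M z.1) := fun M =>
    km.min ((cm M).comp measurable_fst)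
  have hmin0 : ∀ M n t ω, 0 ≤ min (h n t ω) (c M t) := fun M n t ω => le_min (h0 _ _ _) (c0 _ _)
  have kmin0 : ∀ M t ω, 0 ≤ min (k t ω) (c M t) := fun M t ω => le_min (k0 _ _) (c0 _ _)
  have fdd1 : ∀ M t, Tendsto (fun n => ∫ ω, min (h n t ω) (c M t) ∂P) atTop
      (𝓝 (∫ ω, min (k t ω) (c M t) ∂P')) := fun M t => by
    simpa using hfdd 1 (fun _ => t) (fun _ => c M t) (fun _ => c0 M t)
  -- the excess of the means
  set ρ : ℕ → ℝ := fun M =>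
    ∫ t, (∫ ω, k t ω ∂P' - ∫ ω, min (k t ω) (c M t) ∂P') ∂ν with hρ
  have kdiff : ∀ M t, ‖∫ ω, k t ω ∂P' - ∫ ω, min (k t ω) (c M t) ∂P'‖ ≤ G t := fun M t => by
    have h1 : 0 ≤ ∫ ω, min (k t ω) (c M t) ∂P' := integral_nonneg fun _ => kmin0 _ _ _
    have h2 : ∫ ω, min (k t ω) (c M t) ∂P' ≤ ∫ ω, k t ω ∂P' :=
      integral_mono_of_nonneg (ae_of_all _ fun _ => kmin0 _ _ _) (ki t)
        (ae_of_all _ fun _ => min_le_left _ _)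
    rw [Real.norm_of_nonneg (sub_nonneg.2 h2)]
    linarith [kG t]
  have hdiff : ∀ M, ∀ n ≥ n₀, ∀ t,
      ‖∫ ω, h n t ω ∂P - ∫ ω, min (h n t ω) (c M t) ∂P‖ ≤ G t := fun M n hn t => by
    have h1 : 0 ≤ ∫ ω, min (h n t ω) (c M t) ∂P := integral_nonneg fun _ => hmin0 _ _ _ _
    have h2 : ∫ ω, min (h n t ω) (c M t) ∂P ≤ ∫ ω, h n t ω ∂P :=
      integral_mono_of_nonneg (ae_of_all _ fun _ => hmin0 _ _ _ _) (hi n hn t)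
        (ae_of_all _ fun _ => min_le_left _ _)
    rw [Real.norm_of_nonneg (sub_nonneg.2 h2)]
    linarith [hG n hn t]
  -- The convergence of the untruncated means is used here: it makes the L¹ truncation error of the
  -- n-th process converge to that of the limit, with majorant `G` in t.
  have hρn : ∀ M, Tendsto (fun n => ∫ t, (∫ ω, h n t ω ∂P - ∫ ω, min (h n t ω) (c M t) ∂P) ∂ν)
      atTop (𝓝 (ρ M)) := fun M => by
    refine tendsto_integral_filter_of_dominated_convergence G (Eventually.of_forall fun n => ?_)
      (eventually_atTop.2 ⟨n₀, fun n hn => ae_of_all _ (hdiff M n hn)⟩) Gi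
      (ae_of_all _ fun t => (hmean t).sub (fdd1 M t))
    exact (measurable_integral_right (hm n)).aestronglyMeasurable.sub
      (measurable_integral_right (hmm M n)).aestronglyMeasurable
  have hρ0 : Tendsto ρ atTop (𝓝 0) := by
    have : Tendsto ρ atTop (𝓝 (∫ _t, (0 : ℝ) ∂ν)) := by
      refine tendsto_integral_of_dominated_convergence G (fun M => ?_) Gi
        (fun M => ae_of_all _ (kdiff M)) (ae_of_all _ fun t => ?_)
      · exact (measurable_integral_right km).aestronglyMeasurable.sub
          (measurable_integral_right (kmm M)).aestronglyMeasurable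
      · have hlim : Tendsto (fun M : ℕ => ∫ ω, min (k t ω) (c M t) ∂P') atTop
            (𝓝 (∫ ω, k t ω ∂P')) := by
          refine tendsto_integral_of_dominated_convergence (k t)
            (fun M => ((kmm M).comp measurable_prodMk_left).aestronglyMeasurable) (ki t)
            (fun M => ae_of_all _ fun ω => ?_) ?_
          · rw [Real.norm_of_nonneg (kmin0 _ _ _)]
            exact min_le_left _ _
          -- Where `G t = 0` the level never rises, but then the limit process vanishes almost
          -- surely. Elsewhere the level eventually exceeds each value.
          · rcases (G0 t).eq_or_lt with hGt | hGt
            · have hz : ∫ ω, k t ω ∂P' = 0 := le_antisymm ((kG t).trans hGt.symm.le)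
                (integral_nonneg (k0 t))
              have := (integral_eq_zero_iff_of_nonneg (k0 t) (ki t)).1 hz
              filter_upwards [this] with ω hω
              have hω' : k t ω = 0 := hω
              simp [hω', c0]
            · refine ae_of_all _ fun ω => ?_
              have : ∀ᶠ M : ℕ in atTop, k t ω ≤ c M t :=
                (tendsto_natCast_atTop_atTop.atTop_mul_const hGt).eventually_ge_atTop _
              refine (tendsto_const_nhds (x := k t ω)).congr' ?_
              filter_upwards [this] with M hM
              exact (min_eq_left hM).symm
        simpa using (tendsto_const_nhds (x := ∫ ω, k t ω ∂P')).sub hlim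
    simpa using this
  -- the truncated functionals converge
  have htr : ∀ M, Tendsto (fun n => ∫ ω, F (∫ t, min (h n t ω) (c M t) ∂ν) ∂P) atTop
      (𝓝 (∫ ω, F (∫ t, min (k t ω) (c M t) ∂ν) ∂P')) := fun M => by
    refine tendsto_integral_comp_of_tendsto_moments (C := ∫ t, c M t ∂ν)
      (fun n => (measurable_integral_left (hmm M n)).aemeasurable)
      (measurable_integral_left (kmm M)).aemeasurable
      (fun n ω => ⟨integral_nonneg fun t => hmin0 M n t ω,
        integral_mono_of_nonneg (ae_of_all _ fun t => hmin0 M n t ω) (ci M)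
          (ae_of_all _ fun t => min_le_right _ _)⟩)
      (fun ω => ⟨integral_nonneg fun t => kmin0 M t ω,
        integral_mono_of_nonneg (ae_of_all _ fun t => kmin0 M t ω) (ci M)
          (ae_of_all _ fun t => min_le_right _ _)⟩) (fun m => ?_) hL.continuous
    -- The truncation level is integrable in t, so its products dominate the m-fold integrands and
    -- `hfdd` passes under the integral.
    rw [integral_pow_integral_eq (kmm M) (kmin0 M) (fun t ω => min_le_right _ _) (ci M)]
    simp_rw [fun n => integral_pow_integral_eq (P := P) (hmm M n) (hmin0 M n)
      (fun t ω => min_le_right _ _) (ci M) m]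
    refine tendsto_integral_of_dominated_convergence (fun s : Fin m → T => ∏ i, c M (s i))
      (fun n => ?_) (Integrable.fintype_prod fun _ => ci M)
      (fun n => ae_of_all _ fun s => ?_)
      (ae_of_all _ fun s => hfdd m s (fun i => c M (s i)) fun i => c0 M _)
    · have : Measurable fun z : (Fin m → T) × Ω => ∏ i, min (h n (z.1 i) z.2) (c M (z.1 i)) := by
        refine Finset.measurable_prod _ fun i _ => ?_
        have h2 : Measurable (fun z : (Fin m → T) × Ω => (z.1 i, z.2)) := by fun_prop
        exact (hmm M n).comp h2
      exact (measurable_integral_right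
        (f := fun (s : Fin m → T) ω => ∏ i, min (h n (s i) ω) (c M (s i)))
        this).aestronglyMeasurable
    · have := norm_integral_le_of_norm_le_const (μ := P) (C := ∏ i, c M (s i))
        (f := fun ω => ∏ i, min (h n (s i) ω) (c M (s i))) (ae_of_all _ fun ω => by
          rw [Real.norm_of_nonneg (Finset.prod_nonneg fun i _ => hmin0 _ _ _ _)]
          exact Finset.prod_le_prod (fun i _ => hmin0 _ _ _ _) fun i _ => min_le_right _ _)
      simpa using this
  -- conclusion
  rw [Metric.tendsto_atTop]
  intro ε hε
  have hLρ : Tendsto (fun M => (L : ℝ) * ρ M) atTop (𝓝 0) := by simpa using hρ0.const_mul (L : ℝ)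
  -- The level is fixed from the limit process alone and only then is n taken large. The two
  -- truncation errors and the truncated difference are each below ε/4.
  obtain ⟨M, hM⟩ := (hLρ.eventually_lt_const (show (0 : ℝ) < ε / 4 by positivity)).exists
  have e1 := ((hρn M).const_mul (L : ℝ)).eventually_lt_const hM
  have e2 := (Metric.tendsto_nhds.1 (htr M)) (ε / 4) (by positivity)
  obtain ⟨N, hN⟩ := eventually_atTop.1 ((e1.and e2).and (eventually_ge_atTop n₀))
  refine ⟨N, fun n hn => ?_⟩
  obtain ⟨⟨a1, a2⟩, a3⟩ := hN n hn
  obtain ⟨b1, b2, b3⟩ := integral_abs_integral_sub_min (hm n) (h0 n) (hi n a3) (hG n a3) Gi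
    (cm M) (c0 M)
  obtain ⟨d1, d2, d3⟩ := integral_abs_integral_sub_min km k0 ki kG Gi (cm M) (c0 M)
  have f1 := abs_integral_lipschitz_sub_le hL hC b1 b2
  have f2 := abs_integral_lipschitz_sub_le hL hC d1 d2
  rw [b3] at f1
  rw [d3] at f2
  rw [Real.dist_eq] at a2 ⊢
  rw [abs_le] at f1 f2
  rw [abs_lt] at a2 ⊢
  have hM' : (L : ℝ) * ∫ t, (∫ ω, k t ω ∂P' - ∫ ω, min (k t ω) (c M t) ∂P') ∂ν < ε / 4 := hM
  constructor <;> linarith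

end IntegralFunctional

/-! ### Mixed sample points and degenerate functions -/

section Array

variable {d : ℕ} {p : Fin d → ℕ} {μ : Measure (BlockSpace p)} [IsProbabilityMeasure μ]
  {Ω : Type*} [MeasurableSpace Ω] {P : Measure Ω} [IsProbabilityMeasure P]
  {X : ℕ → Ω → BlockSpace p}

lemma measurable_blockSpace_eval (j : Fin d) : Measurable (fun x : BlockSpace p => x j) := by
  fun_prop

lemma map_ofLp_eq_pi (hμ : iIndepFun (fun (j : Fin d) (x : BlockSpace p) => x j) μ) :
    μ.map (fun x j => x j) = Measure.pi fun j => μ.map (fun x : BlockSpace p => x j) :=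
  (iIndepFun_iff_map_fun_eq_pi_map fun j => (measurable_blockSpace_eval j).aemeasurable).1 hμ

omit [IsProbabilityMeasure μ] [IsProbabilityMeasure P] in
lemma map_eval_comp {Y : Ω → BlockSpace p} (hY : Measurable Y) (hlaw : P.map Y = μ) (j : Fin d) :
    P.map (fun ω => Y ω j) = μ.map (fun x : BlockSpace p => x j) := by
  rw [← hlaw, Measure.map_map (measurable_blockSpace_eval j) hY]
  rfl

lemma iIndepFun_blocks_comp {Y : Ω → BlockSpace p} (hY : Measurable Y) (hlaw : P.map Y = μ)
    (hμ : iIndepFun (fun (j : Fin d) (x : BlockSpace p) => x j) μ) :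
    iIndepFun (fun (j : Fin d) ω => Y ω j) P := by
  have hm : ∀ j, AEMeasurable (fun ω => Y ω j) P := fun j =>
    ((measurable_blockSpace_eval j).comp hY).aemeasurable
  rw [iIndepFun_iff_map_fun_eq_pi_map hm]
  simp_rw [map_eval_comp hY hlaw]
  rw [← map_ofLp_eq_pi hμ, ← hlaw, Measure.map_map (by fun_prop) hY]
  rfl

/-- All the components of all the sample points are mutually independent. -/
lemma iIndepFun_array (hX : ∀ k, Measurable (X k)) (hlaw : ∀ k, P.map (X k) = μ)
    (hindep : iIndepFun X P) (hμ : iIndepFun (fun (j : Fin d) (x : BlockSpace p) => x j) μ) :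
    iIndepFun (fun (q : ℕ × Fin d) ω => X q.1 ω q.2) P := by
  refine iIndepFun_uncurry' (X := fun k j ω => X k ω j) (fun k j => ?_) ?_
    fun k => iIndepFun_blocks_comp (hX k) (hlaw k) hμ
  · exact (measurable_blockSpace_eval j).comp (hX k)
  · exact hindep.comp (fun _ x j => x j) fun _ => by fun_prop

/-- The vector whose `j`-th component is the `j`-th component of the `a j`-th sample point. -/
def mixedPoint {d : ℕ} {p : Fin d → ℕ} (a : Fin d → ℕ) (x : ℕ → BlockSpace p) : BlockSpace p :=
  WithLp.toLp 2 fun j => x (a j) j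

lemma measurable_mixedPoint (hX : ∀ k, Measurable (X k)) (a : Fin d → ℕ) :
    Measurable fun ω => mixedPoint a (fun k => X k ω) := by
  unfold mixedPoint
  refine (WithLp.measurable_toLp 2 _).comp (measurable_pi_lambda _ fun j => ?_)
  exact (measurable_blockSpace_eval j).comp (hX (a j))

/-- The index pairs `(a j, j)` are distinct even if `a` repeats values, so the chosen blocks are
always independent with the right marginals, and under independence `μ` is the product of those
marginals. -/
lemma map_mixedPoint (hX : ∀ k, Measurable (X k)) (hlaw : ∀ k, P.map (X k) = μ)
    (hindep : iIndepFun X P) (hμ : iIndepFun (fun (j : Fin d) (x : BlockSpace p) => x j) μ)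
    (a : Fin d → ℕ) : P.map (fun ω => mixedPoint a fun k => X k ω) = μ := by
  have h1 : iIndepFun (fun (j : Fin d) ω => X (a j) ω j) P :=
    (iIndepFun_array hX hlaw hindep hμ).precomp (g := fun j : Fin d => (a j, j))
      fun i j h => (Prod.ext_iff.1 h).2
  have hm : ∀ j, Measurable (fun ω => X (a j) ω j) := fun j =>
    (measurable_blockSpace_eval j).comp (hX (a j))
  rw [iIndepFun_iff_map_fun_eq_pi_map fun j => (hm j).aemeasurable] at h1
  simp_rw [fun j => map_eval_comp (hX (a j)) (hlaw (a j)) j] at h1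
  rw [← map_ofLp_eq_pi hμ] at h1
  have h2 := congrArg (Measure.map (WithLp.toLp 2)) h1
  rw [Measure.map_map (by fun_prop) (measurable_pi_lambda _ hm),
    Measure.map_map (by fun_prop) (by fun_prop)] at h2
  refine Eq.trans h2 ?_
  exact Measure.map_id

/-- Mixed points without a common entry are independent. -/
lemma map_mixedPoint_prodMk (hX : ∀ k, Measurable (X k)) (hlaw : ∀ k, P.map (X k) = μ)
    (hindep : iIndepFun X P) (hμ : iIndepFun (fun (j : Fin d) (x : BlockSpace p) => x j) μ)
    {a b : Fin d → ℕ} (hab : ∀ j, a j ≠ b j) :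
    P.map (fun ω => (mixedPoint a fun k => X k ω, mixedPoint b fun k => X k ω)) = μ.prod μ := by
  classical
  set S := Finset.univ.image fun j : Fin d => (a j, j)
  set S' := Finset.univ.image fun j : Fin d => (b j, j)
  have hd : Disjoint S S' := by
    rw [Finset.disjoint_left]
    rintro ⟨k, j⟩ h1 h2
    simp only [S, S', Finset.mem_image, Finset.mem_univ, true_and, Prod.mk.injEq] at h1 h2
    obtain ⟨i, hi, rfl⟩ := h1
    obtain ⟨i', hi', rfl⟩ := h2
    exact hab _ (hi.trans hi'.symm)
  have h1 := (iIndepFun_array hX hlaw hindep hμ).indepFun_finset S S' hd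
    fun q => (measurable_blockSpace_eval q.2).comp (hX q.1)
  have hS : ∀ j, (a j, j) ∈ S := fun j => Finset.mem_image_of_mem _ (Finset.mem_univ j)
  have hS' : ∀ j, (b j, j) ∈ S' := fun j => Finset.mem_image_of_mem _ (Finset.mem_univ j)
  have h2 := h1.comp
    (φ := fun (z : ∀ q : S, EuclideanSpace ℝ (Fin (p q.1.2))) =>
      (WithLp.toLp 2 fun j => z ⟨(a j, j), hS j⟩ : BlockSpace p))
    (ψ := fun (z : ∀ q : S', EuclideanSpace ℝ (Fin (p q.1.2))) =>
      (WithLp.toLp 2 fun j => z ⟨(b j, j), hS' j⟩ : BlockSpace p))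
    ((WithLp.measurable_toLp 2 _).comp (measurable_pi_lambda _ fun j =>
      measurable_pi_apply (⟨(a j, j), hS j⟩ : S)))
    ((WithLp.measurable_toLp 2 _).comp (measurable_pi_lambda _ fun j =>
      measurable_pi_apply (⟨(b j, j), hS' j⟩ : S')))
  have h3 := (indepFun_iff_map_prod_eq_prod_map_map
    (measurable_mixedPoint hX a).aemeasurable (measurable_mixedPoint hX b).aemeasurable).1 h2
  rw [h3, map_mixedPoint hX hlaw hindep hμ, map_mixedPoint hX hlaw hindep hμ]

/-- `x` with its `j`-th block replaced by that of `y`. -/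
def replaceBlock {d : ℕ} {p : Fin d → ℕ} (j : Fin d) (x y : BlockSpace p) : BlockSpace p :=
  WithLp.toLp 2 (Function.update (fun i => x i) j (y j))

lemma measurable_replaceBlock (j : Fin d) :
    Measurable fun z : BlockSpace p × BlockSpace p => replaceBlock j z.1 z.2 := by
  classical
  unfold replaceBlock
  refine (WithLp.measurable_toLp 2 _).comp (measurable_pi_lambda _ fun i => ?_)
  rcases eq_or_ne i j with rfl | h
  · simp only [Function.update_self]; fun_prop
  · simp only [Function.update_of_ne h]; fun_prop

/-- A function is degenerate if its mean vanishes when all blocks but one are integrated out. -/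
def IsDegenerate {d : ℕ} {p : Fin d → ℕ} (μ : Measure (BlockSpace p)) (ψ : BlockSpace p → ℂ) :
    Prop :=
  ∀ (j : Fin d) (y : BlockSpace p), ∫ x, ψ (replaceBlock j x y) ∂μ = 0

/-- The index `m` is free because the entry it selects is overwritten at once. This allows the point
`b` to be rebuilt from a point that has nothing in common with `a`. -/
lemma mixedPoint_update_eq_replaceBlock (x : ℕ → BlockSpace p) {a b : Fin d → ℕ} {j : Fin d}
    (hab : a j = b j) (m : ℕ) :
    mixedPoint b x = replaceBlock j (mixedPoint (Function.update b j m) x) (mixedPoint a x) := by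
  unfold mixedPoint replaceBlock
  congr 1
  funext i
  rcases eq_or_ne i j with rfl | h
  · simp [hab]
  · simp [Function.update_of_ne h]

/-- Given the point `a`, the block `j` of the point `b` is frozen and its other blocks are fresh;
degeneracy makes the inner integral vanish. -/
lemma integral_mul_mixedPoint_eq_zero_of_eq (hX : ∀ k, Measurable (X k))
    (hlaw : ∀ k, P.map (X k) = μ) (hindep : iIndepFun X P)
    (hμ : iIndepFun (fun (j : Fin d) (x : BlockSpace p) => x j) μ)
    {φ ψ : BlockSpace p → ℂ} (hφ : Measurable φ) (hψ : Measurable ψ) {C D : ℝ}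
    (hC : ∀ x, ‖φ x‖ ≤ C) (hD : ∀ x, ‖ψ x‖ ≤ D) (hdeg : IsDegenerate μ ψ)
    {a b : Fin d → ℕ} {j : Fin d} (hj : a j = b j) (hab : ∀ i, a i = b i → i = j) :
    ∫ ω, φ (mixedPoint a fun k => X k ω) * ψ (mixedPoint b fun k => X k ω) ∂P = 0 := by
  -- `a j + 1` is just an index different from `a j`, so that the rebuilt pattern avoids `a` in
  -- every block.
  simp_rw [fun ω => mixedPoint_update_eq_replaceBlock (fun k => X k ω) hj (a j + 1)]
  have hb' : ∀ i, a i ≠ Function.update b j (a j + 1) i := by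
    intro i h
    rcases eq_or_ne i j with rfl | hij
    · simp at h
    · rw [Function.update_of_ne hij] at h
      exact hij (hab i h)
  have hlaw2 := map_mixedPoint_prodMk hX hlaw hindep hμ hb'
  have hm : Measurable fun z : BlockSpace p × BlockSpace p =>
      φ z.1 * ψ (replaceBlock j z.2 z.1) :=
    (hφ.comp measurable_fst).mul
      (hψ.comp ((measurable_replaceBlock j).comp measurable_swap))
  have h1 := integral_map (μ := P) ((measurable_mixedPoint hX a).prodMk
    (measurable_mixedPoint hX (Function.update b j (a j + 1)))).aemeasurable
    hm.aestronglyMeasurable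
  rw [← h1, hlaw2, integral_prod]
  · simp_rw [integral_const_mul, hdeg j, mul_zero, integral_zero]
  · refine Integrable.of_bound hm.aestronglyMeasurable (C * D) (ae_of_all _ fun z => ?_)
    rw [norm_mul]
    exact mul_le_mul (hC _) (hD _) (norm_nonneg _) ((norm_nonneg _).trans (hC 0))

/-- The orthogonality relation is applied to the constant 1 and to two patterns that meet in the
first block only; `1 ≤ d` provides that block. -/
lemma IsDegenerate.integral_eq_zero (hd : 1 ≤ d) (hX : ∀ k, Measurable (X k))
    (hlaw : ∀ k, P.map (X k) = μ) (hindep : iIndepFun X P)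
    (hμ : iIndepFun (fun (j : Fin d) (x : BlockSpace p) => x j) μ)
    {ψ : BlockSpace p → ℂ} (hψ : Measurable ψ) {D : ℝ}
    (hD : ∀ x, ‖ψ x‖ ≤ D) (hdeg : IsDegenerate μ ψ) : ∫ x, ψ x ∂μ = 0 := by
  have h := integral_mul_mixedPoint_eq_zero_of_eq hX hlaw hindep hμ (φ := fun _ => 1)
    measurable_const hψ (C := 1) (by simp) hD hdeg (a := fun _ => 0)
    (b := Function.update (fun _ => 1) ⟨0, hd⟩ 0) (j := ⟨0, hd⟩) (by simp) (fun i hi => by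
      by_contra hne
      simp [Function.update_of_ne hne] at hi)
  simp only [one_mul] at h
  rw [← map_mixedPoint hX hlaw hindep hμ (Function.update (fun _ => 1) ⟨0, hd⟩ 0),
    integral_map (measurable_mixedPoint hX _).aemeasurable hψ.aestronglyMeasurable]
  exact h

/-- A degenerate function of a mixed point is orthogonal to every function of a mixed point that
shares at most one entry with it. -/
lemma integral_mul_mixedPoint_eq_zero (hd : 1 ≤ d) (hX : ∀ k, Measurable (X k))
    (hlaw : ∀ k, P.map (X k) = μ) (hindep : iIndepFun X P)
    (hμ : iIndepFun (fun (j : Fin d) (x : BlockSpace p) => x j) μ)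
    {φ ψ : BlockSpace p → ℂ} (hφ : Measurable φ) (hψ : Measurable ψ) {C D : ℝ}
    (hC : ∀ x, ‖φ x‖ ≤ C) (hD : ∀ x, ‖ψ x‖ ≤ D) (hdeg : IsDegenerate μ ψ)
    {a b : Fin d → ℕ} (hab : ∀ i j, a i = b i → a j = b j → i = j) :
    ∫ ω, φ (mixedPoint a fun k => X k ω) * ψ (mixedPoint b fun k => X k ω) ∂P = 0 := by
  by_cases hj : ∃ j, a j = b j
  · obtain ⟨j, hj⟩ := hj
    exact integral_mul_mixedPoint_eq_zero_of_eq hX hlaw hindep hμ hφ hψ hC hD hdeg hj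
      fun i hi => hab i j hi hj
  · push Not at hj
    have hm : Measurable fun z : BlockSpace p × BlockSpace p => φ z.1 * ψ z.2 :=
      (hφ.comp measurable_fst).mul (hψ.comp measurable_snd)
    have h1 := integral_map (μ := P) ((measurable_mixedPoint hX a).prodMk
      (measurable_mixedPoint hX b)).aemeasurable hm.aestronglyMeasurable
    rw [← h1, map_mixedPoint_prodMk hX hlaw hindep hμ hj, integral_prod_mul φ ψ,
      hdeg.integral_eq_zero hd hX hlaw hindep hμ hψ hD, mul_zero]

omit [IsProbabilityMeasure μ] in
/-- The integral of a product of functions of the blocks. -/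
lemma integral_prod_blocks (hμ : iIndepFun (fun (j : Fin d) (x : BlockSpace p) => x j) μ)
    {f : ∀ j, EuclideanSpace ℝ (Fin (p j)) → ℂ} (hf : ∀ j, Measurable (f j)) :
    ∫ x, ∏ j, f j (x j) ∂μ = ∏ j, ∫ x, f j (x j) ∂μ :=
  hμ.integral_fun_prod_comp (fun j => (measurable_blockSpace_eval j).aemeasurable)
    fun j => (hf j).aestronglyMeasurable

end Array

/-! ### Elementary bounds for exponentials and products -/

section ExpInner

variable {V : Type*} [NormedAddCommGroup V] [InnerProductSpace ℝ V]

lemma norm_expInner (t x : V) : ‖expInner t x‖ = 1 := by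
  unfold expInner
  exact Complex.norm_exp_ofReal_mul_I _

lemma continuous_expInner : Continuous fun z : V × V => expInner z.1 z.2 := by
  unfold expInner
  fun_prop

lemma measurable_expInner [MeasurableSpace V] [BorelSpace V] [SecondCountableTopology V] :
    Measurable fun z : V × V => expInner z.1 z.2 := continuous_expInner.measurable

lemma measurable_expInner_right [MeasurableSpace V] [BorelSpace V] [SecondCountableTopology V]
    (t : V) : Measurable fun x : V => expInner t x :=
  measurable_expInner.comp measurable_prodMk_left

lemma expInner_neg_left (t x : V) : expInner (-t) x = conj (expInner t x) := by
  unfold expInner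
  rw [← Complex.exp_conj, inner_neg_left]
  simp

lemma expInner_sub_left (t s x : V) : expInner (t - s) x = expInner t x * conj (expInner s x) := by
  unfold expInner
  rw [← Complex.exp_conj, ← Complex.exp_add, inner_sub_left]
  simp
  ring_nf

lemma norm_expInner_sub_one_le (t x : V) : ‖expInner t x - 1‖ ≤ min (‖t‖ * ‖x‖) 2 := by
  refine le_min ?_ ?_
  · unfold expInner
    rw [mul_comm]
    refine (Real.norm_exp_I_mul_ofReal_sub_one_le).trans ?_
    exact norm_inner_le_norm t x
  · refine (norm_sub_le _ _).trans ?_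
    rw [norm_expInner, norm_one]
    norm_num

end ExpInner

lemma norm_prod_le_one {ι : Type*} (s : Finset ι) {a : ι → ℂ} (ha : ∀ i, ‖a i‖ ≤ 1) :
    ‖∏ i ∈ s, a i‖ ≤ 1 := by
  rw [norm_prod]
  exact Finset.prod_le_one (fun _ _ => norm_nonneg _) fun i _ => ha i

/-- Factors are exchanged one at a time, and the factors not being exchanged have modulus at most 1.
-/
lemma norm_prod_sub_prod_le {ι : Type*} (s : Finset ι) {a b : ι → ℂ} (ha : ∀ i, ‖a i‖ ≤ 1)
    (hb : ∀ i, ‖b i‖ ≤ 1) : ‖∏ i ∈ s, a i - ∏ i ∈ s, b i‖ ≤ ∑ i ∈ s, ‖a i - b i‖ := by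
  classical
  induction s using Finset.induction_on with
  | empty => simp
  | insert i s hi ih =>
    rw [Finset.prod_insert hi, Finset.prod_insert hi, Finset.sum_insert hi]
    have : a i * ∏ x ∈ s, a x - b i * ∏ x ∈ s, b x =
        (a i - b i) * ∏ x ∈ s, a x + b i * (∏ x ∈ s, a x - ∏ x ∈ s, b x) := by ring
    rw [this]
    refine (norm_add_le _ _).trans (add_le_add ?_ ?_)
    · rw [norm_mul]
      exact mul_le_of_le_one_right (norm_nonneg _) (norm_prod_le_one s ha)
    · rw [norm_mul]
      exact (mul_le_of_le_one_left (norm_nonneg _) (hb i)).trans ih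

/-- The remainder in the first-order expansion of a product. -/
lemma norm_prod_sub_linear_le {ι : Type*} [DecidableEq ι] (s : Finset ι) {a b : ι → ℂ}
    (ha : ∀ i, ‖a i‖ ≤ 1) (hb : ∀ i, ‖b i‖ ≤ 1) :
    ‖∏ i ∈ s, a i - ∏ i ∈ s, b i - ∑ i ∈ s, (a i - b i) * ∏ l ∈ s.erase i, b l‖ ≤
      ∑ i ∈ s, ∑ l ∈ s.erase i, ‖a i - b i‖ * ‖a l - b l‖ := by
  induction s using Finset.induction_on with
  | empty => simp
  | insert i s hi ih =>
    rw [Finset.prod_insert hi, Finset.prod_insert hi, Finset.sum_insert hi, Finset.sum_insert hi,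
      Finset.erase_insert hi]
    have h1 : ∑ x ∈ s, (a x - b x) * ∏ l ∈ (insert i s).erase x, b l =
        b i * ∑ x ∈ s, (a x - b x) * ∏ l ∈ s.erase x, b l := by
      rw [Finset.mul_sum]
      refine Finset.sum_congr rfl fun x hx => ?_
      have hne : i ≠ x := fun h => hi (h ▸ hx)
      rw [Finset.erase_insert_of_ne hne, Finset.prod_insert fun h => hi (Finset.mem_of_mem_erase h)]
      ring
    have h2 : ∑ x ∈ s, ∑ l ∈ s.erase x, ‖a x - b x‖ * ‖a l - b l‖ ≤
        ∑ x ∈ s, ∑ l ∈ (insert i s).erase x, ‖a x - b x‖ * ‖a l - b l‖ :=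
      Finset.sum_le_sum fun x _ => Finset.sum_le_sum_of_subset_of_nonneg
        (Finset.erase_subset_erase _ (Finset.subset_insert _ _)) fun _ _ _ => by positivity
    rw [h1]
    have h3 : a i * ∏ x ∈ s, a x - b i * ∏ x ∈ s, b x - ((a i - b i) * ∏ l ∈ s, b l +
        b i * ∑ x ∈ s, (a x - b x) * ∏ l ∈ s.erase x, b l) =
        (a i - b i) * (∏ x ∈ s, a x - ∏ x ∈ s, b x) + b i * (∏ x ∈ s, a x - ∏ x ∈ s, b x -
          ∑ x ∈ s, (a x - b x) * ∏ l ∈ s.erase x, b l) := by ring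
    rw [h3]
    refine (norm_add_le _ _).trans (add_le_add ?_ ?_)
    · rw [norm_mul, ← Finset.mul_sum]
      exact mul_le_mul_of_nonneg_left (norm_prod_sub_prod_le s ha hb) (norm_nonneg _)
    · rw [norm_mul]
      exact ((mul_le_of_le_one_left (norm_nonneg _) (hb i)).trans ih).trans h2

/-! ### The dependence kernel -/

section Kernel

variable {d : ℕ} {p : Fin d → ℕ} {μ : Measure (BlockSpace p)} [IsProbabilityMeasure μ]

lemma expInner_blocks (t x : BlockSpace p) : expInner t x = ∏ j, expInner (t j) (x j) := by
  unfold expInner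
  rw [PiLp.inner_apply, ← Complex.exp_sum]
  push_cast
  rw [Finset.sum_mul]

omit [IsProbabilityMeasure μ] in
lemma marginalCharFun_eq (j : Fin d) (s : EuclideanSpace ℝ (Fin (p j))) :
    marginalCharFun p μ j s = ∫ x, expInner s (x j) ∂μ := by
  unfold marginalCharFun expInner
  rw [charFun_apply, integral_map (measurable_blockSpace_eval j).aemeasurable (by fun_prop)]
  simp_rw [real_inner_comm]

lemma norm_marginalCharFun_le (j : Fin d) (s : EuclideanSpace ℝ (Fin (p j))) :
    ‖marginalCharFun p μ j s‖ ≤ 1 := by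
  rw [marginalCharFun_eq]
  have := norm_integral_le_of_norm_le_const (μ := μ) (C := 1)
    (f := fun x : BlockSpace p => expInner s (x j)) (ae_of_all _ fun x => (norm_expInner _ _).le)
  simpa using this

lemma measurable_marginalCharFun (j : Fin d) : Measurable (marginalCharFun p μ j) := by
  have : Measurable fun z : EuclideanSpace ℝ (Fin (p j)) × BlockSpace p =>
      expInner z.1 (z.2 j) := by
    have h : Measurable fun z : EuclideanSpace ℝ (Fin (p j)) × BlockSpace p =>
      (z.1, z.2 j) := by fun_prop
    exact measurable_expInner.comp h
  rw [funext (marginalCharFun_eq (μ := μ) j)]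
  exact measurable_integral_right (f := fun s (x : BlockSpace p) => expInner s (x j)) this

omit [IsProbabilityMeasure μ] in
lemma marginalCharFun_neg (j : Fin d) (s : EuclideanSpace ℝ (Fin (p j))) :
    marginalCharFun p μ j (-s) = conj (marginalCharFun p μ j s) := by
  simp_rw [marginalCharFun_eq, expInner_neg_left]
  exact integral_conj

/-- The Hoeffding projection of `e^{i⟨t, x⟩}` onto the functions that are orthogonal to those of
a single block. -/
noncomputable def dependenceKernel {d : ℕ} (p : Fin d → ℕ) (μ : Measure (BlockSpace p))
    (t x : BlockSpace p) : ℂ :=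
  ∏ j, expInner (t j) (x j) - ∏ j, marginalCharFun p μ j (t j) -
    ∑ j, (expInner (t j) (x j) - marginalCharFun p μ j (t j)) *
      ∏ l ∈ Finset.univ.erase j, marginalCharFun p μ l (t l)

lemma measurable_dependenceKernel :
    Measurable fun z : BlockSpace p × BlockSpace p => dependenceKernel p μ z.1 z.2 := by
  have h1 : ∀ j, Measurable fun z : BlockSpace p × BlockSpace p => expInner (z.1 j) (z.2 j) :=
    fun j => by
      have h : Measurable fun z : BlockSpace p × BlockSpace p => (z.1 j, z.2 j) := by fun_prop
      exact measurable_expInner.comp h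
  have h2 : ∀ j, Measurable fun z : BlockSpace p × BlockSpace p =>
      marginalCharFun p μ j (z.1 j) := fun j => by
    have h : Measurable fun z : BlockSpace p × BlockSpace p => z.1 j := by fun_prop
    exact (measurable_marginalCharFun j).comp h
  have h3 : Measurable fun z : BlockSpace p × BlockSpace p =>
      ∏ j, expInner (z.1 j) (z.2 j) := Finset.measurable_prod _ fun j _ => h1 j
  have h4 : ∀ s : Finset (Fin d), Measurable fun z : BlockSpace p × BlockSpace p =>
      ∏ j ∈ s, marginalCharFun p μ j (z.1 j) := fun s => Finset.measurable_prod _ fun j _ => h2 j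
  have h5 : Measurable fun z : BlockSpace p × BlockSpace p =>
      ∑ j, (expInner (z.1 j) (z.2 j) - marginalCharFun p μ j (z.1 j)) *
        ∏ l ∈ Finset.univ.erase j, marginalCharFun p μ l (z.1 l) :=
    Finset.measurable_sum _ fun j _ => ((h1 j).sub (h2 j)).mul (h4 _)
  exact (h3.sub (h4 _)).sub h5

lemma measurable_dependenceKernel_right (t : BlockSpace p) :
    Measurable (fun x => dependenceKernel p μ t x) := by
  have h : Measurable fun x : BlockSpace p => (t, x) := measurable_prodMk_left
  simpa only [Function.comp_def] using (measurable_dependenceKernel (μ := μ)).comp h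

omit [IsProbabilityMeasure μ] in
lemma dependenceKernel_neg (t x : BlockSpace p) :
    dependenceKernel p μ (-t) x = conj (dependenceKernel p μ t x) := by
  simp [dependenceKernel, expInner_neg_left, marginalCharFun_neg, map_prod, map_sum]

/-- The factor 2 counts the telescoped difference of products and the linear part, each bounded by
the same sum of deviations. -/
lemma norm_dependenceKernel_le_sum (t x : BlockSpace p) :
    ‖dependenceKernel p μ t x‖ ≤
      2 * ∑ j, ‖expInner (t j) (x j) - marginalCharFun p μ j (t j)‖ := by
  unfold dependenceKernel
  refine (norm_sub_le _ _).trans ?_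
  rw [two_mul]
  refine add_le_add (norm_prod_sub_prod_le _ (fun j => (norm_expInner _ _).le)
    fun j => norm_marginalCharFun_le j _) ((norm_sum_le _ _).trans (Finset.sum_le_sum fun j _ => ?_))
  rw [norm_mul]
  exact mul_le_of_le_one_right (norm_nonneg _)
    (norm_prod_le_one _ fun j => norm_marginalCharFun_le j _)

lemma norm_expInner_sub_marginalCharFun_le (t x : BlockSpace p) (j : Fin d) :
    ‖expInner (t j) (x j) - marginalCharFun p μ j (t j)‖ ≤ 2 := by
  refine (norm_sub_le _ _).trans ?_
  rw [norm_expInner]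
  linarith [norm_marginalCharFun_le (μ := μ) j (t j)]

lemma norm_dependenceKernel_le (t x : BlockSpace p) : ‖dependenceKernel p μ t x‖ ≤ 4 * d := by
  refine (norm_dependenceKernel_le_sum t x).trans ?_
  have := Finset.sum_le_sum fun j (_ : j ∈ Finset.univ) =>
    norm_expInner_sub_marginalCharFun_le (μ := μ) t x j
  simp only [Finset.sum_const, Finset.card_univ, Fintype.card_fin, nsmul_eq_mul] at this
  linarith

end Kernel

lemma integrable_of_measurable_bounded {Ω E : Type*} [MeasurableSpace Ω] {P : Measure Ω}
    [IsFiniteMeasure P] [NormedAddCommGroup E] [MeasurableSpace E] [BorelSpace E]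
    [SecondCountableTopology E] {f : Ω → E} (hf : Measurable f) {C : ℝ} (hC : ∀ ω, ‖f ω‖ ≤ C) :
    Integrable f P :=
  Integrable.of_bound hf.aestronglyMeasurable C (ae_of_all _ hC)

/-- The second moment of a linear combination of orthogonal bounded random variables. -/
lemma integral_norm_sum_sq_of_orthogonal {Ω ι : Type*} [MeasurableSpace Ω] {P : Measure Ω}
    [IsFiniteMeasure P] (s : Finset ι) {Z : ι → Ω → ℂ} {C : ℝ}
    (hZ : ∀ k ∈ s, Measurable (Z k)) (hC : ∀ k ∈ s, ∀ ω, ‖Z k ω‖ ≤ C)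
    (horth : ∀ k ∈ s, ∀ l ∈ s, k ≠ l → ∫ ω, Z k ω * conj (Z l ω) ∂P = 0) (c : ι → ℝ) :
    ∫ ω, ‖∑ k ∈ s, (c k : ℂ) * Z k ω‖ ^ 2 ∂P = ∑ k ∈ s, c k ^ 2 * ∫ ω, ‖Z k ω‖ ^ 2 ∂P := by
  have hint : ∀ k ∈ s, ∀ l ∈ s, Integrable (fun ω => Z k ω * conj (Z l ω)) P := fun k hk l hl => by
    refine integrable_of_measurable_bounded (C := C * C)
      ((hZ k hk).mul (Complex.continuous_conj.measurable.comp (hZ l hl))) fun ω => ?_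
    rw [norm_mul, RCLike.norm_conj]
    exact mul_le_mul (hC k hk ω) (hC l hl ω) (norm_nonneg _) ((norm_nonneg _).trans (hC k hk ω))
  have hc : ∀ z : ℂ, ((‖z‖ ^ 2 : ℝ) : ℂ) = z * conj z := fun z => by
    rw [Complex.mul_conj, Complex.normSq_eq_norm_sq]
  have e1 : ∀ ω, ((‖∑ k ∈ s, (c k : ℂ) * Z k ω‖ ^ 2 : ℝ) : ℂ) =
      ∑ k ∈ s, ∑ l ∈ s, ((c k : ℂ) * c l) * (Z k ω * conj (Z l ω)) := by
    intro ω
    rw [hc, map_sum, Finset.sum_mul_sum]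
    refine Finset.sum_congr rfl fun k _ => Finset.sum_congr rfl fun l _ => ?_
    rw [map_mul, Complex.conj_ofReal]
    ring
  apply Complex.ofReal_injective
  rw [← integral_complex_ofReal]
  simp_rw [e1]
  rw [integral_finsetSum _ fun k hk => integrable_finsetSum _ fun l hl =>
    (hint k hk l hl).const_mul _]
  push_cast
  refine Finset.sum_congr rfl fun k hk => ?_
  rw [integral_finsetSum _ fun l hl => (hint k hk l hl).const_mul _, Finset.sum_eq_single k]
  · rw [integral_const_mul, ← integral_complex_ofReal]
    simp_rw [hc]
    ring
  · intro l hl hne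
    rw [integral_const_mul, horth k hk l hl hne.symm, mul_zero]
  · exact fun h => absurd hk h

/-! ### Second moments, degeneracy and covariance of the kernel -/

section Kernel

variable {d : ℕ} {p : Fin d → ℕ} {μ : Measure (BlockSpace p)} [IsProbabilityMeasure μ]

lemma measurable_expInner_block (t : BlockSpace p) (j : Fin d) :
    Measurable fun x : BlockSpace p => expInner (t j) (x j) := by
  have h := measurable_expInner_right (t j)
  exact h.comp (measurable_blockSpace_eval j)

lemma integral_norm_expInner_sub_sq (j : Fin d) (s : EuclideanSpace ℝ (Fin (p j))) :
    ∫ x, ‖expInner s (x j) - marginalCharFun p μ j s‖ ^ 2 ∂μ =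
      1 - ‖marginalCharFun p μ j s‖ ^ 2 := by
  set φ := marginalCharFun p μ j s with hφ
  have hm : Measurable fun x : BlockSpace p => expInner s (x j) := by
    have h := measurable_expInner_right s
    exact h.comp (measurable_blockSpace_eval j)
  have hi : Integrable (fun x : BlockSpace p => expInner s (x j)) μ :=
    integrable_of_measurable_bounded hm fun x => (norm_expInner _ _).le
  have e : ∀ x : BlockSpace p, ‖expInner s (x j) - φ‖ ^ 2 =
      1 + ‖φ‖ ^ 2 - 2 * (conj φ * expInner s (x j)).re := by
    intro x
    have h1 := norm_expInner s (x j)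
    rw [← Complex.normSq_eq_norm_sq, Complex.normSq_sub, Complex.normSq_eq_norm_sq,
      Complex.normSq_eq_norm_sq, h1, mul_comm (expInner s (x j))]
    ring
  simp_rw [e]
  have hi2 : Integrable (fun x : BlockSpace p => (conj φ * expInner s (x j)).re) μ :=
    (hi.const_mul _).re
  rw [integral_sub (integrable_const _) (hi2.const_mul _), integral_const_mul]
  have h3 : ∫ x, (conj φ * expInner s (x j)).re ∂μ = ‖φ‖ ^ 2 := by
    have := integral_re (hi.const_mul (conj φ))
    simp only [RCLike.re_to_complex] at this
    rw [this, integral_const_mul, ← marginalCharFun_eq, ← hφ, mul_comm, Complex.mul_conj,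
      Complex.ofReal_re, Complex.normSq_eq_norm_sq]
  rw [h3]
  simp
  ring

/-- Expanding |1 − φ|² ≥ 0 gives 1 − |φ|² ≤ 2 − 2 Re φ. The right side is E|e^{i⟨t_j, X_j⟩} − 1|²,
which the envelope dominates since blocks have smaller norms. -/
lemma one_sub_norm_marginalCharFun_sq_le (t : BlockSpace p) (j : Fin d) :
    1 - ‖marginalCharFun p μ j (t j)‖ ^ 2 ≤ charEnvelope p μ t := by
  have hm := measurable_expInner_block t j
  have hi : Integrable (fun x : BlockSpace p => expInner (t j) (x j)) μ :=
    integrable_of_measurable_bounded hm fun x => (norm_expInner _ _).le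
  set φ := marginalCharFun p μ j (t j) with hφ
  have h1 : 1 - ‖φ‖ ^ 2 ≤ 2 - 2 * φ.re := by
    have : 0 ≤ ‖1 - φ‖ ^ 2 := by positivity
    rw [← Complex.normSq_eq_norm_sq, Complex.normSq_apply] at this ⊢
    simp at this
    nlinarith
  have h2 : ∫ x, ‖expInner (t j) (x j) - 1‖ ^ 2 ∂μ = 2 - 2 * φ.re := by
    have e : ∀ x : BlockSpace p, ‖expInner (t j) (x j) - 1‖ ^ 2 =
        2 - 2 * (expInner (t j) (x j)).re := by
      intro x
      have h1 := norm_expInner (t j) (x j)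
      rw [← Complex.normSq_eq_norm_sq, Complex.normSq_sub, Complex.normSq_eq_norm_sq, h1]
      simp
      ring
    simp_rw [e]
    have hre : Integrable (fun x : BlockSpace p => (expInner (t j) (x j)).re) μ := hi.re
    rw [integral_sub (integrable_const _) (hre.const_mul _), integral_const_mul]
    have := integral_re hi
    simp only [RCLike.re_to_complex] at this
    rw [this, ← marginalCharFun_eq]
    simp [hφ]
  refine h1.trans (h2.symm.le.trans ?_)
  refine integral_mono_of_nonneg (ae_of_all _ fun _ => by positivity) (integrable_min_sq μ t)
    (ae_of_all _ fun x => ?_)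
  refine pow_le_pow_left₀ (norm_nonneg _) ((norm_expInner_sub_one_le _ _).trans ?_) 2
  exact min_le_min_right _ (mul_le_mul (PiLp.norm_apply_le t j) (PiLp.norm_apply_le x j)
    (norm_nonneg _) (norm_nonneg _))

/-- Cauchy–Schwarz over the d blocks, each contributing its variance 1 − |φ_j|². This supplies the
integrable majorant in t for the limit theorems. -/
lemma integral_norm_dependenceKernel_sq_le (t : BlockSpace p) :
    ∫ x, ‖dependenceKernel p μ t x‖ ^ 2 ∂μ ≤ 4 * d ^ 2 * charEnvelope p μ t := by
  have hi : ∀ j, Integrable (fun x : BlockSpace p =>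
      ‖expInner (t j) (x j) - marginalCharFun p μ j (t j)‖ ^ 2) μ := fun j => by
    refine integrable_of_measurable_bounded (C := 4)
      (((measurable_expInner_block t j).sub_const _).norm.pow_const 2) fun x => ?_
    have := norm_expInner_sub_marginalCharFun_le (μ := μ) t x j
    rw [Real.norm_of_nonneg (by positivity)]
    nlinarith [norm_nonneg (expInner (t j) (x j) - marginalCharFun p μ j (t j))]
  have h1 : ∀ x, ‖dependenceKernel p μ t x‖ ^ 2 ≤
      4 * (d * ∑ j, ‖expInner (t j) (x j) - marginalCharFun p μ j (t j)‖ ^ 2) := by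
    intro x
    refine (pow_le_pow_left₀ (norm_nonneg _) (norm_dependenceKernel_le_sum t x) 2).trans ?_
    have := sq_sum_le_card_mul_sum_sq (s := Finset.univ)
      (f := fun j : Fin d => ‖expInner (t j) (x j) - marginalCharFun p μ j (t j)‖)
    simp only [Finset.card_univ, Fintype.card_fin] at this
    rw [mul_pow]
    linarith
  refine (integral_mono_of_nonneg (ae_of_all _ fun _ => by positivity)
    (((integrable_finsetSum _ fun j _ => hi j).const_mul _).const_mul _) (ae_of_all _ h1)).trans ?_
  rw [integral_const_mul, integral_const_mul, integral_finsetSum _ fun j _ => hi j]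
  have h2 : ∑ j, ∫ x, ‖expInner (t j) (x j) - marginalCharFun p μ j (t j)‖ ^ 2 ∂μ ≤
      ∑ _j : Fin d, charEnvelope p μ t := Finset.sum_le_sum fun j _ => by
    rw [integral_norm_expInner_sub_sq]
    exact one_sub_norm_marginalCharFun_sq_le t j
  simp only [Finset.sum_const, Finset.card_univ, Fintype.card_fin, nsmul_eq_mul] at h2
  have : (4 : ℝ) * (d * ∑ j, ∫ x, ‖expInner (t j) (x j) - marginalCharFun p μ j (t j)‖ ^ 2 ∂μ) ≤
      4 * (d * (d * charEnvelope p μ t)) := by gcongr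
  linarith

/-- With block `j` frozen at y_j, the product averages to e_j(y_j) ∏_{l≠j} φ_l by independence.
Among the linear terms only the j-th survives, and it is this average minus ∏ φ_l. -/
lemma isDegenerate_dependenceKernel
    (hμ : iIndepFun (fun (j : Fin d) (x : BlockSpace p) => x j) μ) (t : BlockSpace p) :
    IsDegenerate μ (fun x => dependenceKernel p μ t x) := by
  classical
  intro j y
  -- Freezing block `j` keeps the integrand a product over blocks: its j-th factor is constant and
  -- the others are unchanged.
  set F : ∀ i, EuclideanSpace ℝ (Fin (p i)) → ℂ := fun i s =>
    if i = j then expInner (t i) (y i) else expInner (t i) s with hF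
  have hFm : ∀ i, Measurable (F i) := fun i => by
    by_cases h : i = j
    · simp [hF, h]
    · simpa [hF, h] using measurable_expInner_right (t i)
  have hFrep : ∀ i x, expInner (t i) ((replaceBlock j x y) i) = F i (x i) := by
    intro i x
    by_cases h : i = j
    · subst h; simp [hF, replaceBlock]
    · simp [hF, replaceBlock, h]
  have hFi : ∀ i, Integrable (fun x : BlockSpace p => F i (x i)) μ := fun i => by
    refine integrable_of_measurable_bounded (C := 1)
      ((hFm i).comp (measurable_blockSpace_eval i)) fun x => ?_
    rw [← hFrep i]
    exact (norm_expInner _ _).le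
  have hprod : Integrable (fun x : BlockSpace p => ∏ i, F i (x i)) μ := by
    refine integrable_of_measurable_bounded (C := 1)
      (Finset.measurable_prod _ fun i _ => (hFm i).comp (measurable_blockSpace_eval i)) fun x => ?_
    refine norm_prod_le_one _ fun i => ?_
    rw [← hFrep i]
    exact (norm_expInner _ _).le
  have hmean : ∀ i, ∫ x, F i (x i) ∂μ =
      if i = j then expInner (t i) (y i) else marginalCharFun p μ i (t i) := by
    intro i
    by_cases h : i = j
    · simp [hF, h]
    · simp [hF, h, marginalCharFun_eq]
  unfold dependenceKernel
  simp_rw [hFrep]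
  have hterm : ∀ i, Integrable (fun x : BlockSpace p => (F i (x i) - marginalCharFun p μ i (t i)) *
      ∏ l ∈ Finset.univ.erase i, marginalCharFun p μ l (t l)) μ := fun i =>
    ((hFi i).sub (integrable_const _)).mul_const _
  have hdiff : Integrable (fun x : BlockSpace p => ∏ i, F i (x i) -
      ∏ i, marginalCharFun p μ i (t i)) μ := hprod.sub (integrable_const _)
  rw [integral_sub hdiff (integrable_finsetSum _ fun i _ => hterm i),
    integral_sub hprod (integrable_const _), integral_finsetSum _ fun i _ => hterm i,
    integral_prod_blocks hμ hFm]
  simp_rw [integral_mul_const, integral_sub (hFi _) (integrable_const _), hmean]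
  rw [Finset.sum_eq_single j]
  · rw [← Finset.mul_prod_erase _ _ (Finset.mem_univ j),
      ← Finset.mul_prod_erase Finset.univ (fun i => marginalCharFun p μ i (t i))
        (Finset.mem_univ j), if_pos rfl]
    have : ∏ x ∈ Finset.univ.erase j,
        (if x = j then expInner (t x) (y x) else marginalCharFun p μ x (t x)) =
        ∏ x ∈ Finset.univ.erase j, marginalCharFun p μ x (t x) :=
      Finset.prod_congr rfl fun x hx => if_neg (Finset.ne_of_mem_erase hx)
    rw [this]
    simp
    ring
  · intro i _ hi
    simp [hi]
  · simp

/-- The moments of the kernel against products of functions of the blocks. -/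
lemma integral_dependenceKernel_mul_prod
    (hμ : iIndepFun (fun (j : Fin d) (x : BlockSpace p) => x j) μ) (t : BlockSpace p)
    {g : ∀ i, EuclideanSpace ℝ (Fin (p i)) → ℂ} (hg : ∀ i, Measurable (g i))
    (hg1 : ∀ i s, ‖g i s‖ ≤ 1) :
    ∫ x, dependenceKernel p μ t x * ∏ i, g i (x i) ∂μ =
      ∏ i, ∫ x, expInner (t i) (x i) * g i (x i) ∂μ -
      (∏ i, marginalCharFun p μ i (t i)) * ∏ i, ∫ x, g i (x i) ∂μ -
      ∑ j, (∫ x, expInner (t j) (x j) * g j (x j) ∂μ -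
          marginalCharFun p μ j (t j) * ∫ x, g j (x j) ∂μ) *
        ∏ l ∈ Finset.univ.erase j, (marginalCharFun p μ l (t l) * ∫ x, g l (x l) ∂μ) := by
  classical
  have he : ∀ i, Measurable fun s : EuclideanSpace ℝ (Fin (p i)) => expInner (t i) s :=
    fun i => measurable_expInner_right (t i)
  have hprod : ∀ {f : ∀ i, EuclideanSpace ℝ (Fin (p i)) → ℂ}, (∀ i, Measurable (f i)) →
      (∀ i s, ‖f i s‖ ≤ 1) → Integrable (fun x : BlockSpace p => ∏ i, f i (x i)) μ :=
    fun {f} hf hf1 => by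
      refine integrable_of_measurable_bounded (C := 1)
        (Finset.measurable_prod _ fun i _ => (hf i).comp (measurable_blockSpace_eval i)) fun x => ?_
      exact norm_prod_le_one _ fun i => hf1 _ _
  have heg : ∀ i s, ‖expInner (t i) s * g i s‖ ≤ 1 := fun i s => by
    rw [norm_mul, norm_expInner, one_mul]; exact hg1 i s
  -- the product with the factor `e_j` kept at the index `j` only
  set G : Fin d → ∀ i, EuclideanSpace ℝ (Fin (p i)) → ℂ := fun j i s =>
    if i = j then expInner (t i) s * g i s else g i s with hG
  have hGm : ∀ j i, Measurable (G j i) := fun j i => by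
    by_cases h : i = j
    · simp only [hG, h, if_true]
      exact (he i).mul (hg i)
    · simpa [hG, h] using hg i
  have hG1 : ∀ j i s, ‖G j i s‖ ≤ 1 := fun j i s => by
    by_cases h : i = j
    · simpa only [hG, h, if_true] using heg i s
    · simpa [hG, h] using hg1 i s
  have hGprod : ∀ j (x : BlockSpace p), ∏ i, G j i (x i) =
      expInner (t j) (x j) * ∏ i, g i (x i) := by
    intro j x
    rw [← Finset.mul_prod_erase _ _ (Finset.mem_univ j),
      ← Finset.mul_prod_erase Finset.univ (fun i => g i (x i)) (Finset.mem_univ j)]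
    have : ∏ i ∈ Finset.univ.erase j, G j i (x i) = ∏ i ∈ Finset.univ.erase j, g i (x i) :=
      Finset.prod_congr rfl fun i hi => by simp [hG, Finset.ne_of_mem_erase hi]
    rw [this]
    simp [hG, mul_assoc]
  have e1 : ∀ x : BlockSpace p, dependenceKernel p μ t x * ∏ i, g i (x i) =
      ∏ i, (expInner (t i) (x i) * g i (x i)) -
      (∏ i, marginalCharFun p μ i (t i)) * ∏ i, g i (x i) -
      ∑ j, (∏ i, G j i (x i) - marginalCharFun p μ j (t j) * ∏ i, g i (x i)) *
        ∏ l ∈ Finset.univ.erase j, marginalCharFun p μ l (t l) := by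
    intro x
    simp_rw [hGprod]
    unfold dependenceKernel
    rw [sub_mul, sub_mul, Finset.sum_mul, Finset.prod_mul_distrib]
    congr 1
    exact Finset.sum_congr rfl fun j _ => by ring
  have i1 : Integrable (fun x : BlockSpace p => ∏ i, (expInner (t i) (x i) * g i (x i))) μ :=
    hprod (f := fun i s => expInner (t i) s * g i s) (fun i => (he i).mul (hg i)) heg
  have i2 := hprod hg hg1
  have i3 := fun j => hprod (hGm j) (hG1 j)
  have i4 : ∀ j, Integrable (fun x : BlockSpace p =>
      (∏ i, G j i (x i) - marginalCharFun p μ j (t j) * ∏ i, g i (x i)) *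
        ∏ l ∈ Finset.univ.erase j, marginalCharFun p μ l (t l)) μ := fun j =>
    ((i3 j).sub (i2.const_mul _)).mul_const _
  have i5 : Integrable (fun x : BlockSpace p => ∏ i, (expInner (t i) (x i) * g i (x i)) -
      (∏ i, marginalCharFun p μ i (t i)) * ∏ i, g i (x i)) μ := i1.sub (i2.const_mul _)
  simp_rw [e1]
  rw [integral_sub i5 (integrable_finsetSum _ fun j _ => i4 j),
    integral_sub i1 (i2.const_mul _), integral_finsetSum _ fun j _ => i4 j, integral_const_mul,
    integral_prod_blocks hμ hg, integral_prod_blocks hμ (f := fun i s => expInner (t i) s * g i s)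
      fun i => (he i).mul (hg i)]
  congr 1
  refine Finset.sum_congr rfl fun j _ => ?_
  rw [integral_mul_const, integral_sub (i3 j) (i2.const_mul _), integral_const_mul,
    integral_prod_blocks hμ hg, integral_prod_blocks hμ (hGm j), Finset.prod_mul_distrib,
    ← Finset.mul_prod_erase _ _ (Finset.mem_univ j),
    ← Finset.mul_prod_erase Finset.univ (fun i => ∫ x, g i (x i) ∂μ) (Finset.mem_univ j)]
  have : ∏ i ∈ Finset.univ.erase j, ∫ x, G j i (x i) ∂μ =
      ∏ i ∈ Finset.univ.erase j, ∫ x, g i (x i) ∂μ :=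
    Finset.prod_congr rfl fun i hi => by simp [hG, Finset.ne_of_mem_erase hi]
  rw [this]
  simp only [hG, if_true]
  ring

lemma integral_dependenceKernel (hμ : iIndepFun (fun (j : Fin d) (x : BlockSpace p) => x j) μ)
    (t : BlockSpace p) : ∫ x, dependenceKernel p μ t x ∂μ = 0 := by
  have h := integral_dependenceKernel_mul_prod hμ t (g := fun _ _ => 1)
    (fun _ => measurable_const) (by simp)
  simp only [Finset.prod_const_one, mul_one] at h
  rw [h]
  simp [marginalCharFun_eq]

/-- With test factors equal to 1 outside block `j`, the moment formula keeps only its j-th linear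
term, and this cancels the difference of the two products. -/
lemma integral_dependenceKernel_mul_conj_expInner
    (hμ : iIndepFun (fun (j : Fin d) (x : BlockSpace p) => x j) μ) (t t₀ : BlockSpace p)
    (j : Fin d) :
    ∫ x, dependenceKernel p μ t x * conj (expInner (t₀ j) (x j)) ∂μ = 0 := by
  classical
  set g : ∀ i, EuclideanSpace ℝ (Fin (p i)) → ℂ := fun i s =>
    if i = j then conj (expInner (t₀ i) s) else 1 with hg
  have h := integral_dependenceKernel_mul_prod hμ t (g := g)
    (fun i => by
      by_cases hi : i = j
      · simp only [hg, hi, if_true]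
        exact Complex.continuous_conj.measurable.comp (measurable_expInner_right (t₀ i))
      · simp [hg, hi])
    (fun i s => by by_cases hi : i = j <;> simp [hg, hi, norm_expInner])
  have hpr : ∀ x : BlockSpace p, ∏ i, g i (x i) = conj (expInner (t₀ j) (x j)) := fun x => by
    rw [Finset.prod_eq_single j] <;> simp +contextual [hg]
  simp_rw [hpr] at h
  rw [h, ← Finset.mul_prod_erase Finset.univ
    (fun i => ∫ x, expInner (t i) (x i) * g i (x i) ∂μ) (Finset.mem_univ j),
    ← Finset.mul_prod_erase Finset.univ (fun i => marginalCharFun p μ i (t i)) (Finset.mem_univ j),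
    ← Finset.mul_prod_erase Finset.univ (fun i => ∫ x, g i (x i) ∂μ) (Finset.mem_univ j),
    Finset.sum_eq_single j]
  · have h1 : ∏ i ∈ Finset.univ.erase j, ∫ x, expInner (t i) (x i) * g i (x i) ∂μ =
        ∏ i ∈ Finset.univ.erase j, marginalCharFun p μ i (t i) :=
      Finset.prod_congr rfl fun i hi => by
        simp [hg, Finset.ne_of_mem_erase hi, marginalCharFun_eq]
    have h2 : ∏ i ∈ Finset.univ.erase j, ∫ x, g i (x i) ∂μ = 1 :=
      Finset.prod_eq_one fun i hi => by simp [hg, Finset.ne_of_mem_erase hi]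
    have h3 : ∏ i ∈ Finset.univ.erase j, (marginalCharFun p μ i (t i) * ∫ x, g i (x i) ∂μ) =
        ∏ i ∈ Finset.univ.erase j, marginalCharFun p μ i (t i) :=
      Finset.prod_congr rfl fun i hi => by simp [hg, Finset.ne_of_mem_erase hi]
    rw [h1, h2, h3]
    ring
  · intro i _ hi
    simp [hg, hi, marginalCharFun_eq]
  · simp

/-- The covariance of the kernel is `R`. -/
lemma integral_dependenceKernel_mul_conj
    (hμ : iIndepFun (fun (j : Fin d) (x : BlockSpace p) => x j) μ) (t t₀ : BlockSpace p) :
    ∫ x, dependenceKernel p μ t x * conj (dependenceKernel p μ t₀ x) ∂μ = limitCov p μ t t₀ := by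
  classical
  set H := fun x => dependenceKernel p μ t x with hH
  have hHm : Measurable H := measurable_dependenceKernel_right t
  have hHb : ∀ x, ‖H x‖ ≤ 4 * d := fun x => norm_dependenceKernel_le t x
  have i0 : Integrable H μ := integrable_of_measurable_bounded hHm hHb
  have ij : ∀ j, Integrable (fun x : BlockSpace p => H x * conj (expInner (t₀ j) (x j))) μ :=
    fun j => by
      refine integrable_of_measurable_bounded (C := 4 * d) (hHm.mul
        (Complex.continuous_conj.measurable.comp (measurable_expInner_block t₀ j))) fun x => ?_
      rw [norm_mul, RCLike.norm_conj, norm_expInner, mul_one]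
      exact hHb x
  have ip : Integrable (fun x : BlockSpace p => H x * ∏ j, conj (expInner (t₀ j) (x j))) μ := by
    refine integrable_of_measurable_bounded (C := 4 * d) (hHm.mul
      (Finset.measurable_prod _ fun j _ =>
        Complex.continuous_conj.measurable.comp (measurable_expInner_block t₀ j))) fun x => ?_
    rw [norm_mul, norm_prod]
    simp only [RCLike.norm_conj, norm_expInner, Finset.prod_const_one, mul_one]
    exact hHb x
  set A := conj (∏ j, marginalCharFun p μ j (t₀ j)) with hA
  set B := fun j => conj (∏ l ∈ Finset.univ.erase j, marginalCharFun p μ l (t₀ l)) with hB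
  -- Only the second kernel is expanded. `H` is orthogonal to constants and to single-block
  -- exponentials, so the full product is the one term that contributes.
  have e : ∀ x, H x * conj (dependenceKernel p μ t₀ x) =
      H x * ∏ j, conj (expInner (t₀ j) (x j)) - H x * A -
      ∑ j, (H x * conj (expInner (t₀ j) (x j)) - H x * conj (marginalCharFun p μ j (t₀ j))) * B j := by
    intro x
    simp only [hA, hB, dependenceKernel, map_sub, map_sum, map_mul, map_prod]
    rw [mul_sub, mul_sub, Finset.mul_sum]
    congr 1
    exact Finset.sum_congr rfl fun j _ => by ring
  have is : ∀ j, Integrable (fun x : BlockSpace p => (H x * conj (expInner (t₀ j) (x j)) -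
      H x * conj (marginalCharFun p μ j (t₀ j))) * B j) μ := fun j =>
    ((ij j).sub (i0.mul_const _)).mul_const _
  have id : Integrable (fun x : BlockSpace p =>
      H x * ∏ j, conj (expInner (t₀ j) (x j)) - H x * A) μ := ip.sub (i0.mul_const _)
  have m0 : ∫ x, H x ∂μ = 0 := integral_dependenceKernel hμ t
  have mj : ∀ j, ∫ x, H x * conj (expInner (t₀ j) (x j)) ∂μ = 0 := fun j =>
    integral_dependenceKernel_mul_conj_expInner hμ t t₀ j
  have mp := integral_dependenceKernel_mul_prod hμ t
    (g := fun i s => conj (expInner (t₀ i) s))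
    (fun i => Complex.continuous_conj.measurable.comp (measurable_expInner_right (t₀ i)))
    (fun i s => by simp [norm_expInner])
  have hconj : ∀ j, ∫ x : BlockSpace p, conj (expInner (t₀ j) (x j)) ∂μ =
      conj (marginalCharFun p μ j (t₀ j)) := fun j => by
    rw [marginalCharFun_eq]; exact integral_conj
  have hsub : ∀ j, ∫ x : BlockSpace p, expInner (t j) (x j) * conj (expInner (t₀ j) (x j)) ∂μ =
      marginalCharFun p μ j (t j - t₀ j) := fun j => by
    rw [marginalCharFun_eq]
    exact integral_congr_ae (ae_of_all _ fun x => (expInner_sub_left _ _ _).symm)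
  refine (integral_congr_ae (ae_of_all _ e)).trans ?_
  rw [integral_sub id (integrable_finsetSum _ fun j _ => is j), integral_sub ip (i0.mul_const _),
    integral_finsetSum _ fun j _ => is j, integral_mul_const, m0, zero_mul, sub_zero,
    Finset.sum_eq_zero, sub_zero]
  · rw [hH, mp]
    simp_rw [hconj, hsub]
    unfold limitCov
    simp_rw [sub_mul]
    rw [Finset.sum_sub_distrib]
    -- Each of the d terms of the sum yields one copy of the full product; against the single −1
    -- outside the sum they leave the coefficient d − 1 of R.
    have : ∀ j ∈ Finset.univ, marginalCharFun p μ j (t j) * conj (marginalCharFun p μ j (t₀ j)) *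
        ∏ l ∈ Finset.univ.erase j,
          (marginalCharFun p μ l (t l) * conj (marginalCharFun p μ l (t₀ l))) =
        ∏ l, (marginalCharFun p μ l (t l) * conj (marginalCharFun p μ l (t₀ l))) := fun j _ =>
      Finset.mul_prod_erase _ (fun l => marginalCharFun p μ l (t l) *
        conj (marginalCharFun p μ l (t₀ l))) (Finset.mem_univ j)
    rw [Finset.sum_congr rfl this, ← Finset.prod_mul_distrib]
    simp only [Finset.sum_const, Finset.card_univ, Fintype.card_fin, nsmul_eq_mul]
    ring
  · intro j _
    rw [integral_mul_const, integral_sub (ij j) (i0.mul_const _), integral_mul_const, mj, m0]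
    simp

end Kernel

/-! ### Cyclic sums, characteristic functions of sums, blocks of a sequence -/

lemma sum_range_add_mod {M : Type*} [AddCommMonoid M] {n : ℕ} (f : ℕ → M) (j : ℕ) :
    ∑ k ∈ Finset.range n, f ((k + j) % n) = ∑ k ∈ Finset.range n, f k := by
  rcases n.eq_zero_or_pos with rfl | hn
  · simp
  have hmaps : Set.MapsTo (fun k => (k + j) % n) (Finset.range n) (Finset.range n) := fun k _ => by
    simpa using Nat.mod_lt _ hn
  have hinj : Set.InjOn (fun k => (k + j) % n) (Finset.range n) := by
    intro k hk l hl h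
    simp only [Finset.coe_range, Set.mem_Iio] at hk hl
    have h' : k ≡ l [MOD n] := Nat.ModEq.add_right_cancel' j h
    rwa [Nat.ModEq, Nat.mod_eq_of_lt hk, Nat.mod_eq_of_lt hl] at h'
  exact Finset.sum_nbij (fun k => (k + j) % n) hmaps hinj
    (Finset.surjOn_of_injOn_of_card_le _ hmaps hinj le_rfl) fun _ _ => rfl

lemma integral_abs_le_sqrt_integral_sq {Ω : Type*} [MeasurableSpace Ω] {P : Measure Ω}
    [IsProbabilityMeasure P] {h : Ω → ℝ} (hh : MemLp h 2 P) :
    ∫ ω, |h ω| ∂P ≤ √(∫ ω, h ω ^ 2 ∂P) := by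
  apply Real.le_sqrt_of_sq_le
  have h1 := variance_nonneg (fun ω => |h ω|) P
  have hh' : MemLp (fun ω => |h ω|) 2 P := hh.abs
  rw [variance_eq_sub hh'] at h1
  simp only [Pi.pow_apply, sq_abs] at h1
  linarith

/-- Characteristic functions are stable under `L²` perturbations. -/
lemma norm_integral_cexp_sub_le {Ω : Type*} [MeasurableSpace Ω] {P : Measure Ω}
    [IsProbabilityMeasure P] {S T : Ω → ℝ} (hS : AEMeasurable S P) (hT : AEMeasurable T P)
    (hST : MemLp (fun ω => S ω - T ω) 2 P) :
    ‖∫ ω, Complex.exp (S ω * Complex.I) ∂P - ∫ ω, Complex.exp (T ω * Complex.I) ∂P‖ ≤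
      √(∫ ω, (S ω - T ω) ^ 2 ∂P) := by
  have hi : ∀ {U : Ω → ℝ}, AEMeasurable U P →
      Integrable (fun ω => Complex.exp (U ω * Complex.I)) P := fun {U} hU =>
    Integrable.of_bound (by fun_prop) 1 (ae_of_all _ fun ω => (Complex.norm_exp_ofReal_mul_I _).le)
  rw [← integral_sub (hi hS) (hi hT)]
  refine ((norm_integral_le_integral_norm _).trans ?_).trans (integral_abs_le_sqrt_integral_sq hST)
  refine integral_mono_of_nonneg (ae_of_all _ fun _ => norm_nonneg _)
    (hST.integrable one_le_two).abs (ae_of_all _ fun ω => ?_)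
  have h1 : Complex.exp (S ω * Complex.I) - Complex.exp (T ω * Complex.I) =
      Complex.exp (T ω * Complex.I) * (Complex.exp (Complex.I * ((S ω - T ω : ℝ) : ℂ)) - 1) := by
    rw [mul_sub, ← Complex.exp_add, mul_one]
    congr 2
    push_cast
    ring
  show ‖_‖ ≤ |S ω - T ω|
  rw [h1, norm_mul, Complex.norm_exp_ofReal_mul_I, one_mul]
  exact Real.norm_exp_I_mul_ofReal_sub_one_le

/-- Frequency 1 suffices: frequencies are absorbed into `W`, in the manner of Cramér and Wold. -/
lemma tendsto_integral_cexp_inv_sqrt_mul_sum {Ω : Type*} [MeasurableSpace Ω] {P : Measure Ω}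
    [IsProbabilityMeasure P] {W : ℕ → Ω → ℝ} (h2 : MemLp (W 0) 2 P) (h0 : ∫ ω, W 0 ω ∂P = 0)
    (hindep : iIndepFun W P) (hident : ∀ k, IdentDistrib (W k) (W 0) P P) {v : ℝ}
    (hv : ∫ ω, W 0 ω ^ 2 ∂P = v) :
    Tendsto (fun n : ℕ => ∫ ω, Complex.exp (((√n)⁻¹ * ∑ k ∈ Finset.range n, W k ω : ℝ) *
      Complex.I) ∂P) atTop (𝓝 (Complex.exp (-(v : ℂ) / 2))) := by
  have hvar : Var[W 0; P] = v := by
    rw [variance_eq_sub h2]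
    simp only [Pi.pow_apply]
    rw [h0, hv]; simp
  have hv0 : 0 ≤ v := hvar ▸ variance_nonneg _ _
  have hY : HasLaw id (gaussianReal 0 Var[W 0; P].toNNReal)
      (gaussianReal 0 Var[W 0; P].toNNReal) := ⟨aemeasurable_id, Measure.map_id⟩
  have h := tendstoInDistribution_inv_sqrt_mul_sum_sub hY h2 hindep hident
  have h3 := (ProbabilityMeasure.tendsto_iff_tendsto_charFun.1 h.tendsto) 1
  have hm : ∀ n : ℕ, AEMeasurable
      (fun ω => (√n)⁻¹ * (∑ k ∈ Finset.range n, W k ω - n * ∫ ω, W 0 ω ∂P)) P :=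
    h.forall_aemeasurable
  simp only [ProbabilityMeasure.coe_mk, Measure.map_id, charFun_gaussianReal] at h3
  have h4 : ∀ n : ℕ, charFun (P.map
      (fun ω => (√n)⁻¹ * (∑ k ∈ Finset.range n, W k ω - n * ∫ ω, W 0 ω ∂P))) 1 =
      ∫ ω, Complex.exp (((√n)⁻¹ * ∑ k ∈ Finset.range n, W k ω : ℝ) * Complex.I) ∂P := by
    intro n
    rw [charFun_apply_real, integral_map (hm n) (by fun_prop)]
    simp [h0]
  simp_rw [h4] at h3
  convert h3 using 2
  rw [hvar, Real.coe_toNNReal _ hv0]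
  simp
  ring_nf

/-- The consecutive blocks of an i.i.d. sequence are i.i.d. -/
lemma iIndepFun_consecutive_blocks {Ω E : Type*} [MeasurableSpace Ω] [MeasurableSpace E]
    {P : Measure Ω} [IsProbabilityMeasure P] {μ : Measure E} [IsProbabilityMeasure μ]
    {X : ℕ → Ω → E} (hX : ∀ k, Measurable (X k)) (hlaw : ∀ k, P.map (X k) = μ)
    (hindep : iIndepFun X P) (B : ℕ) :
    iIndepFun (fun a ω (i : Fin B) => X (a * B + i) ω) P ∧
    ∀ a, P.map (fun ω (i : Fin B) => X (a * B + i) ω) = Measure.pi fun _ => μ := by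
  have hinj : Function.Injective fun q : (_ : ℕ) × Fin B => q.1 * B + (q.2 : ℕ) := by
    rintro ⟨a, i⟩ ⟨b, j⟩ h
    simp only at h
    have h1 : a = b := by
      have hi := i.2
      have hj := j.2
      rcases lt_trichotomy a b with hab | hab | hab
      · have := Nat.mul_le_mul_right B (Nat.succ_le_of_lt hab)
        rw [Nat.succ_mul] at this
        omega
      · exact hab
      · have := Nat.mul_le_mul_right B (Nat.succ_le_of_lt hab)
        rw [Nat.succ_mul] at this
        omega
    subst h1
    have : i = j := Fin.ext (by omega)
    rw [this]
  have h1 := hindep.precomp hinj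
  have hlawB : ∀ a, P.map (fun ω (i : Fin B) => X (a * B + i) ω) = Measure.pi fun _ => μ := by
    intro a
    have h2 : iIndepFun (fun (i : Fin B) => X (a * B + i)) P := hindep.precomp
      (g := fun i : Fin B => a * B + (i : ℕ)) fun i j h => Fin.ext (by simpa using h)
    rw [(iIndepFun_iff_map_fun_eq_pi_map fun i => (hX _).aemeasurable).1 h2]
    simp_rw [hlaw]
  refine ⟨?_, hlawB⟩
  rw [iIndepFun_iff_map_fun_eq_infinitePi_map (fun a => by fun_prop)]
  rw [iIndepFun_iff_map_fun_eq_infinitePi_map (fun q => hX _)] at h1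
  -- Regrouping the index (a, i) is currying, and an infinite product measure curries to an infinite
  -- product of its blocks.
  have h3 := congrArg (Measure.map (MeasurableEquiv.piCurry fun (_ : ℕ) (_ : Fin B) => E)) h1
  rw [Measure.map_map (by fun_prop) (by fun_prop)] at h3
  simp_rw [hlaw] at h3
  rw [Measure.infinitePi_map_piCurry (fun (_ : ℕ) (_ : Fin B) => μ)] at h3
  simp_rw [hlawB, ← Measure.infinitePi_eq_pi]
  exact h3

/-! ### Orthogonality of sample points and cyclically shifted points -/

section Sums

variable {d : ℕ} {p : Fin d → ℕ} {μ : Measure (BlockSpace p)} [IsProbabilityMeasure μ]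
  {Ω : Type*} [MeasurableSpace Ω] {P : Measure Ω} [IsProbabilityMeasure P]
  {X : ℕ → Ω → BlockSpace p}

/-- The entry pattern of a sample point (`true`) or of a cyclically shifted point (`false`). -/
def pattern (d n k : ℕ) (b : Bool) (j : Fin d) : ℕ := if b then k else (k + j) % n

lemma mixedPoint_pattern_true (n k : ℕ) (x : ℕ → BlockSpace p) :
    mixedPoint (pattern d n k true) x = x k := rfl

lemma mixedPoint_pattern_false (n k : ℕ) (x : ℕ → BlockSpace p) :
    mixedPoint (pattern d n k false) x = shiftedPoint p n x k := rfl

lemma mod_add_inj {n k i j : ℕ} (hi : i < n) (hj : j < n) (h : (k + i) % n = (k + j) % n) :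
    i = j := by
  have h' : i ≡ j [MOD n] := Nat.ModEq.add_left_cancel' k h
  rwa [Nat.ModEq, Nat.mod_eq_of_lt hi, Nat.mod_eq_of_lt hj] at h'

/-- Two distinct sample points, or two distinct shifts, share no entry at all. Sample point k meets
the shift started at l only where l + j ≡ k mod n, which determines j because all block indices are
below d ≤ n. -/
lemma pattern_agree {n k l : ℕ} (hn : d ≤ n) (hk : k < n) (hl : l < n) {b b' : Bool}
    (h : (k, b) ≠ (l, b')) (i j : Fin d) (hi : pattern d n k b i = pattern d n l b' i)
    (hj : pattern d n k b j = pattern d n l b' j) : i = j := by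
  have hin := i.2.trans_le hn
  have hjn := j.2.trans_le hn
  cases b <;> cases b' <;> simp only [pattern, if_true, Bool.false_eq_true, if_false] at hi hj
  · rw [add_comm k, add_comm l] at hi
    exact absurd (by rw [mod_add_inj hk hl hi]) h
  · exact Fin.ext (mod_add_inj hin hjn (hi.trans hj.symm))
  · exact Fin.ext (mod_add_inj hin hjn (hi.symm.trans hj))
  · exact absurd (by rw [hi]) h

omit [IsProbabilityMeasure μ] in
lemma IsDegenerate.conj {ψ : BlockSpace p → ℂ} (h : IsDegenerate μ ψ) :
    IsDegenerate μ (fun x => conj (ψ x)) := fun j y => by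
  rw [integral_conj, h j y, map_zero]

/-- The second moment of a weighted sum of a degenerate function over a set of points. -/
lemma integral_norm_sum_pattern_sq (hd : 1 ≤ d) (hX : ∀ k, Measurable (X k))
    (hlaw : ∀ k, P.map (X k) = μ) (hindep : iIndepFun X P)
    (hμ : iIndepFun (fun (j : Fin d) (x : BlockSpace p) => x j) μ)
    {ψ : BlockSpace p → ℂ} (hψ : Measurable ψ) {C : ℝ} (hC : ∀ x, ‖ψ x‖ ≤ C)
    (hdeg : IsDegenerate μ ψ) {n : ℕ} (hn : d ≤ n) (s : Finset (ℕ × Bool))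
    (hs : ∀ q ∈ s, q.1 < n) (c : ℕ × Bool → ℝ) :
    ∫ ω, ‖∑ q ∈ s, (c q : ℂ) * ψ (mixedPoint (pattern d n q.1 q.2) fun k => X k ω)‖ ^ 2 ∂P =
      ∑ q ∈ s, c q ^ 2 * ∫ x, ‖ψ x‖ ^ 2 ∂μ := by
  have hm := fun a : Fin d → ℕ => measurable_mixedPoint hX a
  have h := integral_norm_sum_sq_of_orthogonal (P := P) s
    (Z := fun q ω => ψ (mixedPoint (pattern d n q.1 q.2) fun k => X k ω)) (C := C)
    (fun q _ => hψ.comp (hm _)) (fun q _ ω => hC _) (fun q hq q' hq' hne => by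
      exact integral_mul_mixedPoint_eq_zero hd hX hlaw hindep hμ hψ
        (ψ := fun x => conj (ψ x)) (Complex.continuous_conj.measurable.comp hψ) hC
        (D := C) (fun x => by rw [RCLike.norm_conj]; exact hC x) hdeg.conj
        (pattern_agree hn (hs q hq) (hs q' hq') hne)) c
  rw [h]
  refine Finset.sum_congr rfl fun q _ => ?_
  congr 1
  rw [← map_mixedPoint hX hlaw hindep hμ (pattern d n q.1 q.2),
    integral_map (hm _).aemeasurable (hψ.norm.pow_const 2).aestronglyMeasurable]

lemma integral_norm_sum_sample_sq (hd : 1 ≤ d) (hX : ∀ k, Measurable (X k))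
    (hlaw : ∀ k, P.map (X k) = μ) (hindep : iIndepFun X P)
    (hμ : iIndepFun (fun (j : Fin d) (x : BlockSpace p) => x j) μ)
    {ψ : BlockSpace p → ℂ} (hψ : Measurable ψ) {C : ℝ} (hC : ∀ x, ‖ψ x‖ ≤ C)
    (hdeg : IsDegenerate μ ψ) {n : ℕ} (hn : d ≤ n) (c : ℕ → ℝ) :
    ∫ ω, ‖∑ k ∈ Finset.range n, (c k : ℂ) * ψ (X k ω)‖ ^ 2 ∂P =
      (∑ k ∈ Finset.range n, c k ^ 2) * ∫ x, ‖ψ x‖ ^ 2 ∂μ := by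
  have h := integral_norm_sum_pattern_sq hd hX hlaw hindep hμ hψ hC hdeg hn
    (Finset.range n ×ˢ {true}) (by simp) (fun q => c q.1)
  simp only [Finset.sum_product, Finset.sum_singleton, mixedPoint_pattern_true] at h
  rw [h, Finset.sum_mul]

/-- All 2n points are pairwise orthogonal and equally distributed, so the signs are irrelevant and
each weight is counted twice. -/
lemma integral_norm_sum_sub_shifted_sq (hd : 1 ≤ d) (hX : ∀ k, Measurable (X k))
    (hlaw : ∀ k, P.map (X k) = μ) (hindep : iIndepFun X P)
    (hμ : iIndepFun (fun (j : Fin d) (x : BlockSpace p) => x j) μ)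
    {ψ : BlockSpace p → ℂ} (hψ : Measurable ψ) {C : ℝ} (hC : ∀ x, ‖ψ x‖ ≤ C)
    (hdeg : IsDegenerate μ ψ) {n : ℕ} (hn : d ≤ n) (c : ℕ → ℝ) :
    ∫ ω, ‖∑ k ∈ Finset.range n, (c k : ℂ) *
        (ψ (X k ω) - ψ (shiftedPoint p n (fun k => X k ω) k))‖ ^ 2 ∂P =
      (∑ k ∈ Finset.range n, c k ^ 2) * (2 * ∫ x, ‖ψ x‖ ^ 2 ∂μ) := by
  have h := integral_norm_sum_pattern_sq hd hX hlaw hindep hμ hψ hC hdeg hn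
    (Finset.range n ×ˢ Finset.univ) (by simp) (fun q => if q.2 then c q.1 else -c q.1)
  simp only [Finset.sum_product, Fintype.sum_bool, mixedPoint_pattern_true,
    mixedPoint_pattern_false, if_true, Bool.false_eq_true, if_false] at h
  have e : ∀ ω, ∑ k ∈ Finset.range n, (c k : ℂ) *
        (ψ (X k ω) - ψ (shiftedPoint p n (fun k => X k ω) k)) =
      ∑ k ∈ Finset.range n, ((c k : ℂ) * ψ (X k ω) +
        ((-c k : ℝ) : ℂ) * ψ (shiftedPoint p n (fun k => X k ω) k)) := fun ω =>
    Finset.sum_congr rfl fun k _ => by push_cast; ring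
  simp_rw [e]
  rw [h, Finset.sum_mul]
  exact Finset.sum_congr rfl fun k _ => by ring

end Sums

/-! ### Central limit theorem for the cyclically shifted differences -/

section CentralLimit

variable {d : ℕ} {p : Fin d → ℕ} {μ : Measure (BlockSpace p)} [IsProbabilityMeasure μ]
  {Ω : Type*} [MeasurableSpace Ω] {P : Measure Ω} [IsProbabilityMeasure P]
  {X : ℕ → Ω → BlockSpace p}

lemma measurable_shiftedPoint (hX : ∀ k, Measurable (X k)) (n k : ℕ) :
    Measurable fun ω => shiftedPoint p n (fun k => X k ω) k :=
  measurable_mixedPoint hX (pattern d n k false)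

/-- `integral_norm_sum_sub_shifted_sq` for real functions. -/
lemma integral_sum_sub_shifted_sq (hd : 1 ≤ d) (hX : ∀ k, Measurable (X k))
    (hlaw : ∀ k, P.map (X k) = μ) (hindep : iIndepFun X P)
    (hμ : iIndepFun (fun (j : Fin d) (x : BlockSpace p) => x j) μ)
    {f : BlockSpace p → ℝ} (hf : Measurable f) {C : ℝ} (hC : ∀ x, |f x| ≤ C)
    (hdeg : IsDegenerate μ (fun x => (f x : ℂ))) {n : ℕ} (hn : d ≤ n) (c : ℕ → ℝ) :
    ∫ ω, (∑ k ∈ Finset.range n, c k *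
        (f (X k ω) - f (shiftedPoint p n (fun k => X k ω) k))) ^ 2 ∂P =
      (∑ k ∈ Finset.range n, c k ^ 2) * (2 * ∫ x, f x ^ 2 ∂μ) := by
  have h := integral_norm_sum_sub_shifted_sq hd hX hlaw hindep hμ
    (Complex.measurable_ofReal.comp hf) (C := C)
    (fun x => by simpa using hC x) hdeg hn c
  simp only [Function.comp_apply] at h
  have e : ∀ r : ℝ, ‖(r : ℂ)‖ ^ 2 = r ^ 2 := fun r => by simp
  have e2 : ∀ ω, ∑ k ∈ Finset.range n, (c k : ℂ) *
        ((f (X k ω) : ℂ) - f (shiftedPoint p n (fun k => X k ω) k)) =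
      ((∑ k ∈ Finset.range n, c k *
        (f (X k ω) - f (shiftedPoint p n (fun k => X k ω) k)) : ℝ) : ℂ) := fun ω => by
    push_cast; rfl
  simp_rw [e2, e] at h
  exact h

lemma sum_range_mul_indicator {B L : ℕ} (hB : L ≤ B) (g : ℕ → ℝ) (r : ℕ) :
    ∑ k ∈ Finset.range (r * B), (if k % B < L then g k else 0) =
      ∑ a ∈ Finset.range r, ∑ i ∈ Finset.range L, g (a * B + i) := by
  induction r with
  | zero => simp
  | succ r ih =>
    rw [Nat.succ_mul, Finset.sum_range_add, ih, Finset.sum_range_succ]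
    congr 1
    have h1 : ∀ i ∈ Finset.range B, (if (r * B + i) % B < L then g (r * B + i) else 0) =
        if i < L then g (r * B + i) else 0 := fun i hi => by
      rw [Nat.add_mod, Nat.mul_mod_left, zero_add, Nat.mod_mod,
        Nat.mod_eq_of_lt (Finset.mem_range.1 hi)]
    rw [Finset.sum_congr rfl h1, ← Finset.sum_filter]
    congr 1
    ext i
    simp only [Finset.mem_filter, Finset.mem_range]
    omega

/-- The central limit theorem for the blocks of the shifted differences. -/
lemma tendsto_integral_cexp_blocks (hd : 1 ≤ d) (hX : ∀ k, Measurable (X k))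
    (hlaw : ∀ k, P.map (X k) = μ) (hindep : iIndepFun X P)
    (hμ : iIndepFun (fun (j : Fin d) (x : BlockSpace p) => x j) μ)
    {f : BlockSpace p → ℝ} (hf : Measurable f) {C : ℝ} (hC : ∀ x, |f x| ≤ C)
    (hdeg : IsDegenerate μ (fun x => (f x : ℂ))) (L : ℕ) (s : ℝ) :
    Tendsto (fun r : ℕ => ∫ ω, Complex.exp (((√r)⁻¹ * ∑ a ∈ Finset.range r,
        (s * ∑ i ∈ Finset.range L, (f (X (a * (L + d) + i) ω) -
          f (mixedPoint (fun j => a * (L + d) + i + j) fun k => X k ω))) : ℝ) *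
      Complex.I) ∂P) atTop (𝓝 (Complex.exp (-((s ^ 2 * (L * (2 * ∫ x, f x ^ 2 ∂μ)) : ℝ) : ℂ) / 2))) := by
  set B := L + d with hB
  -- the block functional
  let V : (Fin B → BlockSpace p) → ℝ := fun y => s * ∑ i : Fin L,
    (f (y ⟨i, by omega⟩) - f (mixedPoint (fun j => i + j)
      fun k => if h : k < B then y ⟨k, h⟩ else 0))
  have hVm : Measurable V := by
    refine (Finset.measurable_sum _ fun i _ => ?_).const_mul s
    have h1 : Measurable fun y : Fin B → BlockSpace p => y ⟨i, by omega⟩ := measurable_pi_apply _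
    have h2 := measurable_mixedPoint (X := fun k (y : Fin B → BlockSpace p) =>
      if h : k < B then y ⟨k, h⟩ else 0) (fun k => by
        by_cases h : k < B
        · simp only [h, dif_pos]; exact measurable_pi_apply _
        · simp [h]) (fun j : Fin d => (i : ℕ) + j)
    exact (hf.comp h1).sub (hf.comp h2)
  have hVb : ∀ y, |V y| ≤ |s| * (L * (C + C)) := fun y => by
    simp only [V, abs_mul]
    refine mul_le_mul_of_nonneg_left ((Finset.abs_sum_le_sum_abs _ _).trans ?_) (abs_nonneg _)
    refine (Finset.sum_le_sum fun i _ => (abs_sub _ _).trans (add_le_add (hC _) (hC _))).trans ?_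
    simp [mul_add]
  obtain ⟨hY, hYlaw⟩ := iIndepFun_consecutive_blocks hX hlaw hindep B
  have hYm : ∀ a, Measurable fun ω (i : Fin B) => X (a * B + i) ω := fun a =>
    measurable_pi_lambda _ fun i => hX _
  have hVeq : ∀ a ω, V (fun i : Fin B => X (a * B + i) ω) =
      s * ∑ i ∈ Finset.range L, (f (X (a * B + i) ω) -
        f (mixedPoint (fun j => a * B + i + j) fun k => X k ω)) := fun a ω => by
    rw [Finset.sum_range]
    simp only [V]
    congr 1
    refine Finset.sum_congr rfl fun i _ => ?_
    congr 2
    unfold mixedPoint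
    congr 1
    funext j
    -- Starting indices are below `L` and block indices below `d`, so a shifted point never leaves
    -- its block and the default value 0 in `V` is never read.
    have : (i : ℕ) + j < B := by omega
    simp only [this, dif_pos, add_assoc]
  have hid : ∀ a, IdentDistrib (fun ω => V (fun i : Fin B => X (a * B + i) ω))
      (fun ω => V (fun i : Fin B => X (0 * B + i) ω)) P P := fun a =>
    IdentDistrib.comp (u := V) ⟨(hYm a).aemeasurable, (hYm 0).aemeasurable,
      (hYlaw a).trans (hYlaw 0).symm⟩ hVm
  have hWind : iIndepFun (fun a ω => V (fun i : Fin B => X (a * B + i) ω)) P :=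
    hY.comp (fun _ => V) fun _ => hVm
  have hL2 : MemLp (fun ω => V (fun i : Fin B => X (0 * B + i) ω)) 2 P :=
    MemLp.of_bound (hVm.comp (hYm 0)).aestronglyMeasurable (|s| * (L * (C + C)))
      (ae_of_all _ fun ω => by 
        exact hVb (fun i : Fin B => X (0 * B + i) ω))
  have hfi : ∀ a : Fin d → ℕ, Integrable (fun ω => f (mixedPoint a fun k => X k ω)) P := fun a =>
    integrable_of_measurable_bounded (hf.comp (measurable_mixedPoint hX a)) fun ω => hC _
  have hfmean : ∀ a : Fin d → ℕ, ∫ ω, f (mixedPoint a fun k => X k ω) ∂P = ∫ x, f x ∂μ := fun a => by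
    rw [← map_mixedPoint hX hlaw hindep hμ a,
      integral_map (measurable_mixedPoint hX a).aemeasurable hf.aestronglyMeasurable]
  have hfi' : ∀ k, Integrable (fun ω => f (X k ω)) P := fun k => hfi fun _ => k
  have hfmean' : ∀ k, ∫ ω, f (X k ω) ∂P = ∫ x, f x ∂μ := fun k => hfmean fun _ => k
  have hmean : ∫ ω, V (fun i : Fin B => X (0 * B + i) ω) ∂P = 0 := by
    simp_rw [hVeq]
    rw [integral_const_mul, integral_finsetSum]
    · rw [Finset.sum_eq_zero, mul_zero]
      intro i _
      rw [integral_sub (hfi' _) (hfi _), hfmean, hfmean', sub_self]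
    · exact fun i _ => (hfi' _).sub (hfi _)
  have hvar : ∫ ω, V (fun i : Fin B => X (0 * B + i) ω) ^ 2 ∂P =
      s ^ 2 * (L * (2 * ∫ x, f x ^ 2 ∂μ)) := by
    simp_rw [hVeq, mul_pow]
    rw [integral_const_mul]
    congr 1
    -- The first block is viewed as a cyclic sample of size `B` with weight 1 on the first `L`
    -- indices, for which the shift does not wrap around.
    have h := integral_sum_sub_shifted_sq hd hX hlaw hindep hμ hf hC hdeg
      (show d ≤ B by omega) (fun k => if k < L then 1 else 0)
    have e1 : ∑ k ∈ Finset.range B, (if k < L then (1 : ℝ) else 0) ^ 2 = L := by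
      simp only [ite_pow, one_pow, ne_eq, OfNat.ofNat_ne_zero, not_false_eq_true, zero_pow]
      rw [← Finset.sum_filter]
      have : (Finset.range B).filter (· < L) = Finset.range L := by
        ext i; simp only [Finset.mem_filter, Finset.mem_range]; omega
      rw [this]; simp
    rw [e1] at h
    rw [← h]
    refine integral_congr_ae (ae_of_all _ fun ω => ?_)
    simp only [ite_mul, one_mul, zero_mul]
    rw [← Finset.sum_filter]
    have : (Finset.range B).filter (· < L) = Finset.range L := by
      ext i; simp only [Finset.mem_filter, Finset.mem_range]; omega
    rw [this]
    congr 1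
    refine Finset.sum_congr rfl fun i hi => ?_
    have hiL := Finset.mem_range.1 hi
    simp only [zero_add]
    congr 2
    unfold mixedPoint shiftedPoint
    congr 1
    funext j
    rw [Nat.mod_eq_of_lt (by omega : i + (j : ℕ) < B)]
  have h := tendsto_integral_cexp_inv_sqrt_mul_sum hL2 hmean hWind hid hvar
  simp_rw [hVeq] at h
  exact h

/-- The central limit theorem for the cyclically shifted differences. -/
lemma tendsto_integral_cexp_sub_shifted (hd : 1 ≤ d) (hX : ∀ k, Measurable (X k))
    (hlaw : ∀ k, P.map (X k) = μ) (hindep : iIndepFun X P)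
    (hμ : iIndepFun (fun (j : Fin d) (x : BlockSpace p) => x j) μ)
    {f : BlockSpace p → ℝ} (hf : Measurable f) {C : ℝ} (hC : ∀ x, |f x| ≤ C)
    (hdeg : IsDegenerate μ (fun x => (f x : ℂ))) :
    Tendsto (fun n : ℕ => ∫ ω, Complex.exp (((√n)⁻¹ * ∑ k ∈ Finset.range n,
        (f (X k ω) - f (shiftedPoint p n (fun k => X k ω) k)) : ℝ) * Complex.I) ∂P) atTop
      (𝓝 (Complex.exp (-((2 * ∫ x, f x ^ 2 ∂μ : ℝ) : ℂ) / 2))) := by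
  set v : ℝ := 2 * ∫ x, f x ^ 2 ∂μ with hv
  have hv0 : 0 ≤ v := mul_nonneg zero_le_two (integral_nonneg fun _ => sq_nonneg _)
  set D : ℕ → ℕ → Ω → ℝ := fun n k ω =>
    f (X k ω) - f (shiftedPoint p n (fun k => X k ω) k) with hD
  have hDm : ∀ n k, Measurable (D n k) := fun n k =>
    (hf.comp (hX k)).sub (hf.comp (measurable_shiftedPoint hX n k))
  have hDb : ∀ n k ω, |D n k ω| ≤ C + C := fun n k ω =>
    (abs_sub _ _).trans (add_le_add (hC _) (hC _))
  -- the ratio of kept indices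
  set lam : ℕ → ℝ := fun L => (L : ℝ) / ((L + d : ℕ) : ℝ) with hlam
  have hlam1 : Tendsto lam atTop (𝓝 1) := by
    have := tendsto_natCast_div_add_atTop (𝕜 := ℝ) (d : ℝ)
    simpa [hlam] using this
  rw [Metric.tendsto_nhds]
  intro ε hε
  have t1 : Tendsto (fun L => √((1 - lam L) * v)) atTop (𝓝 0) := by
    have : Tendsto (fun L => √((1 - lam L) * v)) atTop (𝓝 (√((1 - 1) * v))) :=
      ((tendsto_const_nhds.sub hlam1).mul_const v).sqrt
    simpa using this
  have t2 : Tendsto (fun L => Complex.exp (-((lam L * v : ℝ) : ℂ) / 2)) atTop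
      (𝓝 (Complex.exp (-(v : ℂ) / 2))) := by
    have h : Tendsto (fun L => lam L * v) atTop (𝓝 v) := by simpa using hlam1.mul_const v
    have hc : Continuous fun r : ℝ => Complex.exp (-(r : ℂ) / 2) := by fun_prop
    exact (hc.tendsto v).comp h
  -- Bernstein blocking: of every L + d starting indices only the first L are kept, so different
  -- blocks read disjoint observations. `L` makes the kept fraction close enough to 1 for the
  -- discarded mean square and for the loss of variance.
  obtain ⟨L, ⟨hL1, hL2⟩, hL0⟩ := ((((t1.eventually_lt_const (show (0 : ℝ) < ε / 3 by positivity))).and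
    (Metric.tendsto_nhds.1 t2 (ε / 3) (by positivity))).and (eventually_ge_atTop 1)).exists
  set B := L + d with hB
  have hB0 : 0 < B := by omega
  have hBr : (0 : ℝ) < B := by exact_mod_cast hB0
  -- the blocked sum
  set s : ℝ := (√B)⁻¹ with hs
  set T : ℕ → Ω → ℝ := fun r ω => (√r)⁻¹ * ∑ a ∈ Finset.range r,
        (s * ∑ i ∈ Finset.range L, (f (X (a * (L + d) + i) ω) -
          f (mixedPoint (fun j => a * (L + d) + i + j) fun k => X k ω))) with hT
  have hlim := tendsto_integral_cexp_blocks hd hX hlaw hindep hμ hf hC hdeg L s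
  have hsv : s ^ 2 * (L * (2 * ∫ x, f x ^ 2 ∂μ)) = lam L * v := by
    rw [hs, inv_pow, Real.sq_sqrt hBr.le]
    simp only [hlam, hv, hB]
    field_simp
  rw [hsv] at hlim
  have hdiv : Tendsto (fun n : ℕ => n / B) atTop atTop := Nat.tendsto_div_const_atTop hB0.ne'
  have hlimn := hlim.comp hdiv
  -- The weight of the k-th difference in the blocked sum: zero on the gaps and on the incomplete
  -- last block.
  set c : ℕ → ℕ → ℝ := fun n k => if k < n / B * B then
    (if k % B < L then (√(n / B : ℕ))⁻¹ * s else 0) else 0 with hc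
  have hTeq : ∀ n ω, T (n / B) ω = ∑ k ∈ Finset.range n, c n k * D n k ω := by
    intro n ω
    have hle : n / B * B ≤ n := Nat.div_mul_le_self n B
    have h1 : ∑ k ∈ Finset.range n, c n k * D n k ω = ∑ k ∈ Finset.range (n / B * B),
        (if k % B < L then (√(n / B : ℕ))⁻¹ * s * D n k ω else 0) := by
      simp only [hc, ite_mul, zero_mul]
      rw [← Finset.sum_filter]
      refine Finset.sum_congr ?_ fun _ _ => rfl
      ext k
      simp only [Finset.mem_filter, Finset.mem_range]
      omega
    rw [h1, sum_range_mul_indicator (by omega)]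
    simp only [hT]
    rw [Finset.mul_sum]
    refine Finset.sum_congr rfl fun a ha => ?_
    rw [← mul_assoc, Finset.mul_sum]
    refine Finset.sum_congr rfl fun i hi => ?_
    simp only [hD]
    congr 3
    unfold mixedPoint shiftedPoint
    congr 1
    funext j
    have ha' := Finset.mem_range.1 ha
    have hi' := Finset.mem_range.1 hi
    have : (a + 1) * B ≤ n / B * B := Nat.mul_le_mul_right B ha'
    rw [Nat.succ_mul] at this
    -- A kept index lies in a complete block, which ends at or before n; the reduction modulo n is
    -- therefore void.
    rw [Nat.mod_eq_of_lt (by omega : a * B + i + (j : ℕ) < n)]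
  have hSeq : ∀ (n : ℕ) ω, (√(n : ℝ))⁻¹ * ∑ k ∈ Finset.range n, D n k ω =
      ∑ k ∈ Finset.range n, (√(n : ℝ))⁻¹ * D n k ω := fun n ω => Finset.mul_sum _ _ _
  -- the distance between the sum and the blocked sum
  have hdist : ∀ n : ℕ, n ≥ B → ∫ ω, ((√(n : ℝ))⁻¹ * ∑ k ∈ Finset.range n, D n k ω - T (n / B) ω) ^ 2 ∂P =
      (1 + lam L - 2 * (lam L * √(((n / B : ℕ) : ℝ) / n * B))) * v := by
    intro n hn
    have hn0 : (0 : ℝ) < n := by exact_mod_cast hB0.trans_le hn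
    have hr0 : (0 : ℝ) < (n / B : ℕ) := by exact_mod_cast Nat.div_pos hn hB0
    simp_rw [hSeq, hTeq, ← Finset.sum_sub_distrib, ← sub_mul]
    -- Both sums are weighted sums of the same differences, so by orthogonality their distance is Σ
    -- (n^{−1/2} − c)² times v, an explicit number.
    have h := integral_sum_sub_shifted_sq hd hX hlaw hindep hμ hf hC hdeg
      (show d ≤ n by omega) (fun k => (√(n : ℝ))⁻¹ - c n k)
    refine h.trans ?_
    rw [← hv]
    congr 1
    have hcnt : ∀ x : ℝ, ∑ k ∈ Finset.range n, (if k < n / B * B then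
        (if k % B < L then x else 0) else 0) = (n / B : ℕ) * (L * x) := by
      intro x
      have hle : n / B * B ≤ n := Nat.div_mul_le_self n B
      rw [← Finset.sum_filter]
      have : (Finset.range n).filter (· < n / B * B) = Finset.range (n / B * B) := by
        ext k
        simp only [Finset.mem_filter, Finset.mem_range]
        omega
      rw [this, sum_range_mul_indicator (by omega)]
      simp
    have e1 : ∀ k, ((√(n : ℝ))⁻¹ - c n k) ^ 2 = (n : ℝ)⁻¹ - 2 * (√(n : ℝ))⁻¹ * c n k +
        (if k < n / B * B then (if k % B < L then ((√(n / B : ℕ))⁻¹ * s) ^ 2 else 0) else 0) := by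
      intro k
      rw [sub_sq, inv_pow, Real.sq_sqrt hn0.le]
      congr 1
      simp only [hc]
      split_ifs <;> simp
    simp_rw [e1]
    rw [Finset.sum_add_distrib, Finset.sum_sub_distrib, hcnt, ← Finset.mul_sum]
    simp only [hc]
    rw [hcnt]
    simp only [Finset.sum_const, Finset.card_range, nsmul_eq_mul]
    rw [mul_inv_cancel₀ hn0.ne', mul_pow, inv_pow, Real.sq_sqrt hr0.le, hs, inv_pow,
      Real.sq_sqrt hBr.le, Real.sqrt_mul (by positivity), Real.sqrt_div hr0.le]
    have q1 : √(n : ℝ) ≠ 0 := (Real.sqrt_pos.2 hn0).ne'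
    have q2 : √((n / B : ℕ) : ℝ) ≠ 0 := (Real.sqrt_pos.2 hr0).ne'
    have q3 : √(B : ℝ) ≠ 0 := (Real.sqrt_pos.2 hBr).ne'
    have s2 : √((n / B : ℕ) : ℝ) ^ 2 = (n / B : ℕ) := Real.sq_sqrt hr0.le
    have s3 : √(B : ℝ) ^ 2 = B := Real.sq_sqrt hBr.le
    have hlamB : lam L = L / B := rfl
    rw [hlamB]
    rw [show (L : ℝ) / B = L / √(B : ℝ) ^ 2 by rw [s3]]
    have s2' : ((n / B : ℕ) : ℝ) * (L * ((√((n / B : ℕ) : ℝ))⁻¹ * (√(B : ℝ))⁻¹)) =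
      √((n / B : ℕ) : ℝ) ^ 2 * (L * ((√((n / B : ℕ) : ℝ))⁻¹ * (√(B : ℝ))⁻¹)) := by rw [s2]
    rw [s2']
    have s4 : ((n / B : ℕ) : ℝ) * (L * ((((n / B : ℕ) : ℝ))⁻¹ * (B : ℝ)⁻¹)) =
      L / √(B : ℝ) ^ 2 := by rw [s3]; field_simp
    rw [s4]
    field_simp
    ring
  have hratio : Tendsto (fun n : ℕ => √(((n / B : ℕ) : ℝ) / n * B)) atTop (𝓝 1) := by
    have h1 : Tendsto (fun n : ℕ => ((n / B : ℕ) : ℝ) / n) atTop (𝓝 (1 / B : ℝ)) := by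
      have h := (tendsto_nat_floor_mul_div_atTop (R := ℝ) (a := 1 / B) (by positivity)).comp
        tendsto_natCast_atTop_atTop
      refine h.congr fun n => ?_
      simp only [Function.comp_apply]
      congr 2
      rw [one_div, inv_mul_eq_div, Nat.floor_div_natCast, Nat.floor_natCast]
    have h2 := (h1.mul_const (B : ℝ)).sqrt
    rwa [one_div, inv_mul_cancel₀ hBr.ne', Real.sqrt_one] at h2
  -- Since ⌊n/B⌋B/n tends to 1, the distance tends to that of the discarded fraction: 1 + λ − 2λ = 1
  -- − λ.
  have hdist0 : Tendsto (fun n : ℕ =>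
      √((1 + lam L - 2 * (lam L * √(((n / B : ℕ) : ℝ) / n * B))) * v)) atTop
      (𝓝 (√((1 - lam L) * v))) := by
    have : Tendsto (fun n : ℕ =>
      √((1 + lam L - 2 * (lam L * √(((n / B : ℕ) : ℝ) / n * B))) * v)) atTop
      (𝓝 (√((1 + lam L - 2 * (lam L * 1)) * v))) :=
      ((tendsto_const_nhds.sub ((hratio.const_mul _).const_mul _)).mul_const v).sqrt
    convert this using 4
    ring
  have hTm : ∀ r, Measurable (T r) := fun r => by
    refine (Finset.measurable_sum _ fun a _ => (Finset.measurable_sum _ fun i _ => ?_).const_mul _).const_mul _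
    exact (hf.comp (hX _)).sub (hf.comp (measurable_mixedPoint hX _))
  have hSm : ∀ n : ℕ, Measurable fun ω => (√n)⁻¹ * ∑ k ∈ Finset.range n, D n k ω := fun n =>
    (Finset.measurable_sum _ fun k _ => hDm n k).const_mul _
  filter_upwards [hdist0.eventually_lt_const hL1,
    Metric.tendsto_nhds.1 hlimn (ε / 3) (by positivity), eventually_ge_atTop B] with n a1 a2 a3
  have hmem : MemLp (fun ω => (√n)⁻¹ * ∑ k ∈ Finset.range n, D n k ω - T (n / B) ω) 2 P := by
    refine MemLp.of_bound ((hSm n).sub (hTm _)).aestronglyMeasurable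
      (∑ k ∈ Finset.range n, |(√(n : ℝ))⁻¹ - c n k| * (C + C)) (ae_of_all _ fun ω => ?_)
    rw [hSeq, hTeq, ← Finset.sum_sub_distrib, Real.norm_eq_abs]
    refine (Finset.abs_sum_le_sum_abs _ _).trans (Finset.sum_le_sum fun k _ => ?_)
    rw [← sub_mul, abs_mul]
    exact mul_le_mul_of_nonneg_left (hDb _ _ _) (abs_nonneg _)
  have b1 := norm_integral_cexp_sub_le (hSm n).aemeasurable (hTm (n / B)).aemeasurable hmem
  rw [hdist n a3] at b1
  rw [dist_eq_norm] at a2 hL2 ⊢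
  have b2 := norm_sub_le_norm_sub_add_norm_sub
    (∫ ω, Complex.exp (((√n)⁻¹ * ∑ k ∈ Finset.range n, D n k ω : ℝ) * Complex.I) ∂P)
    (∫ ω, Complex.exp ((T (n / B) ω : ℝ) * Complex.I) ∂P) (Complex.exp (-(v : ℂ) / 2))
  have b3 := norm_sub_le_norm_sub_add_norm_sub
    (∫ ω, Complex.exp ((T (n / B) ω : ℝ) * Complex.I) ∂P)
    (Complex.exp (-((lam L * v : ℝ) : ℂ) / 2)) (Complex.exp (-(v : ℂ) / 2))
  refine lt_of_le_of_lt b2 ?_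
  have a2' : ‖∫ ω, Complex.exp ((T (n / B) ω : ℝ) * Complex.I) ∂P -
    Complex.exp (-((lam L * v : ℝ) : ℂ) / 2)‖ < ε / 3 := a2
  linarith

end CentralLimit

/-! ### The two statistics as averages of the kernel -/

section Statistics

variable {d : ℕ} {p : Fin d → ℕ} {μ : Measure (BlockSpace p)} [IsProbabilityMeasure μ]
  {Ω : Type*} [MeasurableSpace Ω] {P : Measure Ω} [IsProbabilityMeasure P]
  {X : ℕ → Ω → BlockSpace p}

/-- The empirical characteristic function of the `j`-th block. -/
noncomputable def empMarginal {d : ℕ} (p : Fin d → ℕ) (n : ℕ) (x : ℕ → BlockSpace p) (t : BlockSpace p)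
    (j : Fin d) : ℂ :=
  (n : ℂ)⁻¹ * ∑ k ∈ Finset.range n, expInner (t j) (x k j)

/-- The part of `∏ j, φ_j^n` that is of second order in the deviations `φ_j^n - φ_j`. -/
noncomputable def prodRemainder {d : ℕ} (p : Fin d → ℕ) (μ : Measure (BlockSpace p)) (n : ℕ)
    (x : ℕ → BlockSpace p) (t : BlockSpace p) : ℂ :=
  ∏ j, empMarginal p n x t j - ∏ j, marginalCharFun p μ j (t j) -
    ∑ j, (empMarginal p n x t j - marginalCharFun p μ j (t j)) *
      ∏ l ∈ Finset.univ.erase j, marginalCharFun p μ l (t l)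

lemma norm_inv_mul_sum_le {n : ℕ} {f : ℕ → ℂ} {C : ℝ} (hC : 0 ≤ C)
    (hf : ∀ k ∈ Finset.range n, ‖f k‖ ≤ C) :
    ‖(n : ℂ)⁻¹ * ∑ k ∈ Finset.range n, f k‖ ≤ C := by
  rcases n.eq_zero_or_pos with rfl | hn
  · simpa using hC
  have hn' : (0 : ℝ) < n := by exact_mod_cast hn
  rw [norm_mul, norm_inv, Complex.norm_natCast, inv_mul_le_iff₀ hn']
  refine (norm_sum_le _ _).trans ((Finset.sum_le_sum hf).trans ?_)
  simp

lemma norm_empMarginal_le (n : ℕ) (x : ℕ → BlockSpace p) (t : BlockSpace p) (j : Fin d) :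
    ‖empMarginal p n x t j‖ ≤ 1 :=
  norm_inv_mul_sum_le zero_le_one fun _ _ => (norm_expInner _ _).le

lemma norm_prodRemainder_le (n : ℕ) (x : ℕ → BlockSpace p) (t : BlockSpace p) :
    ‖prodRemainder p μ n x t‖ ≤ ∑ i, ∑ l ∈ Finset.univ.erase i,
      ‖empMarginal p n x t i - marginalCharFun p μ i (t i)‖ *
        ‖empMarginal p n x t l - marginalCharFun p μ l (t l)‖ := by
  classical
  exact norm_prod_sub_linear_le _ (norm_empMarginal_le n x t) fun j => norm_marginalCharFun_le j _

omit [IsProbabilityMeasure μ] in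
-- The constant and linear parts subtracted in the kernel average to the constant and linear parts
-- of the product of empirical marginals; adding them back leaves the second-order part.
lemma diffComplete_eq {n : ℕ} (hn : n ≠ 0) (x : ℕ → BlockSpace p) (t : BlockSpace p) :
    diffComplete p n x t = (n : ℂ)⁻¹ * ∑ k ∈ Finset.range n, dependenceKernel p μ t (x k) -
      prodRemainder p μ n x t := by
  have hn' : (n : ℂ) ≠ 0 := by exact_mod_cast hn
  unfold diffComplete empJoint empProd dependenceKernel prodRemainder
  simp_rw [expInner_blocks, Finset.sum_sub_distrib, mul_sub]
  rw [Finset.sum_comm (s := Finset.range n)]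
  simp only [← Finset.sum_mul, Finset.mul_sum (s := Finset.univ), Finset.sum_sub_distrib,
    Finset.sum_const, Finset.card_range, nsmul_eq_mul, ← mul_assoc, mul_sub,
    inv_mul_cancel₀ hn', one_mul]
  unfold empMarginal
  ring

omit [IsProbabilityMeasure μ] in
-- The constant parts cancel outright. The linear parts depend on one block each, and within a block
-- the cyclic shift only permutes the sample.
lemma diffSimplified_eq (n : ℕ) (x : ℕ → BlockSpace p) (t : BlockSpace p) :
    diffSimplified p n x t = (n : ℂ)⁻¹ * ∑ k ∈ Finset.range n,
      (dependenceKernel p μ t (x k) - dependenceKernel p μ t (shiftedPoint p n x k)) := by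
  unfold diffSimplified empJoint empShifted dependenceKernel
  rw [← mul_sub]
  congr 1
  simp_rw [expInner_blocks, Finset.sum_sub_distrib]
  have h : ∑ k ∈ Finset.range n, ∑ j, (expInner (t j) (shiftedPoint p n x k j) -
        marginalCharFun p μ j (t j)) * ∏ l ∈ Finset.univ.erase j, marginalCharFun p μ l (t l) =
      ∑ k ∈ Finset.range n, ∑ j, (expInner (t j) (x k j) -
        marginalCharFun p μ j (t j)) * ∏ l ∈ Finset.univ.erase j, marginalCharFun p μ l (t l) := by
    rw [Finset.sum_comm, Finset.sum_comm (s := Finset.range n)]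
    exact Finset.sum_congr rfl fun j _ => sum_range_add_mod (fun k => (expInner (t j) (x k j) -
        marginalCharFun p μ j (t j)) * ∏ l ∈ Finset.univ.erase j, marginalCharFun p μ l (t l)) j
  rw [h]
  ring

/-! ### Existence of the integrals -/

lemma norm_inv_mul_sum_sub_one_le {n : ℕ} (hn : n ≠ 0) {f : ℕ → ℂ} {C : ℝ} (hC : 0 ≤ C)
    (hf : ∀ k ∈ Finset.range n, ‖f k - 1‖ ≤ C) :
    ‖(n : ℂ)⁻¹ * ∑ k ∈ Finset.range n, f k - 1‖ ≤ C := by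
  have hn' : (n : ℂ) ≠ 0 := by exact_mod_cast hn
  have e : (n : ℂ)⁻¹ * ∑ k ∈ Finset.range n, f k - 1 =
      (n : ℂ)⁻¹ * ∑ k ∈ Finset.range n, (f k - 1) := by
    rw [Finset.sum_sub_distrib, mul_sub]
    simp [hn']
  rw [e]
  exact norm_inv_mul_sum_le hC hf

lemma norm_expInner_block_sub_one_le {n k : ℕ} (hk : k ∈ Finset.range n) (x : ℕ → BlockSpace p)
    (t : BlockSpace p) (j : Fin d) :
    ‖expInner (t j) (x k j) - 1‖ ≤ min (‖t‖ * ∑ k ∈ Finset.range n, ‖x k‖) 2 := by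
  refine (norm_expInner_sub_one_le _ _).trans (min_le_min_right _ ?_)
  refine mul_le_mul (PiLp.norm_apply_le t j) ((PiLp.norm_apply_le (x k) j).trans ?_)
    (norm_nonneg _) (norm_nonneg _)
  exact Finset.single_le_sum (f := fun k => ‖x k‖) (fun _ _ => norm_nonneg _) hk

lemma min_mul_sum_nonneg (n : ℕ) (x : ℕ → BlockSpace p) (t : BlockSpace p) :
    0 ≤ min (‖t‖ * ∑ k ∈ Finset.range n, ‖x k‖) 2 := by
  positivity

lemma norm_empJoint_sub_one_le {n : ℕ} (hn : n ≠ 0) (x : ℕ → BlockSpace p) (t : BlockSpace p) :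
    ‖empJoint p n x t - 1‖ ≤ min (‖t‖ * ∑ k ∈ Finset.range n, ‖x k‖) 2 := by
  refine norm_inv_mul_sum_sub_one_le hn (min_mul_sum_nonneg _ _ _) fun k hk => ?_
  refine (norm_expInner_sub_one_le _ _).trans (min_le_min_right _ ?_)
  refine mul_le_mul_of_nonneg_left ?_ (norm_nonneg _)
  exact Finset.single_le_sum (f := fun k => ‖x k‖) (fun _ _ => norm_nonneg _) hk

/-- Both terms are compared with their common value 1 at t = 0; the product moves by at most the sum
over its d factors. The bound is linear in |t| near 0, which offsets the singularity of the weight.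
-/
lemma norm_diffComplete_le {n : ℕ} (hn : n ≠ 0) (x : ℕ → BlockSpace p) (t : BlockSpace p) :
    ‖diffComplete p n x t‖ ≤ (1 + d) * min (‖t‖ * ∑ k ∈ Finset.range n, ‖x k‖) 2 := by
  have h2 : ‖empProd p n x t - 1‖ ≤ d * min (‖t‖ * ∑ k ∈ Finset.range n, ‖x k‖) 2 := by
    have h := norm_prod_sub_prod_le Finset.univ (norm_empMarginal_le n x t)
      (b := fun _ => 1) (by simp)
    rw [Finset.prod_const_one] at h
    refine h.trans ((Finset.sum_le_sum fun j _ => norm_inv_mul_sum_sub_one_le hn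
      (min_mul_sum_nonneg _ _ _) fun k hk => norm_expInner_block_sub_one_le hk x t j).trans ?_)
    simp
  have h3 : diffComplete p n x t = (empJoint p n x t - 1) - (empProd p n x t - 1) := by
    unfold diffComplete; ring
  rw [h3, one_add_mul]
  exact (norm_sub_le _ _).trans (add_le_add (norm_empJoint_sub_one_le hn x t) h2)

lemma norm_diffSimplified_le {n : ℕ} (hn : n ≠ 0) (x : ℕ → BlockSpace p) (t : BlockSpace p) :
    ‖diffSimplified p n x t‖ ≤ (1 + d) * min (‖t‖ * ∑ k ∈ Finset.range n, ‖x k‖) 2 := by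
  have h2 : ‖empShifted p n x t - 1‖ ≤ d * min (‖t‖ * ∑ k ∈ Finset.range n, ‖x k‖) 2 := by
    refine norm_inv_mul_sum_sub_one_le hn
      (mul_nonneg d.cast_nonneg (min_mul_sum_nonneg _ _ _)) fun k _ => ?_
    rw [expInner_blocks]
    have h := norm_prod_sub_prod_le Finset.univ
      (fun j => (norm_expInner (t j) (shiftedPoint p n x k j)).le) (b := fun _ => 1) (by simp)
    rw [Finset.prod_const_one] at h
    refine h.trans ((Finset.sum_le_sum fun j _ => norm_expInner_block_sub_one_le
      (Finset.mem_range.2 (Nat.mod_lt _ (Nat.pos_of_ne_zero hn))) x t j).trans ?_)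
    simp
  have h3 : diffSimplified p n x t = (empJoint p n x t - 1) - (empShifted p n x t - 1) := by
    unfold diffSimplified; ring
  rw [h3, one_add_mul]
  exact (norm_sub_le _ _).trans (add_le_add (norm_empJoint_sub_one_le hn x t) h2)

lemma measurable_expInner_comp {V A : Type*} [NormedAddCommGroup V] [InnerProductSpace ℝ V]
    [MeasurableSpace V] [BorelSpace V] [SecondCountableTopology V] [MeasurableSpace A]
    {f g : A → V} (hf : Measurable f) (hg : Measurable g) :
    Measurable fun a => expInner (f a) (g a) :=
  measurable_expInner.comp (hf.prodMk hg)

lemma measurable_eval_prod_seq (k : ℕ) :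
    Measurable fun z : BlockSpace p × (ℕ → BlockSpace p) => z.2 k :=
  (measurable_pi_apply k).comp measurable_snd

lemma measurable_empJoint (n : ℕ) :
    Measurable fun z : BlockSpace p × (ℕ → BlockSpace p) => empJoint p n z.2 z.1 :=
  (Finset.measurable_sum _ fun k _ =>
    measurable_expInner_comp measurable_fst (measurable_eval_prod_seq k)).const_mul _

lemma measurable_empMarginal (n : ℕ) (j : Fin d) :
    Measurable fun z : BlockSpace p × (ℕ → BlockSpace p) => empMarginal p n z.2 z.1 j :=
  (Finset.measurable_sum _ fun k _ =>
    measurable_expInner_comp ((measurable_blockSpace_eval j).comp measurable_fst)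
      ((measurable_blockSpace_eval j).comp (measurable_eval_prod_seq k))).const_mul _

lemma measurable_diffComplete (n : ℕ) :
    Measurable fun z : BlockSpace p × (ℕ → BlockSpace p) => diffComplete p n z.2 z.1 := by
  have h : Measurable fun z : BlockSpace p × (ℕ → BlockSpace p) =>
      ∏ j, empMarginal p n z.2 z.1 j :=
    Finset.measurable_prod _ fun j _ => measurable_empMarginal n j
  exact (measurable_empJoint n).sub h

lemma measurable_diffSimplified (n : ℕ) :
    Measurable fun z : BlockSpace p × (ℕ → BlockSpace p) => diffSimplified p n z.2 z.1 := by
  refine (measurable_empJoint n).sub ((Finset.measurable_sum _ fun k _ => ?_).const_mul _)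
  refine measurable_expInner_comp measurable_fst ?_
  exact (WithLp.measurable_toLp 2 _).comp (measurable_pi_lambda _ fun j =>
    (measurable_blockSpace_eval j).comp (measurable_eval_prod_seq _))

lemma integrable_weightedSq_of_le (hd : 1 ≤ d) (hp : ∀ j, 1 ≤ p j) {η : BlockSpace p → ℂ}
    (hη : Measurable η) {a K : ℝ} (ha : 0 ≤ a) (h : ∀ t, ‖η t‖ ≤ K * min (‖t‖ * a) 2) :
    Integrable (weightedSq p η) := by
  refine ((integrable_min_mul_sq_weightOne hd hp ha).1.const_mul (K ^ 2)).mono'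
    ((hη.norm.pow_const 2).mul measurable_weightOne).aestronglyMeasurable (ae_of_all _ fun t => ?_)
  have hw := weightOne_nonneg t
  unfold weightedSq
  rw [Real.norm_of_nonneg (by positivity), ← mul_assoc, ← mul_pow]
  exact mul_le_mul_of_nonneg_right (pow_le_pow_left₀ (norm_nonneg _) (h t) 2) hw

lemma integrable_weightedSq_diffComplete (hd : 1 ≤ d) (hp : ∀ j, 1 ≤ p j) {n : ℕ} (hn : n ≠ 0)
    (x : ℕ → BlockSpace p) : Integrable (weightedSq p (diffComplete p n x)) := by
  have h : Measurable fun t : BlockSpace p => (t, x) := measurable_prodMk_right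
  have hm : Measurable fun t => diffComplete p n x t := by
    simpa only [Function.comp_def] using (measurable_diffComplete n).comp h
  exact integrable_weightedSq_of_le hd hp hm
    (Finset.sum_nonneg fun _ _ => norm_nonneg _) (norm_diffComplete_le hn x)

lemma integrable_weightedSq_diffSimplified (hd : 1 ≤ d) (hp : ∀ j, 1 ≤ p j) {n : ℕ} (hn : n ≠ 0)
    (x : ℕ → BlockSpace p) : Integrable (weightedSq p (diffSimplified p n x)) := by
  have h : Measurable fun t : BlockSpace p => (t, x) := measurable_prodMk_right
  have hm : Measurable fun t => diffSimplified p n x t := by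
    simpa only [Function.comp_def] using (measurable_diffSimplified n).comp h
  exact integrable_weightedSq_of_le hd hp hm
    (Finset.sum_nonneg fun _ _ => norm_nonneg _) (norm_diffSimplified_le hn x)

/-! ### The second-order remainder -/

lemma integral_norm_inv_mul_sum_sq {E : Type*} [MeasurableSpace E] {ν : Measure E}
    {Y : ℕ → Ω → E} (hY : ∀ k, Measurable (Y k)) (hlaw : ∀ k, P.map (Y k) = ν)
    (hindep : iIndepFun Y P) {g : E → ℂ} (hg : Measurable g) {C : ℝ} (hC : ∀ x, ‖g x‖ ≤ C)
    (h0 : ∫ x, g x ∂ν = 0) {n : ℕ} (hn : n ≠ 0) :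
    ∫ ω, ‖(n : ℂ)⁻¹ * ∑ k ∈ Finset.range n, g (Y k ω)‖ ^ 2 ∂P =
      (n : ℝ)⁻¹ * ∫ x, ‖g x‖ ^ 2 ∂ν := by
  have hm : ∀ k, Measurable fun ω => g (Y k ω) := fun k => hg.comp (hY k)
  have h := integral_norm_sum_sq_of_orthogonal (P := P) (Finset.range n) (C := C)
    (Z := fun k ω => g (Y k ω)) (fun k _ => hm k) (fun k _ ω => hC _)
    (fun k _ l _ hkl => by
      have hc : Measurable fun x => conj (g x) := Complex.continuous_conj.measurable.comp hg
      have hI := (hindep.indepFun hkl).comp hg hc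
      have h1 := hI.integral_fun_mul_eq_mul_integral (hm k).aestronglyMeasurable
        (hc.comp (hY l)).aestronglyMeasurable
      simp only [Function.comp_def] at h1
      rw [h1, ← integral_map (hY k).aemeasurable hg.aestronglyMeasurable, hlaw, h0, zero_mul])
    (fun _ => (n : ℝ)⁻¹)
  have e : ∀ ω, (n : ℂ)⁻¹ * ∑ k ∈ Finset.range n, g (Y k ω) =
      ∑ k ∈ Finset.range n, (((n : ℝ)⁻¹ : ℝ) : ℂ) * g (Y k ω) := fun ω => by
    rw [← Finset.mul_sum]
    simp
  simp_rw [e]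
  rw [h]
  have h2 : ∀ k, ∫ ω, ‖g (Y k ω)‖ ^ 2 ∂P = ∫ x, ‖g x‖ ^ 2 ∂ν := fun k => by
    rw [← hlaw k, integral_map (hY k).aemeasurable (hg.norm.pow_const 2).aestronglyMeasurable]
  simp_rw [h2]
  have hn'' : (n : ℝ) ≠ 0 := by exact_mod_cast hn
  rw [Finset.sum_const, Finset.card_range, nsmul_eq_mul]
  field_simp

lemma integral_norm_empMarginal_sub_sq (hX : ∀ k, Measurable (X k))
    (hlaw : ∀ k, P.map (X k) = μ) (hindep : iIndepFun X P) {n : ℕ} (hn : n ≠ 0)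
    (t : BlockSpace p) (j : Fin d) :
    ∫ ω, ‖empMarginal p n (fun k => X k ω) t j - marginalCharFun p μ j (t j)‖ ^ 2 ∂P =
      (n : ℝ)⁻¹ * (1 - ‖marginalCharFun p μ j (t j)‖ ^ 2) := by
  have hn' : (n : ℂ) ≠ 0 := by exact_mod_cast hn
  have h0 : ∫ x, (expInner (t j) (x j) - marginalCharFun p μ j (t j)) ∂μ = 0 := by
    rw [integral_sub (integrable_of_measurable_bounded (measurable_expInner_block t j) (C := 1)
      fun x => (norm_expInner _ _).le) (integrable_const _), ← marginalCharFun_eq]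
    simp
  have h := integral_norm_inv_mul_sum_sq hX hlaw hindep
    ((measurable_expInner_block t j).sub_const _)
    (fun x => norm_expInner_sub_marginalCharFun_le (μ := μ) t x j) h0 hn
  rw [integral_norm_expInner_sub_sq] at h
  rw [← h]
  refine integral_congr_ae (ae_of_all _ fun ω => ?_)
  simp only [empMarginal, Finset.sum_sub_distrib, mul_sub, Finset.sum_const, Finset.card_range,
    nsmul_eq_mul, inv_mul_cancel_left₀ hn']

/-- The two sums read disjoint parts, range n × {i} and range n × {j}, of the independent array of
all blocks. -/
lemma indepFun_sum_blocks (hX : ∀ k, Measurable (X k)) (hlaw : ∀ k, P.map (X k) = μ)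
    (hindep : iIndepFun X P) (hμ : iIndepFun (fun (j : Fin d) (x : BlockSpace p) => x j) μ)
    (n : ℕ) {g : ∀ j : Fin d, EuclideanSpace ℝ (Fin (p j)) → ℂ} (hg : ∀ j, Measurable (g j))
    {i j : Fin d} (hij : i ≠ j) :
    IndepFun (fun ω => ∑ k ∈ Finset.range n, g i (X k ω i))
      (fun ω => ∑ k ∈ Finset.range n, g j (X k ω j)) P := by
  classical
  have hdis : Disjoint (Finset.range n ×ˢ {i}) (Finset.range n ×ˢ {j}) := by
    rw [Finset.disjoint_left]
    rintro ⟨k, l⟩ h1 h2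
    simp only [Finset.mem_product, Finset.mem_singleton] at h1 h2
    exact hij (h1.2.symm.trans h2.2)
  have hA := (iIndepFun_array hX hlaw hindep hμ).comp (fun q => g q.2) fun q => hg q.2
  have h := hA.indepFun_finset _ _ hdis fun q =>
    (hg q.2).comp ((measurable_blockSpace_eval q.2).comp (hX q.1))
  have hF : ∀ j : Fin d, Measurable fun y : (Finset.range n ×ˢ {j} : Finset (ℕ × Fin d)) → ℂ =>
      ∑ q, y q := fun j => Finset.measurable_sum _ fun q _ => measurable_pi_apply q
  have h2 := h.comp (hF i) (hF j)
  have e : ∀ j : Fin d, (fun ω => ∑ k ∈ Finset.range n, g j (X k ω j)) =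
      (fun y : (Finset.range n ×ˢ {j} : Finset (ℕ × Fin d)) → ℂ => ∑ q, y q) ∘
        fun ω q => g q.1.2 (X q.1.1 ω q.1.2) := fun j => by
    funext ω
    simp only [Function.comp_apply]
    rw [Finset.sum_coe_sort (Finset.range n ×ˢ {j}) fun q : ℕ × Fin d => g q.2 (X q.1 ω q.2),
      Finset.sum_product]
    simp
  rw [e, e]
  exact h2

lemma indepFun_empMarginal (hX : ∀ k, Measurable (X k)) (hlaw : ∀ k, P.map (X k) = μ)
    (hindep : iIndepFun X P) (hμ : iIndepFun (fun (j : Fin d) (x : BlockSpace p) => x j) μ)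
    (n : ℕ) (t : BlockSpace p) {i j : Fin d} (hij : i ≠ j) :
    IndepFun (fun ω => empMarginal p n (fun k => X k ω) t i)
      (fun ω => empMarginal p n (fun k => X k ω) t j) P :=
  (indepFun_sum_blocks hX hlaw hindep hμ n (g := fun j s => expInner (t j) s)
    (fun j => measurable_expInner_right (t j)) hij).comp
    (measurable_const_mul (n : ℂ)⁻¹) (measurable_const_mul (n : ℂ)⁻¹)

lemma measurable_sample_comp (hX : ∀ k, Measurable (X k)) {A : Type*} [MeasurableSpace A]
    {F : BlockSpace p × (ℕ → BlockSpace p) → A} (hF : Measurable F) (t : BlockSpace p) :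
    Measurable fun ω => F (t, fun k => X k ω) :=
  hF.comp (measurable_const.prodMk (measurable_pi_lambda _ hX))

/-- Every term pairs deviations of two different blocks. By independence its mean square factors
into two variances of order 1/n; one keeps the envelope and the other is bounded by 1/n.
Cauchy–Schwarz and the number of pairs each cost d². -/
lemma integral_norm_prodRemainder_sq_le (hX : ∀ k, Measurable (X k))
    (hlaw : ∀ k, P.map (X k) = μ) (hindep : iIndepFun X P)
    (hμ : iIndepFun (fun (j : Fin d) (x : BlockSpace p) => x j) μ) {n : ℕ} (hn : n ≠ 0)
    (t : BlockSpace p) :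
    ∫ ω, ‖prodRemainder p μ n (fun k => X k ω) t‖ ^ 2 ∂P ≤
      (d : ℝ) ^ 4 * charEnvelope p μ t * ((n : ℝ)⁻¹) ^ 2 := by
  classical
  have hn' : (0 : ℝ) < n := by exact_mod_cast Nat.pos_of_ne_zero hn
  set b : Fin d → Ω → ℝ := fun i ω =>
    ‖empMarginal p n (fun k => X k ω) t i - marginalCharFun p μ i (t i)‖ with hb
  have hbm : ∀ i, Measurable (b i) := fun i =>
    ((measurable_sample_comp hX (measurable_empMarginal n i) t).sub_const _).norm
  have hb0 : ∀ i ω, 0 ≤ b i ω := fun i ω => norm_nonneg _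
  have hb2 : ∀ i ω, b i ω ≤ 2 := fun i ω => (norm_sub_le _ _).trans (by
    linarith [norm_empMarginal_le n (fun k => X k ω) t i, norm_marginalCharFun_le (μ := μ) i (t i)])
  have hi : ∀ i l, Integrable (fun ω => b i ω ^ 2 * b l ω ^ 2) P := fun i l =>
    integrable_of_measurable_bounded (((hbm i).pow_const 2).mul ((hbm l).pow_const 2)) (C := 16)
      fun ω => by
        have h1 : b i ω ^ 2 ≤ 4 := by nlinarith [hb0 i ω, hb2 i ω]
        have h2 : b l ω ^ 2 ≤ 4 := by nlinarith [hb0 l ω, hb2 l ω]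
        rw [Real.norm_of_nonneg (by positivity)]
        nlinarith [sq_nonneg (b i ω), sq_nonneg (b l ω)]
  have hcard : ∀ i : Fin d, (((Finset.univ.erase i).card : ℕ) : ℝ) ≤ d := fun i => by
    exact_mod_cast (Finset.card_le_univ _).trans_eq (Fintype.card_fin d)
  have hpt : ∀ ω, ‖prodRemainder p μ n (fun k => X k ω) t‖ ^ 2 ≤
      (d : ℝ) ^ 2 * ∑ i, ∑ l ∈ Finset.univ.erase i, b i ω ^ 2 * b l ω ^ 2 := fun ω => by
    refine (pow_le_pow_left₀ (norm_nonneg _) (norm_prodRemainder_le n _ t) 2).trans ?_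
    refine sq_sum_le_card_mul_sum_sq.trans ?_
    rw [Finset.card_univ, Fintype.card_fin, sq (d : ℝ), mul_assoc]
    refine mul_le_mul_of_nonneg_left ?_ d.cast_nonneg
    rw [Finset.mul_sum]
    refine Finset.sum_le_sum fun i _ => sq_sum_le_card_mul_sum_sq.trans ?_
    simp_rw [mul_pow]
    exact mul_le_mul_of_nonneg_right (hcard i) (Finset.sum_nonneg fun _ _ => by positivity)
  have hterm : ∀ i, ∀ l ∈ Finset.univ.erase i, ∫ ω, b i ω ^ 2 * b l ω ^ 2 ∂P ≤
      charEnvelope p μ t * ((n : ℝ)⁻¹) ^ 2 := fun i l hl => by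
    have hI := (indepFun_empMarginal hX hlaw hindep hμ n t (Finset.ne_of_mem_erase hl).symm).comp
      (φ := fun z => ‖z - marginalCharFun p μ i (t i)‖ ^ 2)
      (ψ := fun z => ‖z - marginalCharFun p μ l (t l)‖ ^ 2) (by fun_prop) (by fun_prop)
    have h1 := hI.integral_fun_mul_eq_mul_integral ((hbm i).pow_const 2).aestronglyMeasurable
      ((hbm l).pow_const 2).aestronglyMeasurable
    simp only [Function.comp_def] at h1
    refine h1.le.trans ?_
    rw [integral_norm_empMarginal_sub_sq hX hlaw hindep hn,
      integral_norm_empMarginal_sub_sq hX hlaw hindep hn]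
    have g1 := one_sub_norm_marginalCharFun_sq_le (μ := μ) t i
    have g2 : 1 - ‖marginalCharFun p μ l (t l)‖ ^ 2 ≤ 1 := by
      linarith [sq_nonneg ‖marginalCharFun p μ l (t l)‖]
    have g3 : 0 ≤ 1 - ‖marginalCharFun p μ l (t l)‖ ^ 2 := by
      have := norm_marginalCharFun_le (μ := μ) l (t l)
      nlinarith [norm_nonneg (marginalCharFun p μ l (t l))]
    have g4 := mul_le_mul g1 g2 g3 (charEnvelope_nonneg μ t)
    calc _ = ((n : ℝ)⁻¹) ^ 2 * ((1 - ‖marginalCharFun p μ i (t i)‖ ^ 2) *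
          (1 - ‖marginalCharFun p μ l (t l)‖ ^ 2)) := by ring
      _ ≤ ((n : ℝ)⁻¹) ^ 2 * (charEnvelope p μ t * 1) :=
        mul_le_mul_of_nonneg_left g4 (by positivity)
      _ = _ := by ring
  have hsum : ∫ ω, ∑ i, ∑ l ∈ Finset.univ.erase i, b i ω ^ 2 * b l ω ^ 2 ∂P ≤
      d * (d * (charEnvelope p μ t * ((n : ℝ)⁻¹) ^ 2)) := by
    rw [integral_finsetSum _ fun i _ => integrable_finsetSum _ fun l _ => hi i l]
    refine (Finset.sum_le_card_nsmul _ _ (d * (charEnvelope p μ t * ((n : ℝ)⁻¹) ^ 2))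
      fun i _ => ?_).trans_eq (by simp)
    rw [integral_finsetSum _ fun l _ => hi i l]
    refine (Finset.sum_le_card_nsmul _ _ _ (hterm i)).trans ?_
    rw [nsmul_eq_mul]
    exact mul_le_mul_of_nonneg_right (hcard i)
      (mul_nonneg (charEnvelope_nonneg μ t) (by positivity))
  refine (integral_mono_of_nonneg (ae_of_all _ fun _ => by positivity)
    ((integrable_finsetSum _ fun i _ => integrable_finsetSum _ fun l _ => hi i l).const_mul _)
    (ae_of_all _ hpt)).trans ?_
  rw [integral_const_mul]
  refine (mul_le_mul_of_nonneg_left hsum (by positivity)).trans_eq (by ring)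

end Statistics

/-! ### Finite-dimensional laws of Hermitian Gaussian processes -/

section CovForm

/-- The variance of `∑ i, ⟪u i, A (t i)⟫` for a centred complex process `A` with covariance
function `C` and the symmetry `A (-t) = conj (A t)`. -/
noncomputable def covForm {V : Type*} [Neg V] (C : V → V → ℂ) {m : ℕ} (t : Fin m → V)
    (u : Fin m → ℂ) : ℝ :=
  (1 / 2) * (∑ i, ∑ j, (conj (u i) * u j * C (t i) (t j) +
    conj (u i) * conj (u j) * C (t i) (-t j))).re

lemma covForm_two_mul {V : Type*} [Neg V] (C : V → V → ℂ) {m : ℕ} (t : Fin m → V)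
    (u : Fin m → ℂ) : covForm (fun t s => 2 * C t s) t u = 2 * covForm C t u := by
  unfold covForm
  have : ∀ i j, (conj (u i) * u j * (2 * C (t i) (t j)) +
    conj (u i) * conj (u j) * (2 * C (t i) (-t j))) = (2 : ℝ) * (conj (u i) * u j * C (t i) (t j) +
    conj (u i) * conj (u j) * C (t i) (-t j)) := fun i j => by push_cast; ring
  simp_rw [this, ← Finset.mul_sum]
  rw [Complex.re_ofReal_mul]
  ring

lemma re_sq_eq_half (z : ℂ) : z.re ^ 2 = (1 / 2) * (z * conj z + z * z).re := by
  simp only [Complex.add_re, Complex.mul_re, Complex.conj_re, Complex.conj_im]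
  ring

lemma sum_inner_eq_re {m : ℕ} (u a : Fin m → ℂ) :
    ∑ i, inner ℝ (u i) (a i) = (∑ i, conj (u i) * a i).re := by
  rw [Complex.re_sum]
  exact Finset.sum_congr rfl fun i _ => by rw [Complex.inner, mul_comm]

/-- From (Re z)² = ½ Re(z z̄ + z z). The second term involves E[A(t) A(s)], which Hermitian symmetry
rewrites as the covariance at (t, −s). The statement serves both the kernel under `μ` and the limit
process. -/
lemma integral_sum_inner_sq {V Ω : Type*} [Neg V] [MeasurableSpace Ω] {P : Measure Ω}
    {A : V → Ω → ℂ} (hA : ∀ t, MemLp (A t) 2 P) (hneg : ∀ t, ∀ᵐ ω ∂P, A (-t) ω = conj (A t ω))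
    {C : V → V → ℂ} (hC : ∀ t s, ∫ ω, A t ω * conj (A s ω) ∂P = C t s) {m : ℕ} (t : Fin m → V)
    (u : Fin m → ℂ) :
    ∫ ω, (∑ i, inner ℝ (u i) (A (t i) ω)) ^ 2 ∂P = covForm C t u := by
  have hint : ∀ t s, Integrable (fun ω => A t ω * conj (A s ω)) P := fun t s => by
    have h := (hA t).integrable_mul (hA s).star
    exact h
  have hae : ∀ᵐ ω ∂P, (∑ i, inner ℝ (u i) (A (t i) ω)) ^ 2 = (1 / 2) * RCLike.re
      (∑ i, ∑ j, (conj (u i) * u j * (A (t i) ω * conj (A (t j) ω)) +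
        conj (u i) * conj (u j) * (A (t i) ω * conj (A (-t j) ω)))) := by
    filter_upwards [ae_all_iff.2 fun j => hneg (t j)] with ω hω
    rw [sum_inner_eq_re, re_sq_eq_half, RCLike.re_eq_complex_re]
    congr 2
    simp_rw [hω, Complex.conj_conj, Finset.sum_add_distrib]
    rw [map_sum, Finset.sum_mul_sum, Finset.sum_mul_sum]
    congr 1
    · refine Finset.sum_congr rfl fun i _ => Finset.sum_congr rfl fun j _ => ?_
      rw [map_mul, Complex.conj_conj]; ring
    · exact Finset.sum_congr rfl fun i _ => Finset.sum_congr rfl fun j _ => by ring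
  have h1 : ∀ i j, Integrable (fun ω => conj (u i) * u j * (A (t i) ω * conj (A (t j) ω)) +
        conj (u i) * conj (u j) * (A (t i) ω * conj (A (-t j) ω))) P := fun i j =>
    ((hint _ _).const_mul _).add ((hint _ _).const_mul _)
  have h2 : ∀ i, Integrable (fun ω => ∑ j, (conj (u i) * u j * (A (t i) ω * conj (A (t j) ω)) +
        conj (u i) * conj (u j) * (A (t i) ω * conj (A (-t j) ω)))) P := fun i =>
    integrable_finsetSum _ fun j _ => h1 i j
  rw [integral_congr_ae hae, integral_const_mul, integral_re (integrable_finsetSum _ fun i _ => h2 i),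
    integral_finsetSum _ fun i _ => h2 i]
  unfold covForm
  rw [RCLike.re_eq_complex_re]
  congr 2
  refine Finset.sum_congr rfl fun i _ => ?_
  rw [integral_finsetSum _ fun j _ => h1 i j]
  refine Finset.sum_congr rfl fun j _ => ?_
  rw [integral_add ((hint _ _).const_mul _) ((hint _ _).const_mul _), integral_const_mul,
    integral_const_mul, hC, hC]

variable {V Ω' : Type*} [MeasurableSpace V] [Neg V] [MeasurableSpace Ω'] {P' : Measure Ω'}
  {ζ : V → Ω' → ℂ} {C : V → V → ℂ}

lemma IsHermitianGaussianProcess.memLp (hζ : IsHermitianGaussianProcess ζ P' C) (t : V) :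
    MemLp (ζ t) 2 P' := (hζ.gaussian.hasGaussianLaw_eval t).memLp_two

lemma IsHermitianGaussianProcess.integral_norm_sq (hζ : IsHermitianGaussianProcess ζ P' C)
    (t : V) : ∫ ω, ‖ζ t ω‖ ^ 2 ∂P' = (C t t).re := by
  rw [← hζ.covariance t t]
  have h : ∀ ω, ‖ζ t ω‖ ^ 2 = RCLike.re (ζ t ω * conj (ζ t ω)) := fun ω => by
    rw [RCLike.mul_conj]; norm_cast
  simp_rw [h]
  have hi : Integrable (fun ω => ζ t ω * conj (ζ t ω)) P' :=
    (hζ.memLp t).integrable_mul (hζ.memLp t).star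
  rw [integral_re hi, RCLike.re_eq_complex_re]

/-- The characteristic function of the finite-dimensional distributions of `ζ`. -/
lemma IsHermitianGaussianProcess.integral_cexp [IsProbabilityMeasure P']
    (hζ : IsHermitianGaussianProcess ζ P' C) {m : ℕ} (t : Fin m → V) (u : Fin m → ℂ) :
    ∫ ω, Complex.exp ((∑ i, inner ℝ (u i) (ζ (t i) ω) : ℝ) * Complex.I) ∂P' =
      Complex.exp (-(covForm C t u : ℂ) / 2) := by
  classical
  -- The points `t i` may repeat, so the joint law is taken on their image and the functional reads
  -- a coordinate as often as needed.
  set I : Finset V := Finset.univ.image t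
  let L : (I → ℂ) →L[ℝ] ℝ := ∑ i, (innerSL ℝ (u i)).comp
    (ContinuousLinearMap.proj (R := ℝ) (φ := fun _ : I => ℂ)
      ⟨t i, Finset.mem_image_of_mem t (Finset.mem_univ i)⟩)
  have h := (hζ.gaussian.hasGaussianLaw I).map_fun L
  have hL : ∀ ω, L (I.restrict (ζ · ω)) = ∑ i, inner ℝ (u i) (ζ (t i) ω) := fun ω => by
    simp [L]
  simp_rw [hL] at h
  have hi : ∀ i, Integrable (fun ω => inner ℝ (u i) (ζ (t i) ω)) P' := fun i =>
    ((hζ.memLp (t i)).integrable (by norm_num)).const_inner (u i)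
  have hmean : ∫ ω, ∑ i, inner ℝ (u i) (ζ (t i) ω) ∂P' = 0 := by
    rw [integral_finsetSum _ fun i _ => hi i]
    refine Finset.sum_eq_zero fun i _ => ?_
    rw [integral_inner ((hζ.memLp (t i)).integrable (by norm_num)), hζ.mean_zero, inner_zero_right]
  have hvar : Var[fun ω => ∑ i, inner ℝ (u i) (ζ (t i) ω); P'] = covForm C t u := by
    rw [variance_of_integral_eq_zero h.aemeasurable hmean]
    exact integral_sum_inner_sq hζ.memLp hζ.hermitian hζ.covariance t u
  have h2 := h.charFun_map_eq 1
  have hone : ∀ r : ℝ, inner ℝ (1 : ℝ) r = r := fun r => by simp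
  simp only [hone, hmean, hvar] at h2
  rw [charFun_apply, integral_map h.aemeasurable (by fun_prop)] at h2
  have hone' : ∀ r : ℝ, inner ℝ r (1 : ℝ) = r := fun r => by simp
  simp only [hone'] at h2
  rw [h2]
  congr 1
  simp
  ring

end CovForm

/-! ### From finite-dimensional characteristic functions to weighted norms -/

section Limit

variable {d : ℕ} {p : Fin d → ℕ} {μ : Measure (BlockSpace p)} [IsProbabilityMeasure μ]
  {Ω : Type*} [MeasurableSpace Ω] {P : Measure Ω} [IsProbabilityMeasure P]

/-- Lévy's continuity theorem on ℂ^m gives weak convergence of the marginals, and the truncated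
product is a bounded continuous function of them. -/
lemma tendsto_integral_prod_min {V Ω' : Type*} [MeasurableSpace Ω'] {P' : Measure Ω'}
    [IsProbabilityMeasure P'] {Y : ℕ → V → Ω → ℂ} (hY : ∀ n t, Measurable (Y n t))
    {ζ : V → Ω' → ℂ} (hζ : ∀ t, Measurable (ζ t)) {m : ℕ} (t : Fin m → V)
    (h : ∀ u : Fin m → ℂ, Tendsto (fun n => ∫ ω, Complex.exp
      ((∑ i, inner ℝ (u i) (Y n (t i) ω) : ℝ) * Complex.I) ∂P) atTop
      (𝓝 (∫ ω, Complex.exp ((∑ i, inner ℝ (u i) (ζ (t i) ω) : ℝ) * Complex.I) ∂P')))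
    {w c : Fin m → ℝ} (hw : ∀ i, 0 ≤ w i) (hc : ∀ i, 0 ≤ c i) :
    Tendsto (fun n => ∫ ω, ∏ i, min (‖Y n (t i) ω‖ ^ 2 * w i) (c i) ∂P) atTop
      (𝓝 (∫ ω, ∏ i, min (‖ζ (t i) ω‖ ^ 2 * w i) (c i) ∂P')) := by
  have hYm : ∀ n, Measurable fun ω => (WithLp.toLp 2 (fun i => Y n (t i) ω) : PiLp 2 fun _ : Fin m => ℂ) := fun n =>
    (WithLp.measurable_toLp 2 _).comp (measurable_pi_lambda _ fun i => hY n (t i))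
  have hζm : Measurable fun ω => (WithLp.toLp 2 (fun i => ζ (t i) ω) : PiLp 2 fun _ : Fin m => ℂ) :=
    (WithLp.measurable_toLp 2 _).comp (measurable_pi_lambda _ fun i => hζ (t i))
  let ν : ℕ → ProbabilityMeasure (PiLp 2 fun _ : Fin m => ℂ) := fun n =>
    ⟨P.map fun ω => WithLp.toLp 2 (fun i => Y n (t i) ω),
      Measure.isProbabilityMeasure_map (hYm n).aemeasurable⟩
  let ν₀ : ProbabilityMeasure (PiLp 2 fun _ : Fin m => ℂ) :=
    ⟨P'.map fun ω => WithLp.toLp 2 (fun i => ζ (t i) ω),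
      Measure.isProbabilityMeasure_map hζm.aemeasurable⟩
  have hν : Tendsto ν atTop (𝓝 ν₀) := by
    refine ProbabilityMeasure.tendsto_of_tendsto_charFun fun u => ?_
    have e1 : ∀ n, charFun (ν n : Measure (PiLp 2 fun _ : Fin m => ℂ)) u = ∫ ω, Complex.exp
        ((∑ i, inner ℝ (u i) (Y n (t i) ω) : ℝ) * Complex.I) ∂P := fun n => by
      change charFun (P.map _) u = _
      rw [charFun_apply, integral_map (hYm n).aemeasurable (by fun_prop)]
      simp_rw [real_inner_comm u, PiLp.inner_apply]
    have e2 : charFun (ν₀ : Measure (PiLp 2 fun _ : Fin m => ℂ)) u = ∫ ω, Complex.exp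
        ((∑ i, inner ℝ (u i) (ζ (t i) ω) : ℝ) * Complex.I) ∂P' := by
      change charFun (P'.map _) u = _
      rw [charFun_apply, integral_map hζm.aemeasurable (by fun_prop)]
      simp_rw [real_inner_comm u, PiLp.inner_apply]
    simp_rw [e1, e2]
    exact h u
  have hF : Continuous fun z : (PiLp 2 fun _ : Fin m => ℂ) => ∏ i, min (‖z i‖ ^ 2 * w i) (c i) :=
    continuous_finsetProd _ fun i _ => by fun_prop
  let F := BoundedContinuousFunction.ofNormedAddCommGroup
    (fun z : (PiLp 2 fun _ : Fin m => ℂ) => ∏ i, min (‖z i‖ ^ 2 * w i) (c i)) hF (∏ i, c i) fun z => by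
      have h0 : ∀ i, 0 ≤ min (‖z i‖ ^ 2 * w i) (c i) := fun i =>
        le_min (mul_nonneg (sq_nonneg _) (hw i)) (hc i)
      rw [Real.norm_of_nonneg (Finset.prod_nonneg fun i _ => h0 i)]
      exact Finset.prod_le_prod (fun i _ => h0 i) fun i _ => min_le_right _ _
  have h3 := (ProbabilityMeasure.tendsto_iff_forall_integral_tendsto.1 hν) F
  have e3 : ∀ n, ∫ z, F z ∂(ν n : Measure (PiLp 2 fun _ : Fin m => ℂ)) =
      ∫ ω, ∏ i, min (‖Y n (t i) ω‖ ^ 2 * w i) (c i) ∂P := fun n => by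
    change ∫ z, F z ∂(P.map _) = _
    rw [integral_map (hYm n).aemeasurable F.continuous.aestronglyMeasurable]
    rfl
  have e4 : ∫ z, F z ∂(ν₀ : Measure (PiLp 2 fun _ : Fin m => ℂ)) =
      ∫ ω, ∏ i, min (‖ζ (t i) ω‖ ^ 2 * w i) (c i) ∂P' := by
    change ∫ z, F z ∂(P'.map _) = _
    rw [integral_map hζm.aemeasurable F.continuous.aestronglyMeasurable]
    rfl
  simp_rw [e3, e4] at h3
  exact h3

/-- Convergence in distribution of weighted norms to that of a Hermitian Gaussian process. -/
theorem tendstoInDistribution_weightedNormSq (hd : 1 ≤ d) (hp : ∀ j, 1 ≤ p j)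
    (hμ : Integrable (fun x : BlockSpace p => ‖x‖) μ) {Y : ℕ → BlockSpace p → Ω → ℂ}
    (hY : ∀ n, Measurable fun z : BlockSpace p × Ω => Y n z.1 z.2) {K : ℝ} (hK : 0 ≤ K) {n₀ : ℕ}
    (hi : ∀ n t, Integrable (fun ω => ‖Y n t ω‖ ^ 2) P)
    (hG : ∀ n ≥ n₀, ∀ t, ∫ ω, ‖Y n t ω‖ ^ 2 ∂P ≤ K * charEnvelope p μ t)
    {C : BlockSpace p → BlockSpace p → ℂ}
    (hmean : ∀ t, Tendsto (fun n => ∫ ω, ‖Y n t ω‖ ^ 2 ∂P) atTop (𝓝 (C t t).re))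
    (hchar : ∀ (m : ℕ) (t : Fin m → BlockSpace p) (u : Fin m → ℂ),
      Tendsto (fun n => ∫ ω, Complex.exp
        ((∑ i, inner ℝ (u i) (Y n (t i) ω) : ℝ) * Complex.I) ∂P) atTop
        (𝓝 (Complex.exp (-(covForm C t u : ℂ) / 2))))
    {Ω' : Type*} [MeasurableSpace Ω'] {P' : Measure Ω'} [IsProbabilityMeasure P']
    {ζ : BlockSpace p → Ω' → ℂ} (hζ : IsHermitianGaussianProcess ζ P' C) :
    (∀ᵐ ω' ∂P', Integrable (weightedSq p (fun t => ζ t ω'))) ∧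
    TendstoInDistribution (fun n ω => weightedNormSq p fun t => Y n t ω) atTop
      (fun ω' => weightedNormSq p (fun t => ζ t ω')) (fun _ => P) P' := by
  have hw : ∀ t : BlockSpace p, 0 ≤ weightOne p t := weightOne_nonneg
  have hYt : ∀ n t, Measurable (Y n t) := fun n t => (hY n).comp measurable_prodMk_left
  have hζt : ∀ t, Measurable (ζ t) := fun t => hζ.measurable.comp measurable_prodMk_left
  have h := tendstoInDistribution_integral (P := P) (P' := P') (ν := (volume : Measure (BlockSpace p)))
    (h := fun n t ω => ‖Y n t ω‖ ^ 2 * weightOne p t) (k := fun t ω => ‖ζ t ω‖ ^ 2 * weightOne p t)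
    (G := fun t => K * (charEnvelope p μ t * weightOne p t))
    (fun n => ((hY n).norm.pow_const 2).mul (measurable_weightOne.comp measurable_fst))
    ((hζ.measurable.norm.pow_const 2).mul (measurable_weightOne.comp measurable_fst))
    (fun n t ω => mul_nonneg (sq_nonneg _) (hw t)) (fun t ω => mul_nonneg (sq_nonneg _) (hw t))
    (((measurable_charEnvelope μ).mul measurable_weightOne).const_mul K)
    (fun t => mul_nonneg hK (mul_nonneg (charEnvelope_nonneg μ t) (hw t)))
    ((integrable_charEnvelope_weightOne hd hp μ hμ).const_mul K) (n₀ := n₀)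
    (fun n _ t => (hi n t).mul_const _)
    (fun n hn t => by
      rw [integral_mul_const, ← mul_assoc]
      exact mul_le_mul_of_nonneg_right (hG n hn t) (hw t))
    (fun t => (hζ.memLp t).norm.integrable_sq.mul_const _)
    (fun t => by
      simp_rw [integral_mul_const]
      rw [hζ.integral_norm_sq]
      exact (hmean t).mul_const _)
    (fun m t c hc => tendsto_integral_prod_min hYt hζt t
      (fun u => by rw [hζ.integral_cexp]; exact hchar m t u) (fun i => hw (t i)) hc)
  exact h

end Limit

/-! ### Real linear combinations of kernel values -/

section KernelForm

variable {d : ℕ} {p : Fin d → ℕ} {μ : Measure (BlockSpace p)} [IsProbabilityMeasure μ]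

/-- The real linear combination `∑ i, ⟪u i, H(t i, x)⟫` of values of the dependence kernel. -/
noncomputable def kernelForm {d : ℕ} (p : Fin d → ℕ) (μ : Measure (BlockSpace p)) {m : ℕ}
    (t : Fin m → BlockSpace p) (u : Fin m → ℂ) (x : BlockSpace p) : ℝ :=
  ∑ i, inner ℝ (u i) (dependenceKernel p μ (t i) x)

lemma measurable_kernelForm {m : ℕ} (t : Fin m → BlockSpace p) (u : Fin m → ℂ) :
    Measurable (kernelForm p μ t u) :=
  Finset.measurable_sum _ fun i _ =>
    measurable_const.inner (measurable_dependenceKernel_right (t i))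

lemma abs_kernelForm_le {m : ℕ} (t : Fin m → BlockSpace p) (u : Fin m → ℂ) (x : BlockSpace p) :
    |kernelForm p μ t u x| ≤ ∑ i, ‖u i‖ * (4 * d) :=
  (Finset.abs_sum_le_sum_abs _ _).trans (Finset.sum_le_sum fun _ _ =>
    (abs_real_inner_le_norm _ _).trans
      (mul_le_mul_of_nonneg_left (norm_dependenceKernel_le _ _) (norm_nonneg _)))

lemma memLp_dependenceKernel (t : BlockSpace p) :
    MemLp (fun x => dependenceKernel p μ t x) 2 μ :=
  MemLp.of_bound (measurable_dependenceKernel_right t).aestronglyMeasurable (4 * d)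
    (ae_of_all _ fun x => norm_dependenceKernel_le t x)

lemma isDegenerate_kernelForm (hμ : iIndepFun (fun (j : Fin d) (x : BlockSpace p) => x j) μ)
    {m : ℕ} (t : Fin m → BlockSpace p) (u : Fin m → ℂ) :
    IsDegenerate μ (fun x => (kernelForm p μ t u x : ℂ)) := fun j y => by
  have hm : ∀ i, Measurable fun x => dependenceKernel p μ (t i) (replaceBlock j x y) := fun i => by
    have h : Measurable fun x => replaceBlock j x y :=
      (measurable_replaceBlock j).comp measurable_prodMk_right
    simpa only [Function.comp_def] using (measurable_dependenceKernel_right (t i)).comp h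
  have hi : ∀ i, Integrable (fun x => dependenceKernel p μ (t i) (replaceBlock j x y)) μ := fun i =>
    integrable_of_measurable_bounded (hm i) fun x => norm_dependenceKernel_le _ _
  change ∫ x, ((kernelForm p μ t u (replaceBlock j x y) : ℝ) : ℂ) ∂μ = 0
  rw [integral_complex_ofReal]
  unfold kernelForm
  rw [integral_finsetSum _ fun i _ => (hi i).const_inner (u i)]
  norm_cast
  refine Finset.sum_eq_zero fun i _ => ?_
  rw [integral_inner (hi i), isDegenerate_dependenceKernel hμ (t i) j y, inner_zero_right]

lemma integral_kernelForm (hμ : iIndepFun (fun (j : Fin d) (x : BlockSpace p) => x j) μ)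
    {m : ℕ} (t : Fin m → BlockSpace p) (u : Fin m → ℂ) : ∫ x, kernelForm p μ t u x ∂μ = 0 := by
  have hi : ∀ i, Integrable (fun x => dependenceKernel p μ (t i) x) μ := fun i =>
    (memLp_dependenceKernel (t i)).integrable (by norm_num)
  unfold kernelForm
  rw [integral_finsetSum _ fun i _ => (hi i).const_inner (u i)]
  refine Finset.sum_eq_zero fun i _ => ?_
  rw [integral_inner (hi i), integral_dependenceKernel hμ (t i), inner_zero_right]

/-- Matches the variance in the central limit theorem with the exponent in the characteristic
function of the limit process. -/
lemma integral_kernelForm_sq (hμ : iIndepFun (fun (j : Fin d) (x : BlockSpace p) => x j) μ)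
    {m : ℕ} (t : Fin m → BlockSpace p) (u : Fin m → ℂ) :
    ∫ x, kernelForm p μ t u x ^ 2 ∂μ = covForm (limitCov p μ) t u :=
  integral_sum_inner_sq memLp_dependenceKernel
    (fun t => ae_of_all _ fun x => dependenceKernel_neg t x)
    (integral_dependenceKernel_mul_conj hμ) t u

lemma integral_norm_dependenceKernel_sq
    (hμ : iIndepFun (fun (j : Fin d) (x : BlockSpace p) => x j) μ) (t : BlockSpace p) :
    ∫ x, ‖dependenceKernel p μ t x‖ ^ 2 ∂μ = (limitCov p μ t t).re := by
  rw [← integral_dependenceKernel_mul_conj hμ t t]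
  have h : ∀ x, ‖dependenceKernel p μ t x‖ ^ 2 =
      RCLike.re (dependenceKernel p μ t x * conj (dependenceKernel p μ t x)) := fun x => by
    rw [RCLike.mul_conj]; norm_cast
  simp_rw [h]
  have hi : Integrable (fun x => dependenceKernel p μ t x * conj (dependenceKernel p μ t x)) μ :=
    (memLp_dependenceKernel t).integrable_mul (memLp_dependenceKernel t).star
  rw [integral_re hi, RCLike.re_eq_complex_re]

end KernelForm

/-! ### Limit theorems under independence -/

section NullLimits

variable {d : ℕ} {p : Fin d → ℕ} {μ : Measure (BlockSpace p)} [IsProbabilityMeasure μ]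
  {Ω : Type*} [MeasurableSpace Ω] {P : Measure Ω} [IsProbabilityMeasure P]
  {X : ℕ → Ω → BlockSpace p}

lemma sqrt_mul_inv_eq (n : ℕ) : √(n : ℝ) * (n : ℝ)⁻¹ = (√(n : ℝ))⁻¹ := by
  rw [← div_eq_mul_inv, Real.sqrt_div_self]

lemma weightedNormSq_real_mul (c : ℝ) (η : BlockSpace p → ℂ) :
    weightedNormSq p (fun t => (c : ℂ) * η t) = c ^ 2 * weightedNormSq p η := by
  unfold weightedNormSq weightedSq
  rw [← integral_const_mul]
  refine integral_congr_ae (ae_of_all _ fun t => ?_)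
  simp only [norm_mul, Complex.norm_real, Real.norm_eq_abs, mul_pow, sq_abs, mul_assoc]

lemma measurable_sample_process {F : BlockSpace p × (ℕ → BlockSpace p) → ℂ} (hF : Measurable F)
    (hX : ∀ k, Measurable (X k)) (c : ℂ) :
    Measurable fun z : BlockSpace p × Ω => c * F (z.1, fun k => X k z.2) := by
  have h : Measurable fun z : BlockSpace p × Ω => (z.1, fun k => X k z.2) :=
    measurable_fst.prodMk (measurable_pi_lambda _ fun k => (hX k).comp measurable_snd)
  exact (hF.comp h).const_mul c

lemma norm_empJoint_le (n : ℕ) (x : ℕ → BlockSpace p) (t : BlockSpace p) :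
    ‖empJoint p n x t‖ ≤ 1 :=
  norm_inv_mul_sum_le zero_le_one fun _ _ => (norm_expInner _ _).le

lemma norm_diffComplete_le_two (n : ℕ) (x : ℕ → BlockSpace p) (t : BlockSpace p) :
    ‖diffComplete p n x t‖ ≤ 2 := by
  refine (norm_sub_le _ _).trans ?_
  have h1 := norm_empJoint_le n x t
  have h2 : ‖empProd p n x t‖ ≤ 1 := norm_prod_le_one _ (norm_empMarginal_le n x t)
  linarith

lemma norm_diffSimplified_le_two (n : ℕ) (x : ℕ → BlockSpace p) (t : BlockSpace p) :
    ‖diffSimplified p n x t‖ ≤ 2 := by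
  refine (norm_sub_le _ _).trans ?_
  have h1 := norm_empJoint_le n x t
  have h2 : ‖empShifted p n x t‖ ≤ 1 :=
    norm_inv_mul_sum_le zero_le_one fun _ _ => (norm_expInner _ _).le
  linarith

lemma integrable_norm_sq_sample_process {F : BlockSpace p × (ℕ → BlockSpace p) → ℂ}
    (hF : Measurable F) (hX : ∀ k, Measurable (X k)) {B : ℝ} (hB : ∀ z, ‖F z‖ ≤ B) (c : ℂ)
    (t : BlockSpace p) : Integrable (fun ω => ‖c * F (t, fun k => X k ω)‖ ^ 2) P := by
  refine integrable_of_measurable_bounded (C := (‖c‖ * B) ^ 2)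
    (((measurable_sample_comp hX hF t).const_mul c).norm.pow_const 2) fun ω => ?_
  rw [Real.norm_of_nonneg (sq_nonneg _), norm_mul]
  exact pow_le_pow_left₀ (by positivity) (mul_le_mul_of_nonneg_left (hB _) (norm_nonneg _)) 2

/-- The limit of the simplified statistic under independence. -/
theorem tendstoInDistribution_simplifiedMeasure (hd : 1 ≤ d) (hp : ∀ j, 1 ≤ p j)
    (hμ1 : Integrable (fun x : BlockSpace p => ‖x‖) μ) (hX : ∀ k, Measurable (X k))
    (hlaw : ∀ k, P.map (X k) = μ) (hindep : iIndepFun X P)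
    (hμ : iIndepFun (fun (j : Fin d) (x : BlockSpace p) => x j) μ)
    {Ω' : Type*} [MeasurableSpace Ω'] {P' : Measure Ω'} [IsProbabilityMeasure P']
    {ζ : BlockSpace p → Ω' → ℂ}
    (hζ : IsHermitianGaussianProcess ζ P' (fun t t₀ => 2 * limitCov p μ t t₀)) :
    (∀ᵐ ω' ∂P', Integrable (weightedSq p (fun t => ζ t ω'))) ∧
    TendstoInDistribution
      (fun (n : ℕ) (ω : Ω) => (n : ℝ) * simplifiedMeasure p n (fun k => X k ω)) atTop
      (fun ω' => weightedNormSq p (fun t => ζ t ω')) (fun _ => P) P' := by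
  have hD : ∀ (n : ℕ) (t : BlockSpace p) (ω : Ω),
      ((√(n : ℝ) : ℝ) : ℂ) * diffSimplified p n (fun k => X k ω) t =
      ∑ k ∈ Finset.range n, (((√(n : ℝ))⁻¹ : ℝ) : ℂ) * (dependenceKernel p μ t (X k ω) -
        dependenceKernel p μ t (shiftedPoint p n (fun k => X k ω) k)) := fun n t ω => by
    rw [diffSimplified_eq (μ := μ), ← mul_assoc, ← Finset.mul_sum, ← sqrt_mul_inv_eq n]
    push_cast
    rfl
  -- The second moment equals its limit exactly as soon as n ≥ d, the range where the orthogonality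
  -- of sample and shifted points holds.
  have hsq : ∀ n : ℕ, n ≥ d → ∀ t : BlockSpace p,
      ∫ ω, ‖((√(n : ℝ) : ℝ) : ℂ) * diffSimplified p n (fun k => X k ω) t‖ ^ 2 ∂P =
        2 * (limitCov p μ t t).re := fun n hn t => by
    have hn0 : (n : ℝ) ≠ 0 := by
      have : 0 < n := by omega
      exact_mod_cast this.ne'
    have h := integral_norm_sum_sub_shifted_sq hd hX hlaw hindep hμ
      (measurable_dependenceKernel_right (μ := μ) t) (norm_dependenceKernel_le t)
      (isDegenerate_dependenceKernel hμ t) hn (fun _ => (√(n : ℝ))⁻¹)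
    simp_rw [hD]
    rw [h, integral_norm_dependenceKernel_sq hμ]
    simp only [inv_pow, Real.sq_sqrt n.cast_nonneg, Finset.sum_const, Finset.card_range,
      nsmul_eq_mul, mul_inv_cancel₀ hn0, one_mul]
  have h := tendstoInDistribution_weightedNormSq (P := P) (μ := μ) hd hp hμ1
    (Y := fun n t ω => ((√(n : ℝ) : ℝ) : ℂ) * diffSimplified p n (fun k => X k ω) t)
    (fun n => measurable_sample_process (measurable_diffSimplified n) hX _)
    (K := 2 * (4 * d ^ 2)) (by positivity) (n₀ := d)
    (fun n t => integrable_norm_sq_sample_process (measurable_diffSimplified n) hX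
      (fun z => norm_diffSimplified_le_two n z.2 z.1) _ t)
    (fun n hn t => by
      rw [hsq n hn t, mul_assoc, ← integral_norm_dependenceKernel_sq hμ]
      exact mul_le_mul_of_nonneg_left (integral_norm_dependenceKernel_sq_le t) zero_le_two)
    (C := fun t t₀ => 2 * limitCov p μ t t₀)
    (fun t => by
      refine tendsto_const_nhds.congr' ?_
      filter_upwards [eventually_ge_atTop d] with n hn
      rw [hsq n hn t]
      simp)
    (fun m t u => by
      have hc := tendsto_integral_cexp_sub_shifted hd hX hlaw hindep hμ
        (measurable_kernelForm (μ := μ) t u) (abs_kernelForm_le t u)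
        (isDegenerate_kernelForm hμ t u)
      rw [integral_kernelForm_sq hμ, ← covForm_two_mul] at hc
      refine hc.congr fun n => integral_congr_ae (ae_of_all _ fun ω => ?_)
      simp only
      congr 3
      simp_rw [hD, ← Finset.mul_sum, ← Complex.real_smul, inner_smul_right, inner_sum,
        inner_sub_right]
      rw [← Finset.mul_sum, Finset.sum_comm]
      simp only [kernelForm, Finset.sum_sub_distrib]) hζ
  refine ⟨h.1, ?_⟩
  have e : ∀ (n : ℕ) ω, (n : ℝ) * simplifiedMeasure p n (fun k => X k ω) =
      weightedNormSq p fun t => ((√(n : ℝ) : ℝ) : ℂ) * diffSimplified p n (fun k => X k ω) t :=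
    fun n ω => by
      rw [weightedNormSq_real_mul, Real.sq_sqrt n.cast_nonneg]; rfl
  simp_rw [e]
  exact h.2

omit [IsProbabilityMeasure P] in
-- A perturbation with mean square O(1/n) does not change the limit of second moments. The cross
-- term is split by 2|a||y − a| ≤ ε|a|² + ε⁻¹|y − a|².
lemma tendsto_integral_norm_sq_of_sub {Y A : ℕ → Ω → ℂ} (hY : ∀ n, MemLp (Y n) 2 P)
    (hA : ∀ n, MemLp (A n) 2 P) {r b : ℝ}
    (hr : ∀ᶠ n in atTop, ∫ ω, ‖A n ω‖ ^ 2 ∂P = r)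
    (hb : ∀ᶠ n : ℕ in atTop, ∫ ω, ‖Y n ω - A n ω‖ ^ 2 ∂P ≤ b * (n : ℝ)⁻¹) :
    Tendsto (fun n => ∫ ω, ‖Y n ω‖ ^ 2 ∂P) atTop (𝓝 r) := by
  have hpt : ∀ (ε : ℝ), 0 < ε → ∀ y a : ℂ,
      |‖y‖ ^ 2 - ‖a‖ ^ 2| ≤ ε * ‖a‖ ^ 2 + (1 + ε⁻¹) * ‖y - a‖ ^ 2 := fun ε hε y a => by
    have h1 : |‖y‖ - ‖a‖| ≤ ‖y - a‖ := abs_norm_sub_norm_le y a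
    have h2 : ‖y‖ + ‖a‖ ≤ ‖y - a‖ + 2 * ‖a‖ := by
      have := norm_sub_norm_le y a
      linarith
    have h3 : |‖y‖ ^ 2 - ‖a‖ ^ 2| ≤ ‖y - a‖ * (‖y - a‖ + 2 * ‖a‖) := by
      rw [sq_sub_sq, abs_mul, abs_of_nonneg (by positivity : 0 ≤ ‖y‖ + ‖a‖), mul_comm]
      exact mul_le_mul h1 h2 (by positivity) (norm_nonneg _)
    refine h3.trans ?_
    have h4 : 0 ≤ ε⁻¹ * (ε * ‖a‖ - ‖y - a‖) ^ 2 := by positivity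
    have h5 : ε⁻¹ * (ε * ‖a‖ - ‖y - a‖) ^ 2 =
        ε * ‖a‖ ^ 2 - 2 * ‖a‖ * ‖y - a‖ + ε⁻¹ * ‖y - a‖ ^ 2 := by
      field_simp
      ring
    nlinarith
  rw [tendsto_iff_norm_sub_tendsto_zero]
  -- The choice ε = n^{−1/2} balances ε against ε⁻¹/n, so both contributions vanish.
  have hlim : Tendsto (fun n : ℕ => √((n : ℝ)⁻¹) * r + (1 + (√((n : ℝ)⁻¹))⁻¹) * (b * (n : ℝ)⁻¹))
      atTop (𝓝 0) := by
    have h0 : Tendsto (fun n : ℕ => (n : ℝ)⁻¹) atTop (𝓝 0) := tendsto_inv_atTop_nhds_zero_nat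
    have h1 : Tendsto (fun n : ℕ => √((n : ℝ)⁻¹)) atTop (𝓝 0) := by simpa using h0.sqrt
    have h2 : Tendsto (fun n : ℕ => √((n : ℝ)⁻¹) * r + (b * (n : ℝ)⁻¹ + b * √((n : ℝ)⁻¹)))
        atTop (𝓝 (0 * r + (b * 0 + b * 0))) :=
      (h1.mul_const r).add ((h0.const_mul b).add (h1.const_mul b))
    simp only [zero_mul, mul_zero, add_zero] at h2
    refine h2.congr' ?_
    filter_upwards [eventually_ge_atTop 1] with n hn
    have hn0 : (0 : ℝ) < n := by exact_mod_cast hn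
    have hs : (0 : ℝ) < √((n : ℝ)⁻¹) := Real.sqrt_pos.2 (by positivity)
    have hss : (n : ℝ)⁻¹ = √((n : ℝ)⁻¹) ^ 2 := (Real.sq_sqrt (by positivity)).symm
    generalize √((n : ℝ)⁻¹) = s at hs hss ⊢
    rw [hss]
    field_simp
  refine squeeze_zero' (Eventually.of_forall fun _ => norm_nonneg _) ?_ hlim
  filter_upwards [hr, hb, eventually_ge_atTop 1] with n h1 h2 hn
  have hn0 : (0 : ℝ) < n := by exact_mod_cast hn
  have hs : (0 : ℝ) < √((n : ℝ)⁻¹) := Real.sqrt_pos.2 (by positivity)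
  have iY := (hY n).norm.integrable_sq
  have iA := (hA n).norm.integrable_sq
  have iB := ((hY n).sub (hA n)).norm.integrable_sq
  rw [← h1, ← integral_sub iY iA]
  refine (norm_integral_le_integral_norm _).trans ?_
  refine (integral_mono (iY.sub iA).norm ((iA.const_mul (√((n : ℝ)⁻¹))).add
    (iB.const_mul (1 + (√((n : ℝ)⁻¹))⁻¹))) fun ω => hpt _ hs (Y n ω) (A n ω)).trans ?_
  refine (integral_add (iA.const_mul _) (iB.const_mul _)).le.trans ?_
  rw [integral_const_mul, integral_const_mul]
  exact add_le_add le_rfl (mul_le_mul_of_nonneg_left h2 (by positivity))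

/-- The limit of the complete statistic under independence. -/
theorem tendstoInDistribution_completeMeasure (hd : 1 ≤ d) (hp : ∀ j, 1 ≤ p j)
    (hμ1 : Integrable (fun x : BlockSpace p => ‖x‖) μ) (hX : ∀ k, Measurable (X k))
    (hlaw : ∀ k, P.map (X k) = μ) (hindep : iIndepFun X P)
    (hμ : iIndepFun (fun (j : Fin d) (x : BlockSpace p) => x j) μ)
    {Ω' : Type*} [MeasurableSpace Ω'] {P' : Measure Ω'} [IsProbabilityMeasure P']
    {ζ : BlockSpace p → Ω' → ℂ} (hζ : IsHermitianGaussianProcess ζ P' (limitCov p μ)) :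
    (∀ᵐ ω' ∂P', Integrable (weightedSq p (fun t => ζ t ω'))) ∧
    TendstoInDistribution
      (fun (n : ℕ) (ω : Ω) => (n : ℝ) * completeMeasure p n (fun k => X k ω)) atTop
      (fun ω' => weightedNormSq p (fun t => ζ t ω')) (fun _ => P) P' := by
  set Y : ℕ → BlockSpace p → Ω → ℂ := fun n t ω =>
    ((√(n : ℝ) : ℝ) : ℂ) * diffComplete p n (fun k => X k ω) t with hYdef
  -- The linear part of the statistic is a normalised i.i.d. sum; the difference from `Y` is √n
  -- times the second-order remainder.
  set A : ℕ → BlockSpace p → Ω → ℂ := fun n t ω => ∑ k ∈ Finset.range n,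
    (((√(n : ℝ))⁻¹ : ℝ) : ℂ) * dependenceKernel p μ t (X k ω) with hAdef
  have hYA : ∀ (n : ℕ) (t : BlockSpace p) (ω : Ω), n ≠ 0 → Y n t ω - A n t ω =
      -(((√(n : ℝ) : ℝ) : ℂ) * prodRemainder p μ n (fun k => X k ω) t) := fun n t ω hn => by
    simp only [hYdef, hAdef]
    rw [diffComplete_eq (μ := μ) hn, mul_sub, ← mul_assoc, ← Finset.mul_sum, ← sqrt_mul_inv_eq n]
    push_cast
    ring
  have hHm : ∀ (k : ℕ) t, Measurable fun ω => dependenceKernel p μ t (X k ω) := fun k t => by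
    simpa only [Function.comp_def] using (measurable_dependenceKernel_right (μ := μ) t).comp (hX k)
  have hYm : ∀ n, Measurable fun z : BlockSpace p × Ω => Y n z.1 z.2 := fun n =>
    measurable_sample_process (measurable_diffComplete n) hX _
  have hYL : ∀ n t, MemLp (Y n t) 2 P := fun n t =>
    MemLp.of_bound ((hYm n).comp measurable_prodMk_left).aestronglyMeasurable
      (‖((√(n : ℝ) : ℝ) : ℂ)‖ * 2) (ae_of_all _ fun ω => by
        simp only [hYdef]
        rw [norm_mul]
        exact mul_le_mul_of_nonneg_left (norm_diffComplete_le_two n _ t) (norm_nonneg _))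
  have hAL : ∀ n t, MemLp (A n t) 2 P := fun n t =>
    memLp_finsetSum _ fun k _ => (MemLp.of_bound (hHm k t).aestronglyMeasurable (4 * d)
      (ae_of_all _ fun ω => norm_dependenceKernel_le t (X k ω))).const_mul _
  have hAsq : ∀ n : ℕ, n ≥ d → ∀ t : BlockSpace p,
      ∫ ω, ‖A n t ω‖ ^ 2 ∂P = (limitCov p μ t t).re := fun n hn t => by
    have hn0 : (n : ℝ) ≠ 0 := by
      have : 0 < n := by omega
      exact_mod_cast this.ne'
    have h := integral_norm_sum_sample_sq hd hX hlaw hindep hμ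
      (measurable_dependenceKernel_right (μ := μ) t) (norm_dependenceKernel_le t)
      (isDegenerate_dependenceKernel hμ t) hn (fun _ => (√(n : ℝ))⁻¹)
    refine h.trans ?_
    rw [integral_norm_dependenceKernel_sq hμ]
    simp only [inv_pow, Real.sq_sqrt n.cast_nonneg, Finset.sum_const, Finset.card_range,
      nsmul_eq_mul, mul_inv_cancel₀ hn0, one_mul]
  have hBsq : ∀ n : ℕ, n ≠ 0 → ∀ t : BlockSpace p, ∫ ω, ‖Y n t ω - A n t ω‖ ^ 2 ∂P ≤
      (d : ℝ) ^ 4 * charEnvelope p μ t * (n : ℝ)⁻¹ := fun n hn t => by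
    have hn0 : (0 : ℝ) < n := by exact_mod_cast Nat.pos_of_ne_zero hn
    have e : ∀ ω, ‖Y n t ω - A n t ω‖ ^ 2 =
        n * ‖prodRemainder p μ n (fun k => X k ω) t‖ ^ 2 := fun ω => by
      rw [hYA n t ω hn, norm_neg, norm_mul, mul_pow, Complex.norm_real, Real.norm_eq_abs, sq_abs,
        Real.sq_sqrt n.cast_nonneg]
    simp_rw [e]
    rw [integral_const_mul]
    refine (mul_le_mul_of_nonneg_left
      (integral_norm_prodRemainder_sq_le hX hlaw hindep hμ hn t) n.cast_nonneg).trans_eq ?_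
    field_simp
  -- The constant comes from |Y|² ≤ 2|A|² + 2|Y − A|², with 4d² for the kernel and d⁴ for the
  -- remainder, where 1/n ≤ 1.
  have hG : ∀ n : ℕ, n ≥ d → ∀ t : BlockSpace p, ∫ ω, ‖Y n t ω‖ ^ 2 ∂P ≤
      (2 * (4 * d ^ 2) + 2 * d ^ 4) * charEnvelope p μ t := fun n hn t => by
    have hn' : n ≠ 0 := by omega
    have i1 := (hAL n t).norm.integrable_sq
    have i2 := ((hYL n t).sub (hAL n t)).norm.integrable_sq
    have h1 : ∫ ω, ‖Y n t ω‖ ^ 2 ∂P ≤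
        ∫ ω, (2 * ‖A n t ω‖ ^ 2 + 2 * ‖Y n t ω - A n t ω‖ ^ 2) ∂P := by
      refine integral_mono (hYL n t).norm.integrable_sq ((i1.const_mul 2).add (i2.const_mul 2))
        fun ω => ?_
      have h := norm_add_le (A n t ω) (Y n t ω - A n t ω)
      rw [add_sub_cancel] at h
      have h3 := pow_le_pow_left₀ (norm_nonneg _) h 2
      simp only
      nlinarith [sq_nonneg (‖A n t ω‖ - ‖Y n t ω - A n t ω‖)]
    refine h1.trans ((integral_add (i1.const_mul 2) (i2.const_mul 2)).le.trans ?_)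
    rw [integral_const_mul, integral_const_mul]
    have h2 : ∫ ω, ‖A n t ω‖ ^ 2 ∂P ≤ 4 * d ^ 2 * charEnvelope p μ t := by
      rw [hAsq n hn t, ← integral_norm_dependenceKernel_sq hμ]
      exact integral_norm_dependenceKernel_sq_le t
    have h3 := hBsq n hn' t
    have h4 : (n : ℝ)⁻¹ ≤ 1 := inv_le_one_of_one_le₀ (by exact_mod_cast Nat.pos_of_ne_zero hn')
    have h5 : (d : ℝ) ^ 4 * charEnvelope p μ t * (n : ℝ)⁻¹ ≤ d ^ 4 * charEnvelope p μ t :=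
      mul_le_of_le_one_right (mul_nonneg (by positivity) (charEnvelope_nonneg μ t)) h4
    have h6 : ∫ ω, ‖Y n t ω - A n t ω‖ ^ 2 ∂P ≤ d ^ 4 * charEnvelope p μ t := h3.trans h5
    calc _ ≤ 2 * (4 * d ^ 2 * charEnvelope p μ t) + 2 * (d ^ 4 * charEnvelope p μ t) :=
        add_le_add (mul_le_mul_of_nonneg_left h2 zero_le_two)
          (mul_le_mul_of_nonneg_left h6 zero_le_two)
      _ = _ := by ring
  have hchar : ∀ (m : ℕ) (t : Fin m → BlockSpace p) (u : Fin m → ℂ),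
      Tendsto (fun n => ∫ ω, Complex.exp
        ((∑ i, inner ℝ (u i) (Y n (t i) ω) : ℝ) * Complex.I) ∂P) atTop
        (𝓝 (Complex.exp (-(covForm (limitCov p μ) t u : ℂ) / 2))) := fun m t u => by
    have hf := measurable_kernelForm (μ := μ) t u
    have hlim := tendsto_integral_cexp_inv_sqrt_mul_sum (P := P)
      (W := fun k ω => kernelForm p μ t u (X k ω)) (v := covForm (limitCov p μ) t u)
      (MemLp.of_bound (hf.comp (hX 0)).aestronglyMeasurable (∑ i, ‖u i‖ * (4 * d))
        (ae_of_all _ fun ω => abs_kernelForm_le t u (X 0 ω)))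
      (by rw [← integral_map (hX 0).aemeasurable hf.aestronglyMeasurable, hlaw,
        integral_kernelForm hμ])
      (hindep.comp (fun _ => kernelForm p μ t u) fun _ => hf)
      (fun k => IdentDistrib.comp (u := kernelForm p μ t u) ⟨(hX k).aemeasurable,
        (hX 0).aemeasurable, (hlaw k).trans (hlaw 0).symm⟩ hf)
      (by rw [← integral_map (f := fun x => kernelForm p μ t u x ^ 2) (hX 0).aemeasurable
        (hf.pow_const 2).aestronglyMeasurable, hlaw, integral_kernelForm_sq hμ])
    have hAsum : ∀ (n : ℕ) ω, (√(n : ℝ))⁻¹ * ∑ k ∈ Finset.range n, kernelForm p μ t u (X k ω) =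
        ∑ i, inner ℝ (u i) (A n (t i) ω) := fun n ω => by
      simp only [hAdef]
      simp_rw [← Finset.mul_sum, ← Complex.real_smul, inner_smul_right, inner_sum]
      rw [← Finset.mul_sum, Finset.sum_comm]
      simp only [kernelForm]
    have hL : ∀ {Z : ℕ → BlockSpace p → Ω → ℂ}, (∀ n t, MemLp (Z n t) 2 P) → ∀ n,
        MemLp (fun ω => ∑ i, inner ℝ (u i) (Z n (t i) ω)) 2 P := fun {Z} hZ n =>
      memLp_finsetSum _ fun i _ => (hZ n (t i)).const_inner (u i)
    have hdiff : ∀ (n : ℕ), n ≠ 0 → ∫ ω, (∑ i, inner ℝ (u i) (Y n (t i) ω) -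
        ∑ i, inner ℝ (u i) (A n (t i) ω)) ^ 2 ∂P ≤
        (m * ∑ i, ‖u i‖ ^ 2 * ((d : ℝ) ^ 4 * charEnvelope p μ (t i))) * (n : ℝ)⁻¹ := fun n hn => by
      have i2 : ∀ i, Integrable (fun ω => ‖u i‖ ^ 2 * ‖Y n (t i) ω - A n (t i) ω‖ ^ 2) P := fun i =>
        (((hYL n (t i)).sub (hAL n (t i))).norm.integrable_sq).const_mul _
      have h1 : ∀ ω, (∑ i, inner ℝ (u i) (Y n (t i) ω) - ∑ i, inner ℝ (u i) (A n (t i) ω)) ^ 2 ≤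
          m * ∑ i, ‖u i‖ ^ 2 * ‖Y n (t i) ω - A n (t i) ω‖ ^ 2 := fun ω => by
        rw [← Finset.sum_sub_distrib]
        refine sq_sum_le_card_mul_sum_sq.trans ?_
        rw [Finset.card_univ, Fintype.card_fin]
        refine mul_le_mul_of_nonneg_left (Finset.sum_le_sum fun i _ => ?_) m.cast_nonneg
        rw [← inner_sub_right, ← mul_pow, ← sq_abs]
        exact pow_le_pow_left₀ (abs_nonneg _) (abs_real_inner_le_norm _ _) 2
      refine (integral_mono_of_nonneg (ae_of_all _ fun _ => sq_nonneg _)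
        ((integrable_finsetSum _ fun i _ => i2 i).const_mul _) (ae_of_all _ h1)).trans ?_
      rw [integral_const_mul, integral_finsetSum _ fun i _ => i2 i, mul_assoc, Finset.sum_mul]
      refine mul_le_mul_of_nonneg_left (Finset.sum_le_sum fun i _ => ?_) m.cast_nonneg
      rw [integral_const_mul, mul_assoc]
      exact mul_le_mul_of_nonneg_left (hBsq n hn (t i)) (sq_nonneg _)
    rw [tendsto_iff_norm_sub_tendsto_zero] at hlim ⊢
    have hrem : Tendsto (fun n : ℕ => √((m * ∑ i, ‖u i‖ ^ 2 *
        ((d : ℝ) ^ 4 * charEnvelope p μ (t i))) * (n : ℝ)⁻¹)) atTop (𝓝 0) := by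
      have h := (tendsto_inv_atTop_nhds_zero_nat (𝕜 := ℝ)).const_mul
        (m * ∑ i, ‖u i‖ ^ 2 * ((d : ℝ) ^ 4 * charEnvelope p μ (t i)))
      simpa using h.sqrt
    have hsum := hrem.add hlim
    rw [add_zero] at hsum
    refine squeeze_zero' (Eventually.of_forall fun _ => norm_nonneg _) ?_ hsum
    filter_upwards [eventually_ge_atTop 1] with n hn
    simp_rw [hAsum]
    refine (norm_sub_le_norm_sub_add_norm_sub _ (∫ ω, Complex.exp
      ((∑ i, inner ℝ (u i) (A n (t i) ω) : ℝ) * Complex.I) ∂P) _).trans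
      (add_le_add ?_ le_rfl)
    refine (norm_integral_cexp_sub_le (hL hYL n).aestronglyMeasurable.aemeasurable
      (hL hAL n).aestronglyMeasurable.aemeasurable ((hL hYL n).sub (hL hAL n))).trans ?_
    exact Real.sqrt_le_sqrt (hdiff n (by omega))
  have h := tendstoInDistribution_weightedNormSq (P := P) (μ := μ) hd hp hμ1 hYm
    (by positivity) (fun n t => (hYL n t).norm.integrable_sq) hG (fun t =>
      tendsto_integral_norm_sq_of_sub (fun n => hYL n t) (fun n => hAL n t)
        (eventually_atTop.2 ⟨d, fun n hn => hAsq n hn t⟩)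
        (eventually_atTop.2 ⟨1, fun n hn => hBsq n (by omega) t⟩)) hchar hζ
  refine ⟨h.1, ?_⟩
  have e : ∀ (n : ℕ) ω, (n : ℝ) * completeMeasure p n (fun k => X k ω) =
      weightedNormSq p fun t => Y n t ω := fun n ω => by
    simp only [hYdef]
    rw [weightedNormSq_real_mul, Real.sq_sqrt n.cast_nonneg]; rfl
  simp_rw [e]
  exact h.2

end NullLimits

/-! ### Mean-square limits of Gaussian processes -/

section MeanSquare

variable {Ω : Type*} [MeasurableSpace Ω] {P : Measure Ω}

/-- Joint continuity of the inner product of L²; it transports means, variances and covariances to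
mean-square limits. -/
lemma tendsto_integral_mul_conj {𝕜 : Type*} [RCLike 𝕜] {f g : ℕ → Ω → 𝕜} {f₀ g₀ : Ω → 𝕜}
    (hf : ∀ k, MemLp (f k) 2 P) (hg : ∀ k, MemLp (g k) 2 P) (hf₀ : MemLp f₀ 2 P)
    (hg₀ : MemLp g₀ 2 P) (hfl : Tendsto (fun k => eLpNorm (f k - f₀) 2 P) atTop (𝓝 0))
    (hgl : Tendsto (fun k => eLpNorm (g k - g₀) 2 P) atTop (𝓝 0)) :
    Tendsto (fun k => ∫ ω, f k ω * conj (g k ω) ∂P) atTop (𝓝 (∫ ω, f₀ ω * conj (g₀ ω) ∂P)) := by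
  have h1 := (Lp.tendsto_Lp_iff_tendsto_eLpNorm'' f hf f₀ hf₀).2 hfl
  have h2 := (Lp.tendsto_Lp_iff_tendsto_eLpNorm'' g hg g₀ hg₀).2 hgl
  have h3 := h2.inner (𝕜 := 𝕜) h1
  have e : ∀ {a b : Ω → 𝕜} (ha : MemLp a 2 P) (hb : MemLp b 2 P),
      inner 𝕜 (hb.toLp b) (ha.toLp a) = ∫ ω, a ω * conj (b ω) ∂P := fun {a b} ha hb => by
    rw [L2.inner_def]
    refine integral_congr_ae ?_
    filter_upwards [ha.coeFn_toLp, hb.coeFn_toLp] with ω h1 h2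
    rw [h1, h2, RCLike.inner_apply]
  simp_rw [e] at h3
  exact h3

lemma memLp_strongDual_pi {I : Type*} [Fintype I] {Z : I → Ω → ℂ} (hZ : ∀ i, MemLp (Z i) 2 P)
    (L : StrongDual ℝ (I → ℂ)) : MemLp (fun ω => L (fun i => Z i ω)) 2 P := by
  classical
  have h : ∀ ω, L (fun i => Z i ω) = ∑ i, L (Pi.single i (Z i ω)) := fun ω => by
    rw [← map_sum]
    congr 1
    exact (Finset.univ_sum_single _).symm
  simp_rw [h]
  refine memLp_finsetSum _ fun i _ => ?_
  exact (L.comp (ContinuousLinearMap.single ℝ (fun _ : I => ℂ) i)).comp_memLp' (hZ i)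

lemma tendsto_eLpNorm_strongDual_pi {I : Type*} [Fintype I] {F : ℕ → I → Ω → ℂ} {Z : I → Ω → ℂ}
    (hF : ∀ k i, MemLp (F k i) 2 P) (hZ : ∀ i, MemLp (Z i) 2 P)
    (h : ∀ i, Tendsto (fun k => eLpNorm (F k i - Z i) 2 P) atTop (𝓝 0))
    (L : StrongDual ℝ (I → ℂ)) :
    Tendsto (fun k => eLpNorm ((fun ω => L (fun i => F k i ω)) - fun ω => L (fun i => Z i ω)) 2 P)
      atTop (𝓝 0) := by
  have hsum : Tendsto (fun k => ENNReal.ofReal ‖L‖ * ∑ i, eLpNorm (F k i - Z i) 2 P) atTop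
      (𝓝 0) := by
    have h1 := tendsto_finsetSum (Finset.univ : Finset I) fun i _ => h i
    simp only [Finset.sum_const_zero] at h1
    have h2 := ENNReal.Tendsto.const_mul (a := ENNReal.ofReal ‖L‖) h1
      (Or.inr ENNReal.ofReal_ne_top)
    rwa [mul_zero] at h2
  refine tendsto_of_tendsto_of_tendsto_of_le_of_le tendsto_const_nhds hsum
    (fun _ => zero_le) fun k => ?_
  have h1 : ∀ ω, ‖((fun ω => L (fun i => F k i ω)) - fun ω => L (fun i => Z i ω)) ω‖ ≤
      ‖L‖ * ‖∑ i, ‖(F k i - Z i) ω‖‖ := fun ω => by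
    simp only [Pi.sub_apply]
    rw [← map_sub]
    refine (L.le_opNorm _).trans (mul_le_mul_of_nonneg_left ?_ (norm_nonneg _))
    rw [Real.norm_of_nonneg (Finset.sum_nonneg fun _ _ => norm_nonneg _)]
    refine (pi_norm_le_iff_of_nonneg (Finset.sum_nonneg fun _ _ => norm_nonneg _)).2 fun i => ?_
    exact Finset.single_le_sum (f := fun i => ‖F k i ω - Z i ω‖)
      (fun _ _ => norm_nonneg _) (Finset.mem_univ i)
  refine (eLpNorm_le_mul_eLpNorm_of_ae_le_mul (ae_of_all _ h1) 2).trans ?_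
  refine mul_le_mul_right ?_ _
  have h2 : (fun ω => ∑ i, ‖(F k i - Z i) ω‖) = ∑ i, fun ω => ‖(F k i - Z i) ω‖ := by
    ext ω; simp
  rw [h2]
  refine (eLpNorm_sum_le (fun i _ => ((hF k i).sub (hZ i)).norm.aestronglyMeasurable)
    (by norm_num)).trans (Finset.sum_le_sum fun i _ => ?_)
  exact (eLpNorm_norm _).le

/-- Mean-square limits of Gaussian processes are Gaussian. -/
theorem isGaussianProcess_of_tendsto_eLpNorm [IsProbabilityMeasure P] {T : Type*}
    {F : ℕ → T → Ω → ℂ} (hF : ∀ k, IsGaussianProcess (F k) P) {ζ : T → Ω → ℂ}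
    (hζ : ∀ t, MemLp (ζ t) 2 P)
    (h : ∀ t, Tendsto (fun k => eLpNorm (F k t - ζ t) 2 P) atTop (𝓝 0)) :
    IsGaussianProcess ζ P where
  hasGaussianLaw I := by
    have hFL : ∀ k t, MemLp (F k t) 2 P := fun k t => ((hF k).hasGaussianLaw_eval t).memLp_two
    have hm : AEMeasurable (fun ω => I.restrict (ζ · ω)) P :=
      aemeasurable_pi_lambda _ fun i => (hζ i).aestronglyMeasurable.aemeasurable
    refine (hasGaussianLaw_iff_charFunDual_map_eq hm).2 fun L => ?_
    set R : ℕ → Ω → ℝ := fun k ω => L (fun i : I => F k i ω) with hR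
    set R₀ : Ω → ℝ := fun ω => L (fun i : I => ζ i ω) with hR₀
    have m1 : ∀ k, MemLp (R k) 2 P := fun k => memLp_strongDual_pi (fun i : I => hFL k i) L
    have m0 : MemLp R₀ 2 P := memLp_strongDual_pi (fun i : I => hζ i) L
    have hlim : Tendsto (fun k => eLpNorm (R k - R₀) 2 P) atTop (𝓝 0) :=
      tendsto_eLpNorm_strongDual_pi (fun k (i : I) => hFL k i) (fun i : I => hζ i)
        (fun i => h i) L
    have mean : Tendsto (fun k => ∫ ω, R k ω ∂P) atTop (𝓝 (∫ ω, R₀ ω ∂P)) := by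
      have := tendsto_integral_mul_conj (g := fun _ _ => (1 : ℝ)) (g₀ := fun _ => 1) m1
        (fun _ => memLp_const 1) m0 (memLp_const 1) hlim (by simp)
      simpa using this
    have sqm : Tendsto (fun k => ∫ ω, R k ω ^ 2 ∂P) atTop (𝓝 (∫ ω, R₀ ω ^ 2 ∂P)) := by
      have := tendsto_integral_mul_conj m1 m1 m0 m0 hlim hlim
      simpa [← sq] using this
    have dif : Tendsto (fun k => ∫ ω, (R k ω - R₀ ω) ^ 2 ∂P) atTop (𝓝 0) := by
      have := tendsto_integral_mul_conj (f₀ := 0) (g₀ := 0) (fun k => (m1 k).sub m0)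
        (fun k => (m1 k).sub m0) MemLp.zero MemLp.zero (by simpa using hlim) (by simpa using hlim)
      simpa [← sq] using this
    have var : Tendsto (fun k => Var[R k; P]) atTop (𝓝 (Var[R₀; P])) := by
      rw [variance_eq_sub m0]
      simp_rw [fun k => variance_eq_sub (m1 k)]
      exact sqm.sub (mean.pow 2)
    have e0 : charFunDual (P.map fun ω => I.restrict (ζ · ω)) L =
        ∫ ω, Complex.exp (R₀ ω * Complex.I) ∂P := by
      rw [charFunDual_apply, integral_map hm (by fun_prop)]
      rfl
    have ek : ∀ k, ∫ ω, Complex.exp (R k ω * Complex.I) ∂P =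
        Complex.exp ((∫ ω, R k ω ∂P : ℝ) * Complex.I - Var[R k; P] / 2) := fun k => by
      have hG := (hF k).hasGaussianLaw I
      have := hG.charFunDual_map_eq_fun L
      rw [charFunDual_apply, integral_map hG.aemeasurable (by fun_prop)] at this
      exact this
    rw [e0]
    -- The characteristic functions of `R k` converge to that of `R₀` by the L² estimate, and to the
    -- Gaussian expression because means and variances converge.
    refine tendsto_nhds_unique (f := fun k => ∫ ω, Complex.exp (R k ω * Complex.I) ∂P)
      (l := atTop) ?_ ?_
    · rw [tendsto_iff_norm_sub_tendsto_zero]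
      refine squeeze_zero (fun _ => norm_nonneg _) (fun k => norm_integral_cexp_sub_le
        (m1 k).aestronglyMeasurable.aemeasurable m0.aestronglyMeasurable.aemeasurable
        ((m1 k).sub m0)) ?_
      simpa using dif.sqrt
    · simp_rw [ek]
      have hc : Continuous fun q : ℝ × ℝ => Complex.exp ((q.1 : ℂ) * Complex.I - q.2 / 2) := by
        fun_prop
      exact (hc.tendsto _).comp (mean.prodMk_nhds var)

end MeanSquare

/-! ### Jointly measurable Gaussian series -/

section GaussianSeries

variable {Ω : Type*} [MeasurableSpace Ω] {P : Measure Ω} [IsProbabilityMeasure P]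

omit [IsProbabilityMeasure P] in
lemma integral_sum_mul_conj_sum {g : ℕ → Ω → ℝ} (hg : ∀ n, MemLp (g n) 2 P)
    (horth : ∀ n m, ∫ ω, g n ω * g m ω ∂P = if n = m then 1 else 0) (s s' : Finset ℕ)
    (a b : ℕ → ℂ) :
    ∫ ω, (∑ n ∈ s, a n * g n ω) * conj (∑ n ∈ s', b n * g n ω) ∂P =
      ∑ n ∈ s ∩ s', a n * conj (b n) := by
  have hi : ∀ n m, Integrable (fun ω => a n * conj (b m) * ((g n ω * g m ω : ℝ) : ℂ)) P :=
    fun n m => (((hg n).integrable_mul (hg m)).ofReal).const_mul _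
  have e : ∀ ω, (∑ n ∈ s, a n * g n ω) * conj (∑ n ∈ s', b n * g n ω) =
      ∑ n ∈ s, ∑ m ∈ s', a n * conj (b m) * ((g n ω * g m ω : ℝ) : ℂ) := fun ω => by
    rw [map_sum, Finset.sum_mul_sum]
    refine Finset.sum_congr rfl fun n _ => Finset.sum_congr rfl fun m _ => ?_
    rw [map_mul, Complex.conj_ofReal]
    push_cast
    ring
  simp_rw [e]
  rw [integral_finsetSum _ fun n _ => integrable_finsetSum _ fun m _ => hi n m]
  rw [← Finset.filter_mem_eq_inter, Finset.sum_filter]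
  refine Finset.sum_congr rfl fun n _ => ?_
  rw [integral_finsetSum _ fun m _ => hi n m]
  have h1 : ∀ m, ∫ ω, a n * conj (b m) * ((g n ω * g m ω : ℝ) : ℂ) ∂P =
      if n = m then a n * conj (b m) else 0 := fun m => by
    rw [integral_const_mul, integral_complex_ofReal, horth]
    split_ifs <;> simp
  simp_rw [h1]
  rw [Finset.sum_ite_eq]

/-- A sequence of independent standard Gaussian variables. -/
lemma exists_iid_gaussian : ∃ (Ω' : Type) (_ : MeasurableSpace Ω') (P' : Measure Ω')
    (_ : IsProbabilityMeasure P') (g : ℕ → Ω' → ℝ), (∀ n, Measurable (g n)) ∧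
    IsGaussianProcess g P' ∧ (∀ n, ∫ ω, g n ω ∂P' = 0) ∧
    ∀ n m, ∫ ω, g n ω * g m ω ∂P' = if n = m then 1 else 0 := by
  let γ : Measure ℝ := gaussianReal 0 1
  let P' : Measure (ℕ → ℝ) := Measure.infinitePi fun _ => γ
  let g : ℕ → (ℕ → ℝ) → ℝ := fun n ω => ω n
  have hm : ∀ n, Measurable (g n) := fun n => measurable_pi_apply n
  have hlaw : ∀ n, P'.map (g n) = γ := fun n => Measure.infinitePi_map_eval (fun _ => γ) n
  have hind : iIndepFun g P' :=
    iIndepFun_infinitePi (P := fun _ => γ) (X := fun _ x => x) fun _ => measurable_id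
  have hG : ∀ n, HasGaussianLaw (g n) P' := fun n => ⟨by rw [hlaw n]; infer_instance⟩
  have hmean : ∀ n, ∫ ω, g n ω ∂P' = 0 := fun n => by
    rw [← integral_map (f := fun x : ℝ => x) (hm n).aemeasurable (by fun_prop), hlaw n]
    exact integral_id_gaussianReal
  refine ⟨ℕ → ℝ, inferInstance, P', inferInstance, g, hm, ⟨fun I => ?_⟩, hmean, fun n m => ?_⟩
  · exact iIndepFun.hasGaussianLaw (X := fun i : I => g i) (fun i => hG i)
      (hind.precomp Subtype.val_injective)
  · split_ifs with h
    · subst h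
      have hv : Var[g n; P'] = 1 := by
        rw [← variance_id_map (hm n).aemeasurable, hlaw n, variance_id_gaussianReal]
        rfl
      rw [variance_of_integral_eq_zero (hm n).aemeasurable (hmean n)] at hv
      simpa [sq] using hv
    · rw [(hind.indepFun h).integral_fun_mul_eq_mul_integral (hm n).aestronglyMeasurable
        (hm m).aestronglyMeasurable, hmean, zero_mul]

omit [IsProbabilityMeasure P] in
lemma eLpNorm_two_lt_of_integral_sq_lt {f : Ω → ℂ} (hf : MemLp f 2 P) {r : ℝ} (hr : 0 < r)
    (h : ∫ ω, ‖f ω‖ ^ 2 ∂P < r ^ 2) : eLpNorm f 2 P < ENNReal.ofReal r := by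
  rw [hf.eLpNorm_eq_integral_rpow_norm two_ne_zero ENNReal.ofNat_ne_top,
    ENNReal.ofReal_lt_ofReal_iff hr]
  simp only [ENNReal.toReal_ofNat, Real.rpow_ofNat]
  rw [← one_div, ← Real.sqrt_eq_rpow]
  exact (Real.sqrt_lt' hr).2 h

/-- A complex Gaussian series with measurable coefficients defines a jointly measurable Hermitian
Gaussian process. -/
theorem exists_isHermitianGaussianProcess {V : Type*} [MeasurableSpace V] [Neg V]
    {a : ℕ → V → ℂ} (ha : ∀ n, Measurable (a n)) (hneg : ∀ n t, a n (-t) = conj (a n t))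
    {C : V → V → ℂ} (hC : ∀ t s, HasSum (fun n => a n t * conj (a n s)) (C t s)) :
    ∃ (Ω' : Type) (_ : MeasurableSpace Ω') (P' : Measure Ω') (_ : IsProbabilityMeasure P')
      (ζ : V → Ω' → ℂ), IsHermitianGaussianProcess ζ P' C := by
  classical
  obtain ⟨Ω', mΩ', P', hP', g, gm, gG, g0, gorth⟩ := exists_iid_gaussian
  have gL : ∀ n, MemLp (g n) 2 P' := fun n => (gG.hasGaussianLaw_eval n).memLp_two
  refine ⟨Ω', mΩ', P', hP', ?_⟩
  -- the total mass of the coefficients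
  have hT : ∀ t, HasSum (fun n => ‖a n t‖ ^ 2) (C t t).re := fun t => by
    have h := Complex.reCLM.hasSum (hC t t)
    have e : (fun n => ‖a n t‖ ^ 2) = fun n => Complex.reCLM (a n t * conj (a n t)) := by
      ext n
      rw [Complex.mul_conj, Complex.normSq_eq_norm_sq, Complex.reCLM_apply, Complex.ofReal_re]
    rw [e]
    exact h
  have hTm : Measurable fun t => (C t t).re :=
    measurable_of_tendsto_metrizable
      (fun N => Finset.measurable_sum (Finset.range N) fun n _ => (ha n).norm.pow_const 2)
      (tendsto_pi_nhds.2 fun t => (hT t).tendsto_sum_nat)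
  -- A length depending on t makes the k-th partial sum accurate to 2^{−k} in L², uniformly in t;
  -- hence the square of 2^{−k} for the tail of squared coefficients. The condition `k ≤ N` ensures
  -- that the lengths tend to infinity.
  have hex : ∀ (k : ℕ) (t : V), ∃ N, k ≤ N ∧
      (C t t).re - ∑ n ∈ Finset.range N, ‖a n t‖ ^ 2 < ((1 / 2 : ℝ) ^ k) ^ 2 := fun k t => by
    have h := ((hT t).tendsto_sum_nat).const_sub (C t t).re
    rw [sub_self] at h
    exact ((eventually_ge_atTop k).and
      (h.eventually_lt_const (by positivity : (0 : ℝ) < ((1 / 2 : ℝ) ^ k) ^ 2))).exists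
  set N : ℕ → V → ℕ := fun k t => Nat.find (hex k t) with hN
  have hNs : ∀ k t, k ≤ N k t ∧ (C t t).re - ∑ n ∈ Finset.range (N k t), ‖a n t‖ ^ 2 <
      ((1 / 2 : ℝ) ^ k) ^ 2 := fun k t => Nat.find_spec (hex k t)
  have hNm : ∀ k, Measurable (N k) := fun k => by
    refine measurable_find (hex k) fun M => ?_
    have h1 : Measurable fun t => (C t t).re - ∑ n ∈ Finset.range M, ‖a n t‖ ^ 2 :=
      hTm.sub (Finset.measurable_sum _ fun n _ => (ha n).norm.pow_const 2)
    exact (MeasurableSet.const (k ≤ M)).inter (measurableSet_lt h1 measurable_const)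
  set F : ℕ → V → Ω' → ℂ := fun k t ω => ∑ n ∈ Finset.range (N k t), a n t * g n ω with hF
  have hFm : ∀ k, Measurable fun z : V × Ω' => F k z.1 z.2 := fun k => by
    have h0 : ∀ n, Measurable fun z : V × Ω' => a n z.1 * (g n z.2 : ℂ) := fun n =>
      ((ha n).comp measurable_fst).mul
        (Complex.measurable_ofReal.comp ((gm n).comp measurable_snd))
    -- The varying length becomes a countable coordinate, so joint measurability is checked one
    -- length at a time.
    have h1 : Measurable fun q : ℕ × (V × Ω') => ∑ n ∈ Finset.range q.1, a n q.2.1 * g n q.2.2 :=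
      measurable_from_prod_countable_right fun M => Finset.measurable_sum (Finset.range M) fun n _ =>
        h0 n
    have h2 : Measurable fun z : V × Ω' => (N k z.1, z) :=
      ((hNm k).comp measurable_fst).prodMk measurable_id
    exact h1.comp h2
  have hFG : ∀ k, IsGaussianProcess (F k) P' := fun k => by
    refine gG.of_isGaussianProcess fun t => ⟨Finset.range (N k t),
      ∑ i : Finset.range (N k t), (ContinuousLinearMap.proj (R := ℝ)
        (φ := fun _ : Finset.range (N k t) => ℝ) i).smulRight (a i t), fun ω => ?_⟩
    simp only [hF, sum_apply, ContinuousLinearMap.smulRight_apply,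
      ContinuousLinearMap.proj_apply, Finset.restrict, Complex.real_smul]
    rw [← Finset.sum_coe_sort (Finset.range (N k t))]
    exact Finset.sum_congr rfl fun n _ => mul_comm _ _
  have hFL : ∀ k t, MemLp (F k t) 2 P' := fun k t => ((hFG k).hasGaussianLaw_eval t).memLp_two
  have hdiff : ∀ (k l : ℕ) (t : V), N k t ≤ N l t → ∫ ω, ‖(F l t - F k t) ω‖ ^ 2 ∂P' <
      ((1 / 2 : ℝ) ^ k) ^ 2 := fun k l t hkl => by
    refine lt_of_le_of_lt ?_ (hNs k t).2
    have e : ∀ ω, ‖(F l t - F k t) ω‖ ^ 2 =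
        RCLike.re ((∑ n ∈ Finset.Ico (N k t) (N l t), a n t * g n ω) *
          conj (∑ n ∈ Finset.Ico (N k t) (N l t), a n t * g n ω)) := fun ω => by
      rw [RCLike.mul_conj, Finset.sum_Ico_eq_sub _ hkl]
      norm_cast
    have hi : Integrable (fun ω => (∑ n ∈ Finset.Ico (N k t) (N l t), a n t * g n ω) *
          conj (∑ n ∈ Finset.Ico (N k t) (N l t), a n t * g n ω)) P' := by
      have hL : MemLp (fun ω => ∑ n ∈ Finset.Ico (N k t) (N l t), a n t * (g n ω : ℂ)) 2 P' :=
        memLp_finsetSum _ fun n _ => ((gL n).ofReal).const_mul _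
      exact hL.integrable_mul hL.star
    simp_rw [e]
    rw [integral_re hi, integral_sum_mul_conj_sum gL gorth, Finset.inter_self, map_sum,
      le_sub_iff_add_le, add_comm]
    have e2 : ∀ n, RCLike.re (a n t * conj (a n t)) = ‖a n t‖ ^ 2 := fun n => by
      rw [RCLike.mul_conj]; norm_cast
    simp_rw [e2]
    rw [Finset.sum_range_add_sum_Ico _ hkl]
    exact sum_le_hasSum _ (fun _ _ => sq_nonneg _) (hT t)
  have hcau : ∀ (t : V) (M k l : ℕ), M ≤ k → M ≤ l →
      eLpNorm (F k t - F l t) 2 P' < ENNReal.ofReal ((1 / 2 : ℝ) ^ M) := fun t => by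
    have key : ∀ (M k l : ℕ), M ≤ k → N k t ≤ N l t →
        eLpNorm (F l t - F k t) 2 P' < ENNReal.ofReal ((1 / 2 : ℝ) ^ M) := fun M k l hk hkl => by
      refine (eLpNorm_two_lt_of_integral_sq_lt ((hFL l t).sub (hFL k t)) (by positivity)
        (hdiff k l t hkl)).trans_le (ENNReal.ofReal_le_ofReal ?_)
      exact pow_le_pow_of_le_one (by norm_num) (by norm_num) hk
    intro M k l hk hl
    rcases le_total (N k t) (N l t) with h | h
    · rw [eLpNorm_sub_comm]
      exact key M k l hk h
    · exact key M l k hl h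
  have hB : ∑' M : ℕ, ENNReal.ofReal ((1 / 2 : ℝ) ^ M) ≠ ⊤ := by
    rw [← ENNReal.ofReal_tsum_of_nonneg (fun _ => by positivity) summable_geometric_two]
    exact ENNReal.ofReal_ne_top
  -- Errors summable in L² force almost sure convergence for each t. The pointwise limit, arbitrary
  -- where it fails to exist, is jointly measurable.
  set ζ : V → Ω' → ℂ := fun t ω => limUnder atTop fun k => F k t ω with hζ
  have hζm : Measurable fun z : V × Ω' => ζ z.1 z.2 :=
    (StronglyMeasurable.limUnder fun k => (hFm k).stronglyMeasurable).measurable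
  have hlim : ∀ t, ∀ᵐ ω ∂P', Tendsto (fun k => F k t ω) atTop (𝓝 (ζ t ω)) := fun t => by
    filter_upwards [Lp.ae_tendsto_of_cauchy_eLpNorm (fun k => (hFL k t).aestronglyMeasurable)
      (by norm_num) hB (hcau t)] with ω hω
    exact tendsto_nhds_limUnder hω
  have hL2 : ∀ t, Tendsto (fun k => eLpNorm (F k t - ζ t) 2 P') atTop (𝓝 0) := fun t =>
    Lp.cauchy_tendsto_of_tendsto (fun k => (hFL k t).aestronglyMeasurable) (ζ t) hB (hcau t) (hlim t)
  have hζL : ∀ t, MemLp (ζ t) 2 P' := fun t =>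
    Lp.memLp_of_cauchy_tendsto (by norm_num) (fun k => hFL k t) (ζ t)
      (hζm.comp measurable_prodMk_left).aestronglyMeasurable (hL2 t)
  refine ⟨ζ, hζm, isGaussianProcess_of_tendsto_eLpNorm hFG hζL hL2, fun t => ?_, fun t s => ?_,
    fun t => ?_⟩
  · have h := tendsto_integral_mul_conj (g := fun _ _ => (1 : ℂ)) (g₀ := fun _ => 1)
      (fun k => hFL k t) (fun _ => memLp_const 1) (hζL t) (memLp_const 1) (hL2 t) (by simp)
    simp only [map_one, mul_one] at h
    refine tendsto_nhds_unique h ?_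
    have e : ∀ k, ∫ ω, F k t ω ∂P' = 0 := fun k => by
      have hi : ∀ n, Integrable (fun ω => a n t * (g n ω : ℂ)) P' := fun n =>
        (((gL n).integrable (by norm_num)).ofReal).const_mul _
      simp only [hF]
      rw [integral_finsetSum _ fun n _ => hi n]
      refine Finset.sum_eq_zero fun n _ => ?_
      rw [integral_const_mul, integral_complex_ofReal, g0]
      simp
    simp_rw [e]
    exact tendsto_const_nhds
  · refine tendsto_nhds_unique (tendsto_integral_mul_conj (fun k => hFL k t) (fun k => hFL k s)
      (hζL t) (hζL s) (hL2 t) (hL2 s)) ?_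
    have e : ∀ k, ∫ ω, F k t ω * conj (F k s ω) ∂P' =
        ∑ n ∈ Finset.range (min (N k t) (N k s)), a n t * conj (a n s) := fun k => by
      simp only [hF]
      rw [integral_sum_mul_conj_sum gL gorth]
      congr 1
      ext n
      simp
    simp_rw [e]
    -- Partial sums at t and s overlap on the shorter length, which is at least k.
    refine (hC t s).tendsto_sum_nat.comp (tendsto_atTop_mono (fun k => ?_) tendsto_id)
    exact le_min (hNs k t).1 (hNs k s).1
  -- Coefficients at t and −t have equal moduli, hence equal truncation lengths, so every partial
  -- sum already has the symmetry.
  · have hCneg : (C (-t) (-t)).re = (C t t).re :=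
      (hT (-t)).unique (by simpa only [hneg, RCLike.norm_conj] using hT t)
    have hNneg : ∀ k, N k (-t) = N k t := fun k => by
      simp only [hN, hneg, RCLike.norm_conj, hCneg]
    have hFneg : ∀ k ω, F k (-t) ω = conj (F k t ω) := fun k ω => by
      simp only [hF, hNneg, hneg, map_sum, map_mul, Complex.conj_ofReal]
    filter_upwards [hlim t, hlim (-t)] with ω h1 h2
    refine tendsto_nhds_unique h2 ?_
    simp_rw [hFneg]
    exact (Complex.continuous_conj.tendsto _).comp h1

end GaussianSeries

/-! ### Basis coefficients of an L² kernel -/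

section Coefficients

/-- Orthonormal vectors are at distance √2 from each other, so no point of a dense sequence lies
within 1/2 of two of them. -/
lemma Orthonormal.countable {E ι : Type*} [NormedAddCommGroup E] [InnerProductSpace ℝ E]
    [TopologicalSpace.SeparableSpace E] {b : ι → E} (hb : Orthonormal ℝ b) : Countable ι := by
  have hdist : ∀ i j, i ≠ j → 1 ≤ dist (b i) (b j) := fun i j hij => by
    have h : ‖b i - b j‖ ^ 2 = 2 := by
      rw [norm_sub_sq_real, hb.1 i, hb.1 j, hb.2 hij]
      norm_num
    rw [dist_eq_norm]
    nlinarith [norm_nonneg (b i - b j)]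
  have hex : ∀ i, ∃ n, dist (b i) (TopologicalSpace.denseSeq E n) < 1 / 2 := fun i =>
    (TopologicalSpace.denseRange_denseSeq E).exists_dist_lt (b i) (by norm_num)
  choose f hf using hex
  refine Function.Injective.countable (f := f) fun i j hij => ?_
  by_contra hne
  have h1 := hdist i j hne
  have h2 := dist_triangle_right (b i) (b j) (TopologicalSpace.denseSeq E (f i))
  have h3 := hf i
  have h4 := hf j
  rw [← hij] at h4
  linarith

/-- Parseval's identity along a sequence in a separable Hilbert space. -/
lemma exists_seq_hasSum_inner_mul_inner (E : Type*) [NormedAddCommGroup E] [InnerProductSpace ℝ E]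
    [CompleteSpace E] [TopologicalSpace.SeparableSpace E] :
    ∃ e : ℕ → E, ∀ f g : E, HasSum (fun n => inner ℝ f (e n) * inner ℝ (e n) g) (inner ℝ f g) := by
  obtain ⟨w, b, -⟩ := exists_hilbertBasis ℝ E
  have : Countable w := b.orthonormal.countable
  obtain ⟨enc, henc⟩ := exists_injective_nat w
  -- The basis may be finite; unused positions of the sequence are filled with zero vectors, which
  -- add nothing to Parseval's sum.
  refine ⟨Function.extend enc b 0, fun f g => ?_⟩
  rw [← henc.hasSum_iff]
  · refine (b.hasSum_inner_mul_inner f g).congr_fun fun i => ?_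
    simp [henc.extend_apply]
  · intro n hn
    rw [Function.extend_apply' _ _ _ (by simpa using hn)]
    simp

/-- A complex kernel in `L²` has a sequence of measurable real-basis coefficients. -/
lemma exists_kernel_coefficients {V S : Type*} [MeasurableSpace V] [MeasurableSpace S]
    [MeasurableSpace.CountablyGenerated S] (μ : Measure S) [IsProbabilityMeasure μ]
    {H : V → S → ℂ} (Hm : Measurable fun z : V × S => H z.1 z.2) (HL : ∀ t, MemLp (H t) 2 μ) :
    ∃ a : ℕ → V → ℂ, (∀ n, Measurable (a n)) ∧
      (∀ t s, HasSum (fun n => a n t * conj (a n s)) (∫ x, H t x * conj (H s x) ∂μ)) ∧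
      ∀ n t s, (∀ x, H s x = conj (H t x)) → a n s = conj (a n t) := by
  have : Fact ((2 : ENNReal) ≠ ⊤) := ⟨by norm_num⟩
  -- A basis of the real L² is taken for a complex kernel: coefficients against real functions
  -- commute with conjugation, which carries the Hermitian symmetry over.
  obtain ⟨e, he⟩ := exists_seq_hasSum_inner_mul_inner (Lp ℝ 2 μ)
  have hem : ∀ n, Measurable (e n) := fun n => (Lp.stronglyMeasurable (e n)).measurable
  have heL : ∀ n, MemLp (e n) 2 μ := fun n => Lp.memLp (e n)
  have hre : ∀ t, MemLp (fun x => (H t x).re) 2 μ := fun t => (HL t).re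
  have him : ∀ t, MemLp (fun x => (H t x).im) 2 μ := fun t => (HL t).im
  have hinner : ∀ {f g : S → ℝ} (hf : MemLp f 2 μ) (hg : MemLp g 2 μ),
      inner ℝ (hf.toLp f) (hg.toLp g) = ∫ x, f x * g x ∂μ := fun {f g} hf hg => by
    rw [L2.inner_def]
    refine integral_congr_ae ?_
    filter_upwards [hf.coeFn_toLp, hg.coeFn_toLp] with x h1 h2
    rw [h1, h2]
    exact mul_comm _ _
  have hinner' : ∀ {f : S → ℝ} (hf : MemLp f 2 μ) n,
      inner ℝ (hf.toLp f) (e n) = ∫ x, f x * e n x ∂μ := fun {f} hf n => by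
    rw [L2.inner_def]
    refine integral_congr_ae ?_
    filter_upwards [hf.coeFn_toLp] with x h1
    rw [h1]
    exact mul_comm _ _
  have hsum : ∀ {f g : S → ℝ}, MemLp f 2 μ → MemLp g 2 μ →
      HasSum (fun n => (∫ x, f x * e n x ∂μ) * ∫ x, g x * e n x ∂μ) (∫ x, f x * g x ∂μ) :=
    fun {f g} hf hg => by
      have h := he (hf.toLp f) (hg.toLp g)
      simp_rw [fun n => real_inner_comm (hg.toLp g) (e n), hinner', hinner] at h
      exact h
  have hmul : ∀ {f g : S → ℝ}, MemLp f 2 μ → MemLp g 2 μ → Integrable (fun x => f x * g x) μ :=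
    fun hf hg => hf.integrable_mul hg
  have hi : ∀ t n, Integrable (fun x => H t x * (e n x : ℂ)) μ := fun t n =>
    (HL t).integrable_mul (heL n).ofReal
  refine ⟨fun n t => ∫ x, H t x * (e n x : ℂ) ∂μ, fun n => ?_, fun t s => ?_, fun n t s h => ?_⟩
  · exact measurable_integral_right (f := fun t x => H t x * (e n x : ℂ))
      (Hm.mul (Complex.measurable_ofReal.comp ((hem n).comp measurable_snd)))
  · have hre' : ∀ t n, (∫ x, H t x * (e n x : ℂ) ∂μ).re = ∫ x, (H t x).re * e n x ∂μ := fun t n => by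
      have h := integral_re (hi t n)
      rw [RCLike.re_eq_complex_re] at h
      rw [← h]
      simp only [Complex.re_mul_ofReal]
    have him' : ∀ t n, (∫ x, H t x * (e n x : ℂ) ∂μ).im = ∫ x, (H t x).im * e n x ∂μ := fun t n => by
      have h := integral_im (hi t n)
      rw [RCLike.im_eq_complex_im] at h
      rw [← h]
      simp only [Complex.im_mul_ofReal]
    have hij : Integrable (fun x => H t x * conj (H s x)) μ := (HL t).integrable_mul (HL s).star
    rw [Complex.hasSum_iff]
    constructor
    · have h := (hsum (hre t) (hre s)).add (hsum (him t) (him s))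
      have h2 := integral_re hij
      rw [RCLike.re_eq_complex_re] at h2
      rw [← h2]
      simp only [Complex.mul_re, Complex.conj_re, Complex.conj_im, hre', him', mul_neg, sub_neg_eq_add]
      rw [integral_add (hmul (hre t) (hre s)) (hmul (him t) (him s))]
      exact h
    · have h := (hsum (him t) (hre s)).sub (hsum (hre t) (him s))
      have h2 := integral_im hij
      rw [RCLike.im_eq_complex_im] at h2
      rw [← h2]
      simp only [Complex.mul_im, Complex.conj_re, Complex.conj_im, hre', him', mul_neg]
      have e1 : ∀ x, -((H t x).re * (H s x).im) + (H t x).im * (H s x).re =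
        (H t x).im * (H s x).re - (H t x).re * (H s x).im := fun x => by ring
      simp_rw [e1]
      rw [integral_sub (hmul (him t) (hre s)) (hmul (hre t) (him s))]
      convert! h using 2 with n
      ring
  · simp only [h]
    rw [← integral_conj]
    refine integral_congr_ae (ae_of_all _ fun x => ?_)
    simp only [map_mul, Complex.conj_ofReal]

end Coefficients

/-! ### Existence of the limit processes -/

section Existence

variable {d : ℕ} {p : Fin d → ℕ} {μ : Measure (BlockSpace p)} [IsProbabilityMeasure μ]

/-- R is the Gram function of the kernel in L²(μ), so Parseval writes it as a sum of products of
coefficients; √c scales these. -/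
lemma exists_isHermitianGaussianProcess_limitCov
    (hμ : iIndepFun (fun (j : Fin d) (x : BlockSpace p) => x j) μ) {c : ℝ} (hc : 0 ≤ c) :
    ∃ (Ω' : Type) (_ : MeasurableSpace Ω') (P' : Measure Ω') (_ : IsProbabilityMeasure P')
      (ζ : BlockSpace p → Ω' → ℂ),
      IsHermitianGaussianProcess ζ P' (fun t t₀ => (c : ℂ) * limitCov p μ t t₀) := by
  obtain ⟨a, am, asum, aneg⟩ := exists_kernel_coefficients μ
    (H := fun t x => dependenceKernel p μ t x) measurable_dependenceKernel memLp_dependenceKernel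
  refine exists_isHermitianGaussianProcess (a := fun n t => ((√c : ℝ) : ℂ) * a n t)
    (fun n => (am n).const_mul _) (fun n t => ?_) fun t s => ?_
  · rw [map_mul, Complex.conj_ofReal, aneg n t (-t) fun x => dependenceKernel_neg t x]
  · have h := (asum t s).mul_left (c : ℂ)
    rw [integral_dependenceKernel_mul_conj hμ] at h
    convert! h using 2 with n
    have : (c : ℂ) = ((√c : ℝ) : ℂ) * ((√c : ℝ) : ℂ) := by
      rw [← Complex.ofReal_mul, Real.mul_self_sqrt hc]
    rw [map_mul, Complex.conj_ofReal, this]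
    ring

end Existence

/-! ### Strong laws for the empirical characteristic functions -/

section LargeNumbers

variable {d : ℕ} {p : Fin d → ℕ} {μ : Measure (BlockSpace p)} [IsProbabilityMeasure μ]
  {Ω : Type*} [MeasurableSpace Ω] {P : Measure Ω} [IsProbabilityMeasure P]
  {X : ℕ → Ω → BlockSpace p}

lemma ae_tendsto_inv_mul_sum {E : Type*} [MeasurableSpace E] {ν : Measure E} {Y : ℕ → Ω → E}
    (hY : ∀ k, Measurable (Y k)) (hlaw : ∀ k, P.map (Y k) = ν) (hindep : iIndepFun Y P)
    {g : E → ℂ} (hg : Measurable g) {C : ℝ} (hC : ∀ x, ‖g x‖ ≤ C) :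
    ∀ᵐ ω ∂P, Tendsto (fun n : ℕ => (n : ℂ)⁻¹ * ∑ k ∈ Finset.range n, g (Y k ω)) atTop
      (𝓝 (∫ x, g x ∂ν)) := by
  have h := strong_law_ae (μ := P) (fun k ω => g (Y k ω))
    (integrable_of_measurable_bounded (hg.comp (hY 0)) fun ω => hC _)
    (fun k l hkl => (hindep.indepFun hkl).comp hg hg)
    (fun k => IdentDistrib.comp (u := g) ⟨(hY k).aemeasurable, (hY 0).aemeasurable,
      (hlaw k).trans (hlaw 0).symm⟩ hg)
  rw [← integral_map (hY 0).aemeasurable hg.aestronglyMeasurable, hlaw] at h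
  simpa only [Complex.real_smul, Complex.ofReal_inv, Complex.ofReal_natCast] using h

lemma sum_range_mul_eq {M : Type*} [AddCommMonoid M] (z : ℕ → M) (q d : ℕ) :
    ∑ k ∈ Finset.range (q * d), z k =
      ∑ r ∈ Finset.range d, ∑ a ∈ Finset.range q, z (a * d + r) := by
  rw [Finset.sum_comm]
  induction q with
  | zero => simp
  | succ q ih => rw [Nat.succ_mul, Finset.sum_range_add, ih, Finset.sum_range_succ]

/-- Averages converge if they do along each residue class. -/
lemma tendsto_inv_mul_sum_of_residues {d : ℕ} (hd : 1 ≤ d) {z : ℕ → ℂ} {C : ℝ}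
    (hz : ∀ k, ‖z k‖ ≤ C) {L : ℂ}
    (h : ∀ r < d, Tendsto (fun m : ℕ => (m : ℂ)⁻¹ * ∑ a ∈ Finset.range m, z (a * d + r)) atTop
      (𝓝 L)) :
    Tendsto (fun n : ℕ => (n : ℂ)⁻¹ * ∑ k ∈ Finset.range n, z k) atTop (𝓝 L) := by
  have hd0 : (d : ℂ) ≠ 0 := by exact_mod_cast (by omega : d ≠ 0)
  have hdr : (0 : ℝ) < d := by exact_mod_cast hd
  have h1 : Tendsto (fun q : ℕ => (q : ℂ)⁻¹ * ∑ k ∈ Finset.range (q * d), z k) atTop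
      (𝓝 (d * L)) := by
    simp_rw [sum_range_mul_eq, Finset.mul_sum _ _ ((_ : ℂ)⁻¹)]
    have h2 := tendsto_finsetSum (Finset.range d) fun r hr => h r (Finset.mem_range.1 hr)
    simpa [Finset.mul_sum] using h2
  have h2 := h1.comp (Nat.tendsto_div_const_atTop (by omega : d ≠ 0))
  have h3 : Tendsto (fun n : ℕ => ((n / d : ℕ) : ℝ) / n) atTop (𝓝 (1 / d : ℝ)) := by
    have h := (tendsto_nat_floor_mul_div_atTop (R := ℝ) (a := 1 / d) (by positivity)).comp
      tendsto_natCast_atTop_atTop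
    refine h.congr fun n => ?_
    simp only [Function.comp_apply]
    congr 2
    rw [one_div, inv_mul_eq_div, Nat.floor_div_natCast, Nat.floor_natCast]
  have h3' : Tendsto (fun n : ℕ => ((n / d : ℕ) : ℂ) / n) atTop (𝓝 (1 / d : ℂ)) := by
    have h := (Complex.continuous_ofReal.tendsto _).comp h3
    simpa [Function.comp_def] using h
  -- Fewer than d bounded terms remain after the last complete period.
  have h4 : Tendsto (fun n : ℕ => (n : ℂ)⁻¹ * ∑ k ∈ Finset.Ico (n / d * d) n, z k) atTop (𝓝 0) := by
    have hb : Tendsto (fun n : ℕ => (n : ℝ)⁻¹ * (d * C)) atTop (𝓝 0) := by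
      simpa using (tendsto_inv_atTop_nhds_zero_nat (𝕜 := ℝ)).mul_const (d * C)
    refine squeeze_zero_norm (fun n => ?_) hb
    rw [norm_mul, norm_inv, Complex.norm_natCast]
    refine mul_le_mul_of_nonneg_left ((norm_sum_le _ _).trans
      ((Finset.sum_le_sum fun k _ => hz k).trans ?_)) (by positivity)
    rw [Finset.sum_const, Nat.card_Ico, nsmul_eq_mul]
    refine mul_le_mul_of_nonneg_right ?_ ((norm_nonneg _).trans (hz 0))
    have := Nat.div_add_mod' n d
    have := Nat.mod_lt n (by omega : 0 < d)
    exact_mod_cast (by omega : n - n / d * d ≤ d)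
  have h5 := (h3'.mul h2).add h4
  rw [add_zero, one_div, inv_mul_cancel_left₀ hd0] at h5
  refine h5.congr' ?_
  filter_upwards [eventually_ge_atTop d] with n hn
  have hn0 : (n : ℂ) ≠ 0 := by exact_mod_cast (by omega : n ≠ 0)
  have hq0 : ((n / d : ℕ) : ℂ) ≠ 0 := by
    exact_mod_cast (Nat.div_pos hn (by omega)).ne'
  simp only [Function.comp_apply]
  rw [← Finset.sum_range_add_sum_Ico _ (Nat.div_mul_le_self n d), mul_add]
  congr 1
  field_simp

omit [IsProbabilityMeasure μ] in
lemma ae_tendsto_empJoint (hX : ∀ k, Measurable (X k)) (hlaw : ∀ k, P.map (X k) = μ)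
    (hindep : iIndepFun X P) (t : BlockSpace p) :
    ∀ᵐ ω ∂P, Tendsto (fun n => empJoint p n (fun k => X k ω) t) atTop (𝓝 (charFun μ t)) := by
  have h := ae_tendsto_inv_mul_sum hX hlaw hindep (measurable_expInner_right t)
    (fun x => (norm_expInner t x).le)
  have e : ∫ x, expInner t x ∂μ = charFun μ t := by
    rw [charFun_apply]
    simp_rw [real_inner_comm]
    rfl
  rw [e] at h
  exact h

omit [IsProbabilityMeasure μ] in
lemma ae_tendsto_empProd (hX : ∀ k, Measurable (X k)) (hlaw : ∀ k, P.map (X k) = μ)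
    (hindep : iIndepFun X P) (t : BlockSpace p) :
    ∀ᵐ ω ∂P, Tendsto (fun n => empProd p n (fun k => X k ω) t) atTop
      (𝓝 (∏ j, marginalCharFun p μ j (t j))) := by
  have h : ∀ j, ∀ᵐ ω ∂P, Tendsto (fun n : ℕ => (n : ℂ)⁻¹ * ∑ k ∈ Finset.range n,
      expInner (t j) (X k ω j)) atTop (𝓝 (marginalCharFun p μ j (t j))) := fun j => by
    have hb : ∀ x : BlockSpace p, ‖expInner (t j) (x j)‖ ≤ 1 := fun x => (norm_expInner _ _).le
    have hm := measurable_expInner_block t j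
    have e := marginalCharFun_eq (μ := μ) j (t j)
    generalize marginalCharFun p μ j (t j) = L at e ⊢
    have h := ae_tendsto_inv_mul_sum hX hlaw hindep hm hb
    rw [e]
    simpa only using h
  filter_upwards [ae_all_iff.2 h] with ω hω
  have := tendsto_finsetProd Finset.univ fun j _ => hω j
  simpa only [empProd] using this

omit [IsProbabilityMeasure μ] [IsProbabilityMeasure P] in
-- The factors read different sample points, so independence of the sample is enough and the blocks
-- of one point may be dependent.
lemma integral_prod_comp_succ (hX : ∀ k, Measurable (X k)) (hlaw : ∀ k, P.map (X k) = μ)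
    (hindep : iIndepFun X P) {f : Fin d → BlockSpace p → ℂ} (hf : ∀ j, Measurable (f j)) (r : ℕ) :
    ∫ ω, ∏ j : Fin d, f j (X (r + j) ω) ∂P = ∏ j, ∫ x, f j x ∂μ := by
  have h1 : iIndepFun (fun (j : Fin d) ω => X (r + j) ω) P :=
    hindep.precomp (g := fun j : Fin d => r + (j : ℕ)) fun i j h => Fin.ext (by simpa using h)
  rw [h1.integral_fun_prod_comp (fun j => (hX _).aemeasurable)
    fun j => (hf j).aestronglyMeasurable]
  refine Finset.prod_congr rfl fun j _ => ?_
  rw [← hlaw (r + j), integral_map (hX _).aemeasurable (hf j).aestronglyMeasurable]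

omit [IsProbabilityMeasure μ] [IsProbabilityMeasure P] in
lemma integral_prod_expInner_succ (hX : ∀ k, Measurable (X k)) (hlaw : ∀ k, P.map (X k) = μ)
    (hindep : iIndepFun X P) (t : BlockSpace p) (r : ℕ) :
    ∫ ω, ∏ j : Fin d, expInner (t j) (X (r + j) ω j) ∂P = ∏ j, marginalCharFun p μ j (t j) := by
  have h := integral_prod_comp_succ hX hlaw hindep (measurable_expInner_block t) r
  simp_rw [marginalCharFun_eq]
  simpa only using h

/-- A shifted point reads d consecutive observations. Along each residue class modulo d these
windows are disjoint, so the strong law applies; cyclic wrap-around touches at most d terms. No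
independence of the blocks is needed. -/
lemma ae_tendsto_empShifted (hd : 1 ≤ d) (hX : ∀ k, Measurable (X k))
    (hlaw : ∀ k, P.map (X k) = μ) (hindep : iIndepFun X P) (t : BlockSpace p) :
    ∀ᵐ ω ∂P, Tendsto (fun n => empShifted p n (fun k => X k ω) t) atTop
      (𝓝 (∏ j, marginalCharFun p μ j (t j))) := by
  set z : ℕ → Ω → ℂ := fun k ω => ∏ j : Fin d, expInner (t j) (X (k + j) ω j) with hz
  have hz1 : ∀ k ω, ‖z k ω‖ ≤ 1 := fun k ω => norm_prod_le_one _ fun j => (norm_expInner _ _).le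
  have hres : ∀ r : ℕ, ∀ᵐ ω ∂P, Tendsto (fun m : ℕ => (m : ℂ)⁻¹ *
      ∑ a ∈ Finset.range m, z (a * d + r) ω) atTop (𝓝 (∏ j, marginalCharFun p μ j (t j))) := by
    intro r
    obtain ⟨hI, hL⟩ := iIndepFun_consecutive_blocks (X := fun k => X (k + r)) (μ := μ) (P := P)
      (fun k => hX _) (fun k => hlaw _)
      (hindep.precomp (g := fun k => k + r) (add_left_injective r)) d
    have hG : Measurable fun y : Fin d → BlockSpace p => ∏ j, expInner (t j) (y j j) :=
      Finset.measurable_prod _ fun j _ => (measurable_expInner_block t j).comp (measurable_pi_apply j)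
    have hm : ∀ a, Measurable fun ω (i : Fin d) => X (a * d + i + r) ω := fun a =>
      measurable_pi_lambda _ fun i => hX _
    have h := ae_tendsto_inv_mul_sum hm hL hI hG
      (fun y => norm_prod_le_one _ fun j => (norm_expInner (t j) (y j j)).le)
    have e : ∫ y : Fin d → BlockSpace p, ∏ j, expInner (t j) (y j j) ∂(Measure.pi fun _ => μ) =
        ∏ j, marginalCharFun p μ j (t j) := by
      rw [← hL 0, integral_map (hm 0).aemeasurable hG.aestronglyMeasurable,
        ← integral_prod_expInner_succ hX hlaw hindep t r]
      refine integral_congr_ae (ae_of_all _ fun ω => Finset.prod_congr rfl fun j _ => ?_)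
      simp only [zero_mul, zero_add]
      rw [add_comm]
    rw [e] at h
    filter_upwards [h] with ω hω
    refine hω.congr fun m => ?_
    simp only [hz, add_right_comm]
  filter_upwards [ae_all_iff.2 hres] with ω hω
  have h1 := tendsto_inv_mul_sum_of_residues hd (z := fun k => z k ω) (fun k => hz1 k ω)
    fun r _ => hω r
  have h2 : Tendsto (fun n : ℕ => (n : ℂ)⁻¹ * ∑ k ∈ Finset.range n,
      (expInner t (shiftedPoint p n (fun k => X k ω) k) - z k ω)) atTop (𝓝 0) := by
    have hb : Tendsto (fun n : ℕ => (n : ℝ)⁻¹ * (d * 2)) atTop (𝓝 0) := by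
      simpa using (tendsto_inv_atTop_nhds_zero_nat (𝕜 := ℝ)).mul_const ((d : ℝ) * 2)
    refine squeeze_zero_norm (fun n => ?_) hb
    rw [norm_mul, norm_inv, Complex.norm_natCast]
    refine mul_le_mul_of_nonneg_left ?_ (by positivity)
    -- Only starting indices among the last d can wrap around; elsewhere the cyclic and the plain
    -- shift coincide.
    have hk : ∀ k ∈ Finset.range n, ‖expInner t (shiftedPoint p n (fun k => X k ω) k) - z k ω‖ ≤
        if n - d ≤ k then 2 else 0 := fun k hk => by
      have hkn := Finset.mem_range.1 hk
      split_ifs with hc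
      · refine (norm_sub_le _ _).trans ?_
        rw [norm_expInner]
        linarith [hz1 k ω]
      · have : expInner t (shiftedPoint p n (fun k => X k ω) k) = z k ω := by
          rw [expInner_blocks]
          refine Finset.prod_congr rfl fun j _ => ?_
          have hj := j.2
          simp only [shiftedPoint]
          rw [Nat.mod_eq_of_lt (by omega : k + (j : ℕ) < n)]
        rw [this, sub_self, norm_zero]
    refine (norm_sum_le _ _).trans ((Finset.sum_le_sum hk).trans ?_)
    rw [← Finset.sum_filter, Finset.sum_const, nsmul_eq_mul]
    refine mul_le_mul_of_nonneg_right ?_ zero_le_two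
    have : (Finset.range n).filter (fun k => n - d ≤ k) ⊆ Finset.Ico (n - d) n := fun k hk => by
      simp only [Finset.mem_filter, Finset.mem_range, Finset.mem_Ico] at hk ⊢
      omega
    have hc := Finset.card_le_card this
    rw [Nat.card_Ico] at hc
    exact_mod_cast hc.trans (by omega)
  have h3 := h2.add h1
  rw [zero_add] at h3
  refine h3.congr fun n => ?_
  rw [Finset.sum_sub_distrib]
  unfold empShifted
  ring

end LargeNumbers

/-! ### Divergence under dependence -/

section Alternative

variable {d : ℕ} {p : Fin d → ℕ} {μ : Measure (BlockSpace p)} [IsProbabilityMeasure μ]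
  {Ω : Type*} [MeasurableSpace Ω] {P : Measure Ω} [IsProbabilityMeasure P]
  {X : ℕ → Ω → BlockSpace p}

/-- The difference between the joint characteristic function and the product of the marginal
ones. -/
noncomputable def charFunDefect {d : ℕ} (p : Fin d → ℕ) (μ : Measure (BlockSpace p))
    (t : BlockSpace p) : ℂ :=
  charFun μ t - ∏ j, marginalCharFun p μ j (t j)

lemma continuous_charFunDefect : Continuous (charFunDefect p μ) := by
  have h : ∀ j, Continuous fun t : BlockSpace p => marginalCharFun p μ j (t j) := fun j => by
    have : IsProbabilityMeasure (μ.map (fun x : BlockSpace p => x j)) :=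
      Measure.isProbabilityMeasure_map (measurable_blockSpace_eval j).aemeasurable
    have h1 : Continuous (marginalCharFun p μ j) := continuous_charFun
    exact h1.comp (by fun_prop)
  exact continuous_charFun.sub (continuous_finsetProd _ fun j _ => h j)

/-- Characteristic functions determine laws, so factorisation at every t is independence. -/
lemma iIndepFun_of_charFunDefect_eq_zero (h : charFunDefect p μ = 0) :
    iIndepFun (fun (j : Fin d) (x : BlockSpace p) => x j) μ := by
  rw [iIndepFun_iff_charFun_pi fun j => (measurable_blockSpace_eval j).aemeasurable]
  intro t
  have ht := congrFun h t
  have e : (fun x : BlockSpace p => WithLp.toLp 2 fun j => x j) = id := rfl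
  rw [e, Measure.map_id]
  exact sub_eq_zero.1 ht

/-- If the integral vanished, the defect would be zero almost everywhere, hence everywhere by
continuity, and the blocks would be independent. The extended integral is used so that its
finiteness need not be known. -/
lemma lintegral_weightedSq_charFunDefect_pos (hd : 1 ≤ d) (hp : ∀ j, 1 ≤ p j)
    (hμ : ¬ iIndepFun (fun (j : Fin d) (x : BlockSpace p) => x j) μ) :
    0 < ∫⁻ t, ENNReal.ofReal (weightedSq p (charFunDefect p μ) t) := by
  rw [pos_iff_ne_zero]
  intro h0
  have hm : Measurable fun t => ENNReal.ofReal (weightedSq p (charFunDefect p μ) t) :=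
    ((continuous_charFunDefect.measurable.norm.pow_const 2).mul
      measurable_weightOne).ennreal_ofReal
  rw [lintegral_eq_zero_iff hm] at h0
  refine hμ (iIndepFun_of_charFunDefect_eq_zero ?_)
  have hz : charFunDefect p μ 0 = 0 := by
    unfold charFunDefect
    have h1 : ∀ j, marginalCharFun p μ j 0 = 1 := fun j => by
      rw [marginalCharFun_eq]
      simp [expInner]
    simp [h1]
  have hae : charFunDefect p μ =ᵐ[volume] fun _ => (0 : ℂ) := by
    filter_upwards [h0] with t ht
    by_cases h : t = 0
    · rw [h]; exact hz
    · have hw := weightOne_pos hd hp h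
      simp only [Pi.zero_apply, ENNReal.ofReal_eq_zero, weightedSq] at ht
      have h1 : ‖charFunDefect p μ t‖ ^ 2 ≤ 0 := nonpos_of_mul_nonpos_left ht hw
      have h2 : ‖charFunDefect p μ t‖ ^ 2 = 0 := le_antisymm h1 (sq_nonneg _)
      exact norm_eq_zero.1 (pow_eq_zero_iff two_ne_zero |>.1 h2)
  exact (Continuous.ae_eq_iff_eq (volume : Measure (BlockSpace p)) continuous_charFunDefect
    continuous_const).1 hae

/-- Fatou's lemma for the weighted norms. -/
lemma tendsto_mul_weightedNormSq_atTop {D : ℕ → BlockSpace p → ℂ} (hD : ∀ n, Measurable (D n))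
    (hi : ∀ n, n ≠ 0 → Integrable (weightedSq p (D n))) {η : BlockSpace p → ℂ}
    (hlim : ∀ᵐ t, Tendsto (fun n => D n t) atTop (𝓝 (η t)))
    (hη : 0 < ∫⁻ t, ENNReal.ofReal (weightedSq p η t)) :
    Tendsto (fun n : ℕ => (n : ℝ) * weightedNormSq p (D n)) atTop atTop := by
  have h1 : ∫⁻ t, ENNReal.ofReal (weightedSq p η t) ≤
      liminf (fun n => ∫⁻ t, ENNReal.ofReal (weightedSq p (D n) t)) atTop := by
    refine le_trans (lintegral_mono_ae ?_) (lintegral_liminf_le fun n =>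
      (((hD n).norm.pow_const 2).mul measurable_weightOne).ennreal_ofReal)
    filter_upwards [hlim] with t ht
    have h := ENNReal.tendsto_ofReal ((ht.norm.pow 2).mul_const (weightOne p t))
    exact h.liminf_eq.ge
  -- Any finite δ strictly between 0 and the limit integral is eventually a lower bound for the
  -- weighted norms, and n δ tends to infinity.
  obtain ⟨δ, hδ0, hδ⟩ := ENNReal.lt_iff_exists_nnreal_btwn.1 hη
  have hδ0' : (0 : ℝ) < δ := by exact_mod_cast hδ0
  have h2 := eventually_lt_of_lt_liminf (hδ.trans_le h1)
  have h3 : Tendsto (fun n : ℕ => (n : ℝ) * δ) atTop atTop :=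
    tendsto_natCast_atTop_atTop.atTop_mul_const hδ0'
  refine tendsto_atTop_mono' _ ?_ h3
  filter_upwards [h2, eventually_ge_atTop 1] with n hn hn1
  refine mul_le_mul_of_nonneg_left ?_ n.cast_nonneg
  rw [← ofReal_integral_eq_lintegral_ofReal (hi n (by omega))
    (ae_of_all _ fun t => mul_nonneg (sq_nonneg _) (weightOne_nonneg t))] at hn
  rw [← ENNReal.ofReal_coe_nnreal] at hn
  exact (ENNReal.ofReal_lt_ofReal_iff'.1 hn).1.le

/-- Convergence almost surely for each t is turned by Fubini into convergence for almost every t,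
almost surely; this is what Fatou's lemma requires. -/
lemma ae_tendsto_mul_weightedNormSq_atTop (hd : 1 ≤ d) (hp : ∀ j, 1 ≤ p j)
    (hμ : ¬ iIndepFun (fun (j : Fin d) (x : BlockSpace p) => x j) μ) (hX : ∀ k, Measurable (X k))
    {D : ℕ → (ℕ → BlockSpace p) → BlockSpace p → ℂ}
    (hD : ∀ n, Measurable fun z : BlockSpace p × (ℕ → BlockSpace p) => D n z.2 z.1)
    (hi : ∀ n, n ≠ 0 → ∀ x, Integrable (weightedSq p (D n x)))
    (hlim : ∀ t, ∀ᵐ ω ∂P, Tendsto (fun n => D n (fun k => X k ω) t) atTop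
      (𝓝 (charFunDefect p μ t))) :
    ∀ᵐ ω ∂P, Tendsto (fun n : ℕ => (n : ℝ) * weightedNormSq p (D n fun k => X k ω))
      atTop atTop := by
  have hDX : ∀ n, Measurable fun z : BlockSpace p × Ω => D n (fun k => X k z.2) z.1 := fun n => by
    simpa only [one_mul] using measurable_sample_process (hD n) hX 1
  have hs : MeasurableSet {z : BlockSpace p × Ω | Tendsto (fun n => D n (fun k => X k z.2) z.1)
      atTop (𝓝 (charFunDefect p μ z.1))} :=
    measurableSet_tendsto_fun hDX (continuous_charFunDefect.measurable.comp measurable_fst)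
  have h := (Measure.ae_ae_comm (μ := (volume : Measure (BlockSpace p))) (ν := P)
    (p := fun t ω => Tendsto (fun n => D n (fun k => X k ω) t) atTop
      (𝓝 (charFunDefect p μ t))) hs).1 (ae_of_all _ hlim)
  filter_upwards [h] with ω hω
  exact tendsto_mul_weightedNormSq_atTop (fun n => (hDX n).comp measurable_prodMk_right)
    (fun n hn => hi n hn _) hω (lintegral_weightedSq_charFunDefect_pos hd hp hμ)

end Alternative

/-! ### The main theorem -/

theorem mainTheorem5 {d : ℕ} (hd : 1 ≤ d) (p : Fin d → ℕ) (hp : ∀ j, 1 ≤ p j)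
    -- the law `μ` of `X = (X_1, …, X_d)`, with `E|X| < ∞`
    (μ : Measure (BlockSpace p)) [IsProbabilityMeasure μ]
    (hμ : Integrable (fun x : BlockSpace p => ‖x‖) μ)
    -- the i.i.d. sample from `μ`
    {Ω : Type*} [MeasurableSpace Ω] (P : Measure Ω) [IsProbabilityMeasure P]
    (X : ℕ → Ω → BlockSpace p) (hlaw : ∀ k, HasLaw (X k) μ P) (hindep : iIndepFun X P) :
    -- the integrals defining `Q_n` and `Q_n⋆` exist
    (∀ n : ℕ, 1 ≤ n → ∀ ω : Ω,
      Integrable (weightedSq p (diffComplete p n (fun k => X k ω))) ∧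
      Integrable (weightedSq p (diffSimplified p n (fun k => X k ω)))) ∧
    -- under mutual independence of the components
    (iIndepFun (fun (j : Fin d) (x : BlockSpace p) => x j) μ →
      -- the Gaussian processes `ζ` and `ζ⋆` exist
      (∃ (Ω' : Type) (_ : MeasurableSpace Ω') (P' : Measure Ω') (_ : IsProbabilityMeasure P')
        (ζ : BlockSpace p → Ω' → ℂ), IsHermitianGaussianProcess ζ P' (limitCov p μ)) ∧
      (∃ (Ω' : Type) (_ : MeasurableSpace Ω') (P' : Measure Ω') (_ : IsProbabilityMeasure P')
        (ζ : BlockSpace p → Ω' → ℂ),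
          IsHermitianGaussianProcess ζ P' (fun t t₀ => 2 * limitCov p μ t t₀)) ∧
      -- `n Q_n` converges in distribution to `‖ζ‖²_{w₁}`, which is a.s. finite
      (∀ (Ω' : Type*) [MeasurableSpace Ω'] (P' : Measure Ω') [IsProbabilityMeasure P']
        (ζ : BlockSpace p → Ω' → ℂ), IsHermitianGaussianProcess ζ P' (limitCov p μ) →
          (∀ᵐ ω' ∂P', Integrable (weightedSq p (fun t => ζ t ω'))) ∧
          TendstoInDistribution
            (fun (n : ℕ) (ω : Ω) => (n : ℝ) * completeMeasure p n (fun k => X k ω)) atTop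
            (fun ω' => weightedNormSq p (fun t => ζ t ω')) (fun _ => P) P') ∧
      -- `n Q_n⋆` converges in distribution to `‖ζ⋆‖²_{w₁}`, which is a.s. finite
      (∀ (Ω' : Type*) [MeasurableSpace Ω'] (P' : Measure Ω') [IsProbabilityMeasure P']
        (ζ : BlockSpace p → Ω' → ℂ),
          IsHermitianGaussianProcess ζ P' (fun t t₀ => 2 * limitCov p μ t t₀) →
          (∀ᵐ ω' ∂P', Integrable (weightedSq p (fun t => ζ t ω'))) ∧
          TendstoInDistribution
            (fun (n : ℕ) (ω : Ω) => (n : ℝ) * simplifiedMeasure p n (fun k => X k ω)) atTop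
            (fun ω' => weightedNormSq p (fun t => ζ t ω')) (fun _ => P) P')) ∧
    -- when the components are not mutually independent
    (¬ iIndepFun (fun (j : Fin d) (x : BlockSpace p) => x j) μ →
      (∀ᵐ ω ∂P, Tendsto (fun n : ℕ => (n : ℝ) * completeMeasure p n (fun k => X k ω))
        atTop atTop) ∧
      (∀ᵐ ω ∂P, Tendsto (fun n : ℕ => (n : ℝ) * simplifiedMeasure p n (fun k => X k ω))
        atTop atTop)) := by
  -- `HasLaw` gives only almost everywhere measurability. The sample is replaced by measurable
  -- versions, which almost surely agree with it at all indices simultaneously.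
  have hex : ∀ k, ∃ Y : Ω → BlockSpace p, Measurable Y ∧ Y =ᵐ[P] X k := fun k =>
    ⟨(hlaw k).aemeasurable.mk (X k), (hlaw k).aemeasurable.measurable_mk,
      (hlaw k).aemeasurable.ae_eq_mk.symm⟩
  choose Y hY hYX using hex
  have hYlaw : ∀ k, P.map (Y k) = μ := fun k =>
    (Measure.map_congr (hYX k)).trans (hlaw k).map_eq
  have hYindep : iIndepFun Y P := hindep.congr fun k => (hYX k).symm
  have hall : ∀ᵐ ω ∂P, (fun k => Y k ω) = fun k => X k ω := by
    filter_upwards [ae_all_iff.2 hYX] with ω hω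
    exact funext hω
  refine ⟨fun n hn ω => ⟨integrable_weightedSq_diffComplete hd hp (by omega) _,
    integrable_weightedSq_diffSimplified hd hp (by omega) _⟩, fun hI => ⟨?_, ?_, ?_, ?_⟩,
    fun hI => ⟨?_, ?_⟩⟩
  · simpa using exists_isHermitianGaussianProcess_limitCov hI zero_le_one
  · simpa using exists_isHermitianGaussianProcess_limitCov hI zero_le_two
  · intro Ω' _ P' _ ζ hζ
    obtain ⟨h1, h2⟩ := tendstoInDistribution_completeMeasure hd hp hμ hY hYlaw hYindep hI hζ
    refine ⟨h1, h2.congr (fun n => ?_) EventuallyEq.rfl⟩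
    filter_upwards [hall] with ω hω
    rw [hω]
  · intro Ω' _ P' _ ζ hζ
    obtain ⟨h1, h2⟩ := tendstoInDistribution_simplifiedMeasure hd hp hμ hY hYlaw hYindep hI hζ
    refine ⟨h1, h2.congr (fun n => ?_) EventuallyEq.rfl⟩
    filter_upwards [hall] with ω hω
    rw [hω]
  · have h := ae_tendsto_mul_weightedNormSq_atTop (P := P) hd hp hI hY (D := diffComplete p)
      measurable_diffComplete
      (fun n hn x => integrable_weightedSq_diffComplete hd hp hn x) fun t => by
        filter_upwards [ae_tendsto_empJoint hY hYlaw hYindep t,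
          ae_tendsto_empProd hY hYlaw hYindep t] with ω h1 h2
        exact h1.sub h2
    filter_upwards [h, hall] with ω h1 h2
    simp only [h2] at h1
    exact h1
  · have h := ae_tendsto_mul_weightedNormSq_atTop (P := P) hd hp hI hY (D := diffSimplified p)
      measurable_diffSimplified
      (fun n hn x => integrable_weightedSq_diffSimplified hd hp hn x) fun t => by
        filter_upwards [ae_tendsto_empJoint hY hYlaw hYindep t,
          ae_tendsto_empShifted hd hY hYlaw hYindep t] with ω h1 h2
        exact h1.sub h2
    filter_upwards [h, hall] with ω h1 h2
    simp only [h2] at h1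
    exact h1
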